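/- **Setting.** Let $\mathcal S,\mathcal A$ be finite, $|\mathcal A|\ge 2$, $\gamma\in(0,1)$, $\mathcal P(s'|s,a)$ a transition kernel and $c(s,a)$ a cost with $|c|\le\bar c$. For each $s$ let $h(s)$ be a closed convex function on the simplex $\Delta_{|\mathcal A|}$ with values in $\mathbb R\cup\{+\infty\}$ and closed convex domain $X_s$, $|h|\le\bar h$ on $X_s$; a policy $\pi$ is feasible if $\pi(\cdot|s)\in X_s$ for all $s$, and $h^\pi(s)$ is $h(s)$ at $\pi(\cdot|s)$. Let $\pi_0$ be the uniform policy, assumed feasible, and $D_{\pi'}^\pi(s)=\mathrm{KL}(\pi(\cdot|s)\,\|\,\pi'(\cdot|s))$. For $\tau\ge0$, $$Q_\tau^\pi(s,a)=\mathbb E\Big[\sum_{t\ge0}\gamma^t\big(c(s_t,a_t)+h^\pi(s_t)+\tau D_{\pi_0}^\pi(s_t)\big)\,\Big|\,s_0=s,\,a_0=a\Big]\ \text{under }\pi,\qquad V_\tau^\pi(s)=\sum_a\pi(a|s)Q_\tau^\pi(s,a),$$ $V^\pi=V^\pi_0$. Let $\pi^*$ be a feasible policy minimizing $V^\pi(s)$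 over feasible $\pi$ for all $s$ simultaneously, $\nu^*$ its stationary distribution, $f(\pi)=\mathbb E_{s\sim\nu^*}[V^\pi(s)]$. Assume that for some $\underline\pi>0$ every feasible policy satisfies $\pi(a|s)\ge\underline\pi$ for all $s,a$, and that every feasible policy induces an irreducible aperiodic state chain, with stationary distribution $\nu(\pi)$. Put $M^\pi=\mathrm{Diag}(\nu(\pi)(s)\pi(a|s))$, $\Lambda_{\min}=(1-\gamma)\inf_\pi\lambda_{\min}(M^\pi)$, $\Lambda_{\max}=(1-\gamma)\sup_\pi\lambda_{\max}(M^\pi)$ (over feasible $\pi$). **CTD.** For $z=(s,a)$, $z'=(s',a')$ let $\tilde F^\pi_\tau(\theta,(z,z'))=\big(\theta(z)-c(z)-h^\pi(s)-\tau D^\pi_{\pi_0}(s)-\gamma\theta(z')\big)e_z$, and $F_\tau^\pi(\theta)=M^\pi(\theta-T_\tau^\pi\theta)$ with $T_\tau^\pi$ the Bellman operator of $Q_\tau^\pi$. CTD with parameters $T,\alpha,\beta_t$ starts at $\theta_1=0$ and for $t=1,\dots,T$ collects $\alpha$ successive transitions under $\pi$ and sets $\theta_{t+1}=\theta_t-\beta_t\tilde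 F_\tau^\pi(\theta_t,\zeta_t^\alpha)$, $\zeta_t^\alpha$ being the last of these transitions; it returns $\theta_{T+1}$. Call $C>0$, $\rho\in(0,1)$ *mixing constants* if for all feasible $\pi$, all $\tau\ge 0$, all $\alpha\ge1$, all starting pairs $z$ and all $\theta$, $$\|F_\tau^\pi(\theta)-\mathbb E[\tilde F_\tau^\pi(\theta,\zeta^\alpha)\mid z]\|_2\le C\rho^\alpha\|\theta-Q_\tau^\pi\|_2 .$$ **SAPMD.** Starting from $\pi_0$, iteration $k=0,1,\dots$ computes an estimate $\hat Q_k$ of $Q_{\tau_k}^{\pi_k}$ by CTD for $\pi_k$, with all iterations using consecutive transitions of one single trajectory with arbitrary starting pair, and sets, for all $s$, $$\pi_{k+1}(\cdot|s)=\operatorname*{argmin}_{p\in X_s}\ \eta_k\big[\langle\hat Q_k(s,\cdot),p\rangle+h^p(s)+\tau_kD_{\pi_0}^p(s)\big]+D_{\pi_k}^p(s).$$ With $l=\lceil\log_\gamma\frac14\rceil$ put $\tau_k=\frac{1}{\sqrt{\gamma\log|\mathcal A|}}2^{-(\lfloor k/l\rfloor+1)}$, $\eta_k=\frac{1-\gamma}{\gamma\tau_k}$,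 $b=\bar c+\bar h+\tau_0\log|\mathcal A|$, $\bar\theta=\frac{b}{1-\gamma}$, $\Theta=\sup\{\|Q_\tau^\pi\|_2:\pi\text{ feasible},0\le\tau\le\tau_0\}$, $R^2=8\Theta^2+\frac{3(\Theta^2+2b^2)}{4(1+\gamma)^2}$, $\sigma_F^2=4(1+\gamma)^2R^2+\Theta^2+2b^2$, $t_0=8\max\{\Lambda_{\max}^2,8(1+\gamma)^2\}/\Lambda_{\min}^2$, $\beta_t=\frac{2}{\Lambda_{\min}(t+t_0-1)}$, $$T_k=t_0(3\bar\theta\,2^{\lfloor k/l\rfloor+2})^{2/3}+(4t_0^2\bar\theta^2\,4^{\lfloor k/l\rfloor+2})^{1/2}+24\sigma_F^2\Lambda_{\min}^{-2}\,4^{\lfloor k/l\rfloor+2},$$ $$\alpha_k=\max\Big\{2(\lfloor\tfrac kl\rfloor+2)\log_\rho\tfrac12+\log_\rho\tfrac{\Lambda_{\min}}{24CR^2},\ (\lfloor\tfrac kl\rfloor+2)\log_\rho\tfrac12+\log_\rho\tfrac{\Lambda_{\min}}{3CR^2}\Big\};$$ iteration $k$ runs CTD with $\lceil T_k\rceil$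 updates, $\max\{1,\lceil\alpha_k\rceil\}$ transitions per update and learning rates $\beta_t$. **Proposition.** Mixing constants exist. For any mixing constants $C,\rho$ and all $k\ge0$, $$\mathbb E[f(\pi_k)-f(\pi^*)]\le2^{-\lfloor k/l\rfloor}\Big[f(\pi_0)-f(\pi^*)+\tfrac{3\sqrt{\log|\mathcal A|}}{(1-\gamma)\sqrt\gamma}+\tfrac{5}{2(1-\gamma)}\Big].$$ Consequently, an $\epsilon$-solution, i.e. $\bar\pi$ with $\mathbb E[f(\bar\pi)-f(\pi^*)]\le\epsilon$, is found in $O(\log_\gamma\epsilon)$ SAPMD iterations, and the total number of sampled pairs $(s_t,a_t)$ is $$O\Big\{\big(\log_\gamma\tfrac12\big)\big(\log_2\tfrac1\epsilon\big)\Big(\log_\rho\tfrac{\Lambda_{\min}}{CR^2}\Big)\Big(\frac{t_0\bar\theta}{(1-\gamma)\epsilon}+\frac{\sigma_F^2}{(1-\gamma)^2\Lambda_{\min}^2\epsilon^2}\Big)\Big\}.$$ Here the $O$-bounds mean: for every $\kappa\in(0,1)$ there is a constant $K$ depending only on $\kappa,\bar c,\bar h$ and $|\mathcal A|$ such that, whenever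 $\gamma\ge\kappa$ and $0<\epsilon\le\min\{1-\kappa,(1-\gamma)^\kappa\}$, some iterate $\pi_k$ with $k\le K\log_\gamma\epsilon$ is an $\epsilon$-solution and, if also $\rho\ge\kappa$ and $\Lambda_{\min}/(CR^2)\le1-\kappa$, the number of samples used to compute this $\pi_k$ is at most $K$ times the expression in braces. -/

import Mathlib

/-- A finite discounted Markov decision process with convex regularizers.
`P s a s'` is the probability of moving from `s` to `s'` under action `a`, `c` is the cost, `γ` the
discount factor.  The regularizer at state `s` is the closed convex extended-valued function of the
action distribution `p` which equals `h s p` for `p ∈ X s` and `+∞` for `p ∉ X s`; thus `X s` is the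
set of action distributions that are feasible at `s`. -/
structure RegMDP (S A : Type*) [Fintype S] [Fintype A] where
  P : S → A → S → ℝ
  P_mem : ∀ s a, P s a ∈ stdSimplex ℝ S
  c : S → A → ℝ
  γ : ℝ
  γ_pos : 0 < γ
  γ_lt_one : γ < 1
  X : S → Set (A → ℝ)
  X_subset : ∀ s, X s ⊆ stdSimplex ℝ A
  X_closed : ∀ s, IsClosed (X s)
  X_convex : ∀ s, Convex ℝ (X s)
  h : S → (A → ℝ) → ℝ
  h_convex : ∀ s, ConvexOn ℝ (X s) (h s)
  h_lsc : ∀ s, LowerSemicontinuousOn (h s) (X s)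

/-- The Kullback-Leibler divergence `KL(p ‖ q)`, i.e. the Bregman distance `D_q^p`. -/
noncomputable def klDist {A : Type*} [Fintype A] (p q : A → ℝ) : ℝ :=
  ∑ a, p a * Real.log (p a / q a)

/-- The uniform distribution, used as the initial policy at every state. -/
noncomputable def uniformDist (A : Type*) [Fintype A] : A → ℝ :=
  fun _ => 1 / (Fintype.card A : ℝ)

/-- The Euclidean norm of a finite real vector. -/
noncomputable def l2norm {ι : Type*} [Fintype ι] (x : ι → ℝ) : ℝ :=
  Real.sqrt (∑ i, x i ^ 2)

namespace RegMDP

variable {S A : Type*} [Fintype S] [Fintype A] [DecidableEq S] [DecidableEq A]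

/-- `π s a` is the probability of action `a` in state `s`; feasible policies have finite `h`. -/
def Feasible (M : RegMDP S A) (π : S → A → ℝ) : Prop :=
  ∀ s, π s ∈ M.X s

/-- Transition matrix of the state process `(s_t)` under the policy `π`. -/
noncomputable def stateMatrix (M : RegMDP S A) (π : S → A → ℝ) : Matrix S S ℝ :=
  Matrix.of fun s s' => ∑ a, π s a * M.P s a s'

/-- Transition matrix of the state-action process `(s_t, a_t)` under the policy `π`. -/
noncomputable def pairMatrix (M : RegMDP S A) (π : S → A → ℝ) : Matrix (S × A) (S × A) ℝ :=
  Matrix.of fun z z' => M.P z.1 z.2 z'.1 * π z'.1 z'.2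

/-- One-stage cost `c(s,a) + h^π(s) + τ D_{π₀}^π(s)`. -/
noncomputable def stageCost (M : RegMDP S A) (τ : ℝ) (π : S → A → ℝ) (z : S × A) : ℝ :=
  M.c z.1 z.2 + M.h z.1 (π z.1) + τ * klDist (π z.1) (uniformDist A)

/-- The perturbed action-value function `Q_τ^π(s,a)`: the expected total discounted cost from
`(s_0,a_0) = (s,a)`, the law of `(s_t,a_t)` being the row `(s,a)` of the `t`-th power of the
transition matrix.  `τ = 0` gives `Q^π`. -/
noncomputable def Q (M : RegMDP S A) (τ : ℝ) (π : S → A → ℝ) (z : S × A) : ℝ :=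
  ∑' t : ℕ, M.γ ^ t * ∑ z', (M.pairMatrix π ^ t) z z' * M.stageCost τ π z'

/-- The perturbed state-value function `V_τ^π(s)`.  `τ = 0` gives `V^π`. -/
noncomputable def V (M : RegMDP S A) (τ : ℝ) (π : S → A → ℝ) (s : S) : ℝ :=
  ∑ a, π s a * M.Q τ π (s, a)

/-- `π` minimizes the (unperturbed) value function at all states simultaneously. -/
def IsOptimal (M : RegMDP S A) (π : S → A → ℝ) : Prop :=
  M.Feasible π ∧ ∀ π', M.Feasible π' → ∀ s, M.V 0 π s ≤ M.V 0 π' s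

/-- `ν` is a stationary state distribution under the policy `π`. -/
def IsStationary (M : RegMDP S A) (π : S → A → ℝ) (ν : S → ℝ) : Prop :=
  ν ∈ stdSimplex ℝ S ∧ ∀ s', ∑ s, ν s * M.stateMatrix π s s' = ν s'

/-- The objective `f(π) = E_{s ∼ ν}[V^π(s)]`. -/
noncomputable def f (M : RegMDP S A) (ν : S → ℝ) (π : S → A → ℝ) : ℝ :=
  ∑ s, ν s * M.V 0 π s

/-- Regularity of the chains of feasible policies: action probabilities are bounded below by a
positive constant, and every feasible policy induces a single ergodic (irreducible and aperiodic)
class containing all states. -/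
def Regular (M : RegMDP S A) : Prop :=
  (∃ p₀ > 0, ∀ s, ∀ p ∈ M.X s, ∀ a, p₀ ≤ p a) ∧
    ∀ π, M.Feasible π → (M.stateMatrix π).IsPrimitive

/-- The eigenvalues `ν(π)(s) π(a|s)` of the diagonal weighting matrices
`M^π = Diag(ν(π)) ⊗ Diag(π)` of all feasible policies `π`. -/
def weights (M : RegMDP S A) : Set ℝ :=
  {x | ∃ π ν s a, M.Feasible π ∧ M.IsStationary π ν ∧ x = ν s * π s a}

/-- `Λ_min = (1-γ) λ_min(M^π)`, taken as the worst case over the feasible policies. -/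
noncomputable def Lmin (M : RegMDP S A) : ℝ := (1 - M.γ) * sInf M.weights

/-- `Λ_max = (1-γ) λ_max(M^π)`, taken as the worst case over the feasible policies. -/
noncomputable def Lmax (M : RegMDP S A) : ℝ := (1 - M.γ) * sSup M.weights

/-- Bellman operator of the policy `π` for the perturbed problem. -/
noncomputable def bellman (M : RegMDP S A) (τ : ℝ) (π : S → A → ℝ) (θ : S × A → ℝ) (z : S × A) : ℝ :=
  M.stageCost τ π z + M.γ * ∑ s', M.P z.1 z.2 s' * ∑ a', π s' a' * θ (s', a')

/-- The operator `F^π(θ) = M^π (θ - T^π θ)`, where `ν` is the stationary distribution of `π`. -/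
noncomputable def F (M : RegMDP S A) (τ : ℝ) (π : S → A → ℝ) (ν : S → ℝ) (θ : S × A → ℝ) :
    S × A → ℝ :=
  fun z => ν z.1 * π z.1 z.2 * (θ z - M.bellman τ π θ z)

/-- The stochastic operator at the transition from `z = (s_t,a_t)` to `z' = (s_{t+1},a_{t+1})`:
`(θ(z) - c(z) - h^π(s_t) - τ D_{π₀}^π(s_t) - γ θ(z')) e(z)`. -/
noncomputable def Ftilde (M : RegMDP S A) (τ : ℝ) (π : S → A → ℝ) (θ : S × A → ℝ) (z z' : S × A) :
    S × A → ℝ :=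
  Pi.single z (θ z - M.stageCost τ π z - M.γ * θ z')

/-- Conditional expectation of `Ftilde` at the `α`-th transition collected under `π` when the
collection starts from the pair `z` (the `i`-th transition leads from the `(i-1)`-st to the `i`-th
pair after `z`). -/
noncomputable def meanFtilde (M : RegMDP S A) (τ : ℝ) (π : S → A → ℝ) (θ : S × A → ℝ) (α : ℕ)
    (z : S × A) : S × A → ℝ :=
  fun y => ∑ z₁, (M.pairMatrix π ^ (α - 1)) z z₁ *
    ∑ z₂, M.pairMatrix π z₁ z₂ * M.Ftilde τ π θ z₁ z₂ y

/-- `C` and `ρ` are mixing constants of temporal difference learning: the bias of the stochastic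
operator at the `α`-th transition is at most `C ρ^α ‖θ - θ*‖₂` with `θ* = Q_τ^π`, uniformly over the
feasible policies, the starting pair and the parameters. -/
def MixingConst (M : RegMDP S A) (C ρ : ℝ) : Prop :=
  0 < C ∧ 0 < ρ ∧ ρ < 1 ∧
    ∀ π ν, M.Feasible π → M.IsStationary π ν → ∀ (τ : ℝ), 0 ≤ τ →
      ∀ (α : ℕ), 1 ≤ α → ∀ (z : S × A) (θ : S × A → ℝ),
        l2norm (M.F τ π ν θ - M.meanFtilde τ π θ α z) ≤ C * ρ ^ α * l2norm (θ - M.Q τ π)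

/-- The prox-mapping at state `s`: the minimizer over feasible `p` of
`η (⟨q, p⟩ + h^p(s) + τ D_{π₀}^p(s)) + D_{p₀}^p(s)`. -/
noncomputable def prox (M : RegMDP S A) (η τ : ℝ) (s : S) (q p₀ : A → ℝ) : A → ℝ :=
  Classical.epsilon fun p => p ∈ M.X s ∧ IsMinOn
    (fun p' => η * (∑ a, q a * p' a + M.h s p' + τ * klDist p' (uniformDist A)) + klDist p' p₀)
    (M.X s) p

end RegMDP

/-- Parameters of SAPMD with CTD evaluation: perturbations `τ k`, stepsizes `η k`, number `T k` of
CTD updates and number `α k` of transitions per CTD update in iteration `k`, and CTD learning rates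
`β t` (`t ≥ 1`). -/
structure Schedule where
  τ : ℕ → ℝ
  η : ℕ → ℝ
  T : ℕ → ℕ
  α : ℕ → ℕ
  β : ℕ → ℝ

/-- Number of samples (transitions of the single trajectory) used by the first `k` iterations. -/
def Schedule.samples (σ : Schedule) (k : ℕ) : ℕ :=
  ∑ j ∈ Finset.range k, σ.T j * σ.α j

namespace RegMDP

variable {S A : Type*} [Fintype S] [Fintype A] [DecidableEq S] [DecidableEq A]

/-- The CTD parameter vector in iteration `k` along the trajectory `w`, evaluating the policy `π`:
`ctd … t` is `θ_{t+1}`, so `θ_1 = 0`, and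
`θ_{t+1} = θ_t - β_t Ftilde(θ_t, ζ_t^α)`, where `ζ_t^α` is the last of the `α_k` transitions
collected before the update. -/
noncomputable def ctd (M : RegMDP S A) (σ : Schedule) (w : ℕ → S × A) (k : ℕ) (π : S → A → ℝ) :
    ℕ → (S × A → ℝ)
  | 0 => 0
  | t + 1 =>
      M.ctd σ w k π t - σ.β (t + 1) •
        M.Ftilde (σ.τ k) π (M.ctd σ w k π t)
          (w (σ.samples k + (t + 1) * σ.α k - 1)) (w (σ.samples k + (t + 1) * σ.α k))

/-- The SAPMD iterates `π_k` along the trajectory `w`; `π_0` is uniform and `π_{k+1}` results from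
the prox-mapping with the CTD estimate `θ_{T_k+1}` of `Q_{τ_k}^{π_k}`. -/
noncomputable def iter (M : RegMDP S A) (σ : Schedule) (w : ℕ → S × A) : ℕ → (S → A → ℝ)
  | 0 => fun _ => uniformDist A
  | k + 1 => fun s =>
      M.prox (σ.η k) (σ.τ k) s
        (fun a => M.ctd σ w k (M.iter σ w k) (σ.T k) (s, a)) (M.iter σ w k s)

/-- `Z` is a single trajectory `(s_n, a_n)` generated online by the algorithm: it starts anywhere
and, while iteration `k` is running, conditionally on the past, `s_{n+1} ∼ P(· | s_n, a_n)` and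
`a_{n+1} ∼ π_k(· | s_{n+1})`. -/
def IsTrajectory (M : RegMDP S A) (σ : Schedule) {Ω : Type*} [MeasurableSpace Ω]
    (ℙ : MeasureTheory.Measure Ω) (Z : ℕ → Ω → S × A) : Prop :=
  (∀ n z, MeasurableSet {x | Z n x = z}) ∧
    ∀ k n, σ.samples k ≤ n → n < σ.samples (k + 1) → ∀ w : ℕ → S × A,
      ℙ.real {x | ∀ i ≤ n + 1, Z i x = w i} =
        ℙ.real {x | ∀ i ≤ n, Z i x = w i} *
          (M.P (w n).1 (w n).2 (w (n + 1)).1 * M.iter σ w k (w (n + 1)).1 (w (n + 1)).2)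

/-- The epoch length `l = ⌈log_γ (1/4)⌉`. -/
noncomputable def epoch (M : RegMDP S A) : ℕ := ⌈Real.logb M.γ (1 / 4)⌉₊

/-- `τ_k = 2^{-(⌊k/l⌋+1)} / √(γ log |A|)`. -/
noncomputable def tau (M : RegMDP S A) (k : ℕ) : ℝ :=
  1 / Real.sqrt (M.γ * Real.log (Fintype.card A)) * (1 / 2) ^ (k / M.epoch + 1)

/-- The bound `c̄ + h̄ + τ_0 log |A|` on the perturbed one-stage cost. -/
noncomputable def costBound (M : RegMDP S A) (cbar hbar : ℝ) : ℝ :=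
  cbar + hbar + M.tau 0 * Real.log (Fintype.card A)

/-- `θ̄ = (c̄ + h̄ + τ_0 log |A|) / (1 - γ)`. -/
noncomputable def thetaBar (M : RegMDP S A) (cbar hbar : ℝ) : ℝ :=
  M.costBound cbar hbar / (1 - M.γ)

/-- The largest `‖θ*‖₂`, `θ* = Q_τ^π`, over the feasible policies `π` and `0 ≤ τ ≤ τ_0`. -/
noncomputable def thetaStar (M : RegMDP S A) : ℝ :=
  sSup {x | ∃ π τ, M.Feasible π ∧ 0 ≤ τ ∧ τ ≤ M.tau 0 ∧ x = l2norm (M.Q τ π)}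

/-- `R² = 8 ‖θ_1 - θ*‖₂² + 3 (‖θ*‖₂² + 2 (cost bound)²) / (4 (1+γ)²)` with `θ_1 = 0`. -/
noncomputable def Rsq (M : RegMDP S A) (cbar hbar : ℝ) : ℝ :=
  8 * M.thetaStar ^ 2 +
    3 * (M.thetaStar ^ 2 + 2 * M.costBound cbar hbar ^ 2) / (4 * (1 + M.γ) ^ 2)

/-- `σ_F² = 4 (1+γ)² R² + ‖θ*‖₂² + 2 (cost bound)²`. -/
noncomputable def sigmaFsq (M : RegMDP S A) (cbar hbar : ℝ) : ℝ :=
  4 * (1 + M.γ) ^ 2 * M.Rsq cbar hbar + M.thetaStar ^ 2 + 2 * M.costBound cbar hbar ^ 2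

/-- `t_0 = 8 max {Λ_max², 8 (1+γ)²} / Λ_min²`. -/
noncomputable def t0 (M : RegMDP S A) : ℝ :=
  8 * max (M.Lmax ^ 2) (8 * (1 + M.γ) ^ 2) / M.Lmin ^ 2

/-- The real number `T_k` of the number of CTD updates (before rounding up). -/
noncomputable def Treal (M : RegMDP S A) (cbar hbar : ℝ) (k : ℕ) : ℝ :=
  M.t0 * (3 * M.thetaBar cbar hbar * 2 ^ (k / M.epoch + 2)) ^ (2 / 3 : ℝ) +
    (4 * M.t0 ^ 2 * M.thetaBar cbar hbar ^ 2 * 4 ^ (k / M.epoch + 2)) ^ (1 / 2 : ℝ) +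
    24 * M.sigmaFsq cbar hbar / M.Lmin ^ 2 * 4 ^ (k / M.epoch + 2)

/-- The real number `α_k` of transitions per CTD update (before rounding up). -/
noncomputable def alphaReal (M : RegMDP S A) (cbar hbar C ρ : ℝ) (k : ℕ) : ℝ :=
  max
    (2 * ((k / M.epoch : ℕ) + 2) * Real.logb ρ (1 / 2) +
      Real.logb ρ (M.Lmin / (24 * C * M.Rsq cbar hbar)))
    (((k / M.epoch : ℕ) + 2) * Real.logb ρ (1 / 2) +
      Real.logb ρ (M.Lmin / (3 * C * M.Rsq cbar hbar)))

/-- The parameters: `τ_k`, `η_k = (1-γ)/(γ τ_k)`, `T_k` and `α_k` rounded up (and `α_k ≥ 1`),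
`β_t = 2 / (Λ_min (t + t_0 - 1))`. -/
noncomputable def schedule (M : RegMDP S A) (cbar hbar C ρ : ℝ) : Schedule where
  τ := M.tau
  η k := (1 - M.γ) / (M.γ * M.tau k)
  T k := ⌈M.Treal cbar hbar k⌉₊
  α k := max 1 ⌈M.alphaReal cbar hbar C ρ k⌉₊
  β t := 2 / (M.Lmin * (t + M.t0 - 1))

end RegMDP

/-! The proof combines a contraction of mirror descent in a suitable potential with a mean-square
bound for the temporal difference estimates.

Fix a feasible comparator `πs` with stationary distribution `ν`, and let the potential of `π` at
level `τ` be the `ν`-average of `V_τ^π - V_τ^πs` plus `τ/(1-γ)` times the `ν`-average of `KL(πs ‖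
π)`. The term `τ KL(· ‖ uniform)` makes the prox objective strongly convex relative to the entropy,
so its three-point inequality carries the factor `1 + ητ` in front of `KL(πs ‖ π_{k+1})`; the choice
of `η_k` makes this factor `1/γ`. Averaging the performance difference identity over `ν` turns the
gain of `πs` into `1-γ` times a value gap. Hence both parts of the potential shrink by `γ`, up to an
error `2d + d²/(γτ)`, where `d` is the Euclidean evaluation error (`mirror_step`).

The mean temporal difference operator is strongly monotone with modulus `Λ_min`, because the pair
distribution is stationary (`Lmin_mul_sq_le`). The schedule makes the sampling bias at most
`Λ_min/16`, so the squared error obeys a stochastic approximation recursion, and `T_k` updates bring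
its expectation below `4^{-(⌊k/l⌋+4)}` (`integral_sqError_le`). The estimates are uniform over
feasible policies, so they apply to the random `π_k`; conditioning reduces to finite sums over path
prefixes.

Lowering `τ` to `τ'` raises the potential by at most `(τ-τ') log|A|/(1-γ)`. An epoch of `l`
iterations contracts by `γ^l ≤ 1/4`, which is enough to halve the bound and absorb both the noise
and the change of `τ` (`epoch_recursion`, `convergence`). The complexities follow by taking `m`
whole epochs, `m` about `log₂(B/((1-γ)ε))`, and summing geometric series.

Mixing constants come from a Doeblin argument: a positive power of the uniform policy's state matrix
minorizes the same power for every feasible policy (`exists_minorization`). -/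

set_option linter.unusedSectionVars false

/-! ### Discounted sums of stochastic matrices, Euclidean norms and simplex averages -/

namespace Matrix

variable {ι : Type*} [Fintype ι] [DecidableEq ι]

lemma abs_sum_row_mul_le {P : Matrix ι ι ℝ} (hP : P ∈ rowStochastic ℝ ι) {g : ι → ℝ} {b : ℝ}
    (hg : ∀ j, |g j| ≤ b) (i : ι) : |∑ j, P i j * g j| ≤ b := by
  rw [mem_rowStochastic_iff_sum] at hP
  calc |∑ j, P i j * g j| ≤ ∑ j, |P i j * g j| := Finset.abs_sum_le_sum_abs _ _
    _ ≤ ∑ j, P i j * b := by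
        refine Finset.sum_le_sum fun j _ => ?_
        rw [abs_mul, abs_of_nonneg (hP.1 i j)]
        exact mul_le_mul_of_nonneg_left (hg j) (hP.1 i j)
    _ = b := by rw [← Finset.sum_mul, hP.2 i, one_mul]

lemma sum_row_mul_le {P : Matrix ι ι ℝ} (hP : P ∈ rowStochastic ℝ ι) {g : ι → ℝ} {b : ℝ}
    (hg : ∀ j, g j ≤ b) (i : ι) : ∑ j, P i j * g j ≤ b := by
  rw [mem_rowStochastic_iff_sum] at hP
  calc ∑ j, P i j * g j ≤ ∑ j, P i j * b :=
        Finset.sum_le_sum fun j _ => mul_le_mul_of_nonneg_left (hg j) (hP.1 i j)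
    _ = b := by rw [← Finset.sum_mul, hP.2 i, one_mul]

lemma summable_discounted {P : Matrix ι ι ℝ} (hP : P ∈ rowStochastic ℝ ι) {γ : ℝ} (h0 : 0 ≤ γ)
    (h1 : γ < 1) (g : ι → ℝ) (i : ι) : Summable fun t : ℕ => γ ^ t * ∑ j, (P ^ t) i j * g j := by
  refine Summable.of_norm_bounded (g := fun t : ℕ => γ ^ t * ∑ j, |g j|)
    ((summable_geometric_of_lt_one h0 h1).mul_right _) fun t => ?_
  rw [Real.norm_eq_abs, abs_mul, abs_of_nonneg (pow_nonneg h0 t)]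
  refine mul_le_mul_of_nonneg_left (abs_sum_row_mul_le (pow_mem hP t) (fun j => ?_) i)
    (pow_nonneg h0 t)
  exact Finset.single_le_sum (f := fun j => |g j|) (fun _ _ => abs_nonneg _) (Finset.mem_univ j)

/-- The discounted sum solves the Bellman equation. -/
lemma tsum_discounted_eq {P : Matrix ι ι ℝ} (hP : P ∈ rowStochastic ℝ ι) {γ : ℝ} (h0 : 0 ≤ γ)
    (h1 : γ < 1) (g : ι → ℝ) (i : ι) :
    ∑' t : ℕ, γ ^ t * ∑ j, (P ^ t) i j * g j =
      g i + γ * ∑ k, P i k * ∑' t : ℕ, γ ^ t * ∑ j, (P ^ t) k j * g j := by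
  rw [(summable_discounted hP h0 h1 g i).tsum_eq_zero_add]
  congr 1
  · simp [Matrix.one_apply]
  · simp_rw [← tsum_mul_left]
    rw [← Summable.tsum_finsetSum fun k _ =>
      (summable_discounted hP h0 h1 g k).mul_left (P i k), ← tsum_mul_left]
    refine tsum_congr fun t => ?_
    simp_rw [pow_succ' P, Matrix.mul_apply, Finset.sum_mul, Finset.mul_sum]
    rw [Finset.sum_comm]
    refine Finset.sum_congr rfl fun k _ => Finset.sum_congr rfl fun j _ => ?_
    ring

end Matrix

lemma l2norm_nonneg {ι : Type*} [Fintype ι] (x : ι → ℝ) : 0 ≤ l2norm x := Real.sqrt_nonneg _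

lemma l2norm_sq {ι : Type*} [Fintype ι] (x : ι → ℝ) : l2norm x ^ 2 = ∑ i, x i ^ 2 :=
  Real.sq_sqrt (Finset.sum_nonneg fun _ _ => sq_nonneg _)

lemma abs_le_l2norm {ι : Type*} [Fintype ι] (x : ι → ℝ) (i : ι) : |x i| ≤ l2norm x := by
  refine Real.abs_le_sqrt ?_
  exact Finset.single_le_sum (f := fun i => x i ^ 2) (fun _ _ => sq_nonneg _) (Finset.mem_univ i)

lemma sum_mul_le_l2norm {ι : Type*} [Fintype ι] (x y : ι → ℝ) :
    ∑ i, x i * y i ≤ l2norm x * l2norm y :=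
  Real.sum_mul_le_sqrt_mul_sqrt _ _ _

lemma l2norm_le_of_abs_le {ι : Type*} [Fintype ι] {x : ι → ℝ} {b : ℝ} (hb : 0 ≤ b)
    (h : ∀ i, |x i| ≤ b) : l2norm x ≤ Real.sqrt (Fintype.card ι) * b := by
  refine Real.sqrt_le_iff.2 ⟨by positivity, ?_⟩
  rw [mul_pow, Real.sq_sqrt (Nat.cast_nonneg _)]
  calc ∑ i, x i ^ 2 ≤ ∑ _i : ι, b ^ 2 :=
        Finset.sum_le_sum fun i _ => sq_le_sq' (abs_le.1 (h i)).1 (abs_le.1 (h i)).2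
    _ = Fintype.card ι * b ^ 2 := by simp

/-- An expectation under a probability vector is at most any upper bound. -/
lemma sum_simplex_mul_le {ι : Type*} [Fintype ι] {p : ι → ℝ} (hp : p ∈ stdSimplex ℝ ι) {g : ι → ℝ}
    {b : ℝ} (hg : ∀ i, g i ≤ b) : ∑ i, p i * g i ≤ b :=
  calc ∑ i, p i * g i ≤ ∑ i, p i * b :=
        Finset.sum_le_sum fun i _ => mul_le_mul_of_nonneg_left (hg i) (hp.1 i)
    _ = b := by rw [← Finset.sum_mul, hp.2, one_mul]

lemma le_sum_simplex_mul {ι : Type*} [Fintype ι] {p : ι → ℝ} (hp : p ∈ stdSimplex ℝ ι) {g : ι → ℝ}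
    {b : ℝ} (hg : ∀ i, b ≤ g i) : b ≤ ∑ i, p i * g i := by
  have := sum_simplex_mul_le hp (g := fun i => -g i) (b := -b) fun i => neg_le_neg (hg i)
  simp only [mul_neg, Finset.sum_neg_distrib] at this
  linarith

/-! ### Bellman equations and the performance difference identity -/

namespace RegMDP

variable {S A : Type*} [Fintype S] [Fintype A] [DecidableEq S] [DecidableEq A]
  (M : RegMDP S A) {π π' : S → A → ℝ} {τ : ℝ}

lemma Feasible.mem_stdSimplex {M : RegMDP S A} (hπ : M.Feasible π) (s : S) :
    π s ∈ stdSimplex ℝ A := M.X_subset s (hπ s)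

lemma Feasible.nonneg {M : RegMDP S A} (hπ : M.Feasible π) (s : S) (a : A) : 0 ≤ π s a :=
  (hπ.mem_stdSimplex s).1 a

lemma Feasible.sum_eq_one {M : RegMDP S A} (hπ : M.Feasible π) (s : S) : ∑ a, π s a = 1 :=
  (hπ.mem_stdSimplex s).2

lemma pairMatrix_mem (hπ : M.Feasible π) : M.pairMatrix π ∈ Matrix.rowStochastic ℝ (S × A) := by
  rw [Matrix.mem_rowStochastic_iff_sum]
  refine ⟨fun z z' => mul_nonneg ((M.P_mem _ _).1 _) (hπ.nonneg _ _), fun z => ?_⟩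
  simp only [pairMatrix, Matrix.of_apply, Fintype.sum_prod_type, ← Finset.mul_sum, hπ.sum_eq_one,
    mul_one]
  exact (M.P_mem _ _).2

lemma stateMatrix_mem (hπ : M.Feasible π) : M.stateMatrix π ∈ Matrix.rowStochastic ℝ S := by
  rw [Matrix.mem_rowStochastic_iff_sum]
  refine ⟨fun s s' => Finset.sum_nonneg fun a _ => mul_nonneg (hπ.nonneg _ _) ((M.P_mem _ _).1 _),
    fun s => ?_⟩
  simp only [stateMatrix, Matrix.of_apply]
  rw [Finset.sum_comm]
  simp only [← Finset.mul_sum, (M.P_mem _ _).2, mul_one, hπ.sum_eq_one]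

lemma sum_pairMatrix_mul (θ : S × A → ℝ) (z : S × A) :
    ∑ z', M.pairMatrix π z z' * θ z' = ∑ s', M.P z.1 z.2 s' * ∑ a', π s' a' * θ (s', a') := by
  simp only [pairMatrix, Matrix.of_apply, Fintype.sum_prod_type, Finset.mul_sum, mul_assoc]

lemma sum_stateMatrix_mul (v : S → ℝ) (s : S) :
    ∑ s', M.stateMatrix π s s' * v s' = ∑ a, π s a * ∑ s', M.P s a s' * v s' := by
  simp only [stateMatrix, Matrix.of_apply, Finset.sum_mul, Finset.mul_sum, mul_assoc]
  rw [Finset.sum_comm]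

lemma bellman_eq (θ : S × A → ℝ) (z : S × A) :
    M.bellman τ π θ z = M.stageCost τ π z + M.γ * ∑ z', M.pairMatrix π z z' * θ z' := by
  rw [bellman, sum_pairMatrix_mul]

lemma Q_eq_pair (hπ : M.Feasible π) (z : S × A) :
    M.Q τ π z = M.stageCost τ π z + M.γ * ∑ z', M.pairMatrix π z z' * M.Q τ π z' :=
  Matrix.tsum_discounted_eq (M.pairMatrix_mem hπ) M.γ_pos.le M.γ_lt_one _ z

lemma Q_eq (hπ : M.Feasible π) (s : S) (a : A) :
    M.Q τ π (s, a) = M.stageCost τ π (s, a) + M.γ * ∑ s', M.P s a s' * M.V τ π s' := by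
  rw [Q_eq_pair M hπ, sum_pairMatrix_mul]
  rfl

lemma one_sub_γ_pos : 0 < 1 - M.γ := sub_pos.2 M.γ_lt_one

lemma abs_Q_le (hπ : M.Feasible π) {b : ℝ} (hb : ∀ z, |M.stageCost τ π z| ≤ b) (z : S × A) :
    |M.Q τ π z| ≤ b / (1 - M.γ) := by
  rw [div_eq_mul_inv, ← tsum_geometric_of_lt_one M.γ_pos.le M.γ_lt_one, ← tsum_mul_left,
    ← Real.norm_eq_abs, Q]
  refine tsum_of_norm_bounded (((summable_geometric_of_lt_one M.γ_pos.le
    M.γ_lt_one).mul_left b).hasSum) fun t => ?_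
  rw [Real.norm_eq_abs, abs_mul, abs_of_nonneg (pow_nonneg M.γ_pos.le t), mul_comm]
  exact mul_le_mul_of_nonneg_right
    (Matrix.abs_sum_row_mul_le (pow_mem (M.pairMatrix_mem hπ) t) hb z) (pow_nonneg M.γ_pos.le t)

/-- Stage cost of the advantage of switching from `π` to `p` at `s`. -/
noncomputable def gain (τ : ℝ) (π : S → A → ℝ) (s : S) (p : A → ℝ) : ℝ :=
  ∑ a, M.Q τ π (s, a) * (p a - π s a) + (M.h s p - M.h s (π s)) +
    τ * (klDist p (uniformDist A) - klDist (π s) (uniformDist A))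

/-- The difference of two value functions solves the Bellman equation whose cost is the gain. -/
lemma V_sub_V (hπ : M.Feasible π) (hπ' : M.Feasible π') (s : S) :
    M.V τ π' s - M.V τ π s =
      M.gain τ π s (π' s) +
        M.γ * ∑ s', M.stateMatrix π' s s' * (M.V τ π' s' - M.V τ π s') := by
  have key : ∀ a, M.Q τ π' (s, a) - M.Q τ π (s, a) =
      (M.h s (π' s) - M.h s (π s)) +
        τ * (klDist (π' s) (uniformDist A) - klDist (π s) (uniformDist A)) +
        M.γ * ∑ s', M.P s a s' * (M.V τ π' s' - M.V τ π s') := by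
    intro a
    simp only [Q_eq M hπ, Q_eq M hπ', stageCost, mul_sub, Finset.sum_sub_distrib]
    ring
  -- The mixed term `∑ π' Q_τ^π` is inserted: it separates the change of `Q` from the change of
  -- action distribution.
  have h2 : M.V τ π' s - M.V τ π s = ∑ a, π' s a * (M.Q τ π' (s, a) - M.Q τ π (s, a)) +
      ∑ a, M.Q τ π (s, a) * (π' s a - π s a) := by
    simp only [V, ← Finset.sum_sub_distrib, ← Finset.sum_add_distrib]
    exact Finset.sum_congr rfl fun a _ => by ring
  rw [h2]
  simp only [key, mul_add, Finset.sum_add_distrib, ← Finset.sum_mul, hπ'.sum_eq_one,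
    sum_stateMatrix_mul, gain, one_mul]
  simp only [Finset.mul_sum, mul_left_comm M.γ]
  ring

/-- Maximum principle for discounted evaluation equations. -/
lemma le_of_eq_add_discounted [Nonempty S] (hπ : M.Feasible π) {v g : S → ℝ} {e : ℝ}
    (hv : ∀ s, v s = g s + M.γ * ∑ s', M.stateMatrix π s s' * v s') (hg : ∀ s, g s ≤ e) (s : S) :
    v s ≤ e / (1 - M.γ) := by
  obtain ⟨m, hm⟩ := Finite.exists_max v
  have h1 := Matrix.sum_row_mul_le (M.stateMatrix_mem hπ) hm m
  refine (hm s).trans ?_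
  rw [le_div_iff₀ M.one_sub_γ_pos]
  nlinarith [hv m, hg m, mul_le_mul_of_nonneg_left h1 M.γ_pos.le]

/-- The maximum principle is applied only to the discounted future, so the exact `g s` survives at
the present state. For mirror descent this gain must be kept, since it will be compared with that of
`πs`. -/
lemma le_gain_add [Nonempty S] (hπ : M.Feasible π) {v g : S → ℝ} {e : ℝ}
    (hv : ∀ s, v s = g s + M.γ * ∑ s', M.stateMatrix π s s' * v s') (hg : ∀ s, g s ≤ e) (s : S) :
    v s ≤ g s + M.γ * (e / (1 - M.γ)) := by
  rw [hv s]
  gcongr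
  · exact M.γ_pos.le
  · exact Matrix.sum_row_mul_le (M.stateMatrix_mem hπ) (M.le_of_eq_add_discounted hπ hv hg) s

/-- Averaging an evaluation equation over the stationary distribution. -/
lemma sum_stationary_eq {ν : S → ℝ} (hν : M.IsStationary π ν) {v g : S → ℝ}
    (hv : ∀ s, v s = g s + M.γ * ∑ s', M.stateMatrix π s s' * v s') :
    ∑ s, ν s * g s = (1 - M.γ) * ∑ s, ν s * v s := by
  have h1 : ∑ s, ν s * ∑ s', M.stateMatrix π s s' * v s' = ∑ s, ν s * v s := by
    simp only [Finset.mul_sum, ← mul_assoc]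
    rw [Finset.sum_comm]
    simp only [← Finset.sum_mul, hν.2]
  have h2 : ∑ s, ν s * v s =
      ∑ s, ν s * g s + M.γ * ∑ s, ν s * ∑ s', M.stateMatrix π s s' * v s' := by
    rw [Finset.mul_sum, ← Finset.sum_add_distrib]
    refine Finset.sum_congr rfl fun s _ => ?_
    conv_lhs => rw [hv s]
    ring
  rw [h1] at h2
  linarith

lemma stationary_nonempty {ν : S → ℝ} (hν : M.IsStationary π ν) : Nonempty S := by
  by_contra h
  rw [not_nonempty_iff] at h
  have := hν.1.2
  simp at this

end RegMDP

/-! ### Kullback-Leibler inequalities and the three-point lemma -/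

section Kullback

variable {A : Type*} [Fintype A]

/-- With `x = u²`, `y = v²`, the bound `log (v/u) ≤ v/u - 1` gives `x log (x/y) ≥ 2u² - 2uv = x - y
+ (u-v)²`, and `(x-y)² = (u-v)²(u+v)² ≤ 4(u-v)²` on `[0,1]`. Summed over actions, the linear terms
cancel and a quarter of the squared Euclidean distance remains. -/
lemma le_mul_log_div {x y : ℝ} (hx : 0 ≤ x) (hx1 : x ≤ 1) (hy : 0 < y) (hy1 : y ≤ 1) :
    x - y + (x - y) ^ 2 / 4 ≤ x * Real.log (x / y) := by
  rcases hx.eq_or_lt with rfl | hx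
  · nlinarith
  obtain ⟨u, hu, rfl⟩ : ∃ u : ℝ, 0 < u ∧ u ^ 2 = x :=
    ⟨Real.sqrt x, Real.sqrt_pos.2 hx, Real.sq_sqrt hx.le⟩
  obtain ⟨v, hv, rfl⟩ : ∃ v : ℝ, 0 < v ∧ v ^ 2 = y :=
    ⟨Real.sqrt y, Real.sqrt_pos.2 hy, Real.sq_sqrt hy.le⟩
  have h1 := Real.log_le_sub_one_of_pos (div_pos hv hu)
  have h2 : Real.log (u ^ 2 / v ^ 2) = -(2 * Real.log (v / u)) := by
    rw [← div_pow, Real.log_pow, Real.log_div hu.ne' hv.ne', Real.log_div hv.ne' hu.ne']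
    push_cast
    ring
  have h3 : u ^ 2 * Real.log (v / u) ≤ u * v - u ^ 2 := by
    calc u ^ 2 * Real.log (v / u) ≤ u ^ 2 * (v / u - 1) :=
          mul_le_mul_of_nonneg_left h1 (sq_nonneg u)
      _ = u * v - u ^ 2 := by field_simp
  have hu1 : u ≤ 1 := by nlinarith
  have hv1 : v ≤ 1 := by nlinarith
  have h4 : (u + v) ^ 2 ≤ 4 := by nlinarith
  rw [h2]
  nlinarith [mul_le_mul_of_nonneg_left h4 (sq_nonneg (u - v))]

lemma mem_stdSimplex_le_one {p : A → ℝ} (hp : p ∈ stdSimplex ℝ A) (a : A) : p a ≤ 1 :=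
  hp.2 ▸ Finset.single_le_sum (f := p) (fun i _ => hp.1 i) (Finset.mem_univ a)

/-- A weak form of Pinsker's inequality. -/
lemma sum_sq_sub_le_klDist {p q : A → ℝ} (hp : p ∈ stdSimplex ℝ A) (hq : q ∈ stdSimplex ℝ A)
    (hq0 : ∀ a, 0 < q a) : (∑ a, (p a - q a) ^ 2) / 4 ≤ klDist p q := by
  have h : ∑ a, (p a - q a + (p a - q a) ^ 2 / 4) ≤ klDist p q :=
    Finset.sum_le_sum fun a _ =>
      le_mul_log_div (hp.1 a) (mem_stdSimplex_le_one hp a) (hq0 a) (mem_stdSimplex_le_one hq a)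
  rw [Finset.sum_add_distrib, Finset.sum_sub_distrib, hp.2, hq.2, sub_self, zero_add,
    ← Finset.sum_div] at h
  exact h

lemma klDist_nonneg {p q : A → ℝ} (hp : p ∈ stdSimplex ℝ A) (hq : q ∈ stdSimplex ℝ A)
    (hq0 : ∀ a, 0 < q a) : 0 ≤ klDist p q :=
  le_trans (by positivity) (sum_sq_sub_le_klDist hp hq hq0)

lemma klDist_self {p : A → ℝ} (hp : ∀ a, 0 < p a) : klDist p p = 0 :=
  Finset.sum_eq_zero fun a _ => by rw [div_self (hp a).ne', Real.log_one, mul_zero]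

lemma klDist_eq {p q : A → ℝ} (hp : ∀ a, 0 < p a) (hq : ∀ a, 0 < q a) :
    klDist p q = ∑ a, p a * Real.log (p a) - ∑ a, p a * Real.log (q a) := by
  rw [klDist, ← Finset.sum_sub_distrib]
  exact Finset.sum_congr rfl fun a _ => by
    rw [Real.log_div (hp a).ne' (hq a).ne', mul_sub]

lemma uniformDist_pos [Nonempty A] (a : A) : 0 < uniformDist A a := by
  unfold uniformDist
  have := Fintype.card_pos (α := A)
  positivity

lemma klDist_uniformDist_le [Nonempty A] {p : A → ℝ} (hp : p ∈ stdSimplex ℝ A) :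
    klDist p (uniformDist A) ≤ Real.log (Fintype.card A) := by
  have hc : (0 : ℝ) < Fintype.card A := Nat.cast_pos.2 Fintype.card_pos
  refine sum_simplex_mul_le hp fun a => ?_
  rcases (hp.1 a).eq_or_lt with h | h
  · rw [← h, zero_div, Real.log_zero]
    exact Real.log_natCast_nonneg _
  · refine Real.log_le_log (div_pos h (uniformDist_pos a)) ?_
    rw [uniformDist, div_div_eq_mul_div, div_one]
    have := mem_stdSimplex_le_one hp a
    nlinarith

lemma continuous_klDist {q : A → ℝ} (hq : ∀ a, 0 < q a) : Continuous fun p => klDist p q := by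
  have h : (fun p => klDist p q) =
      fun p : A → ℝ => ∑ a, q a * (p a / q a * Real.log (p a / q a)) := by
    funext p
    refine Finset.sum_congr rfl fun a _ => ?_
    rw [← mul_assoc, mul_div_cancel₀ _ (hq a).ne']
  rw [h]
  refine continuous_finsetSum _ fun a _ => continuous_const.mul ?_
  exact Real.continuous_mul_log.comp ((continuous_apply a).div_const _)

/-- A first-order expansion of `x log x` with explicit quadratic remainder, from `log r ≤ r - 1`. It
replaces differentiation of the entropy in `three_point`. -/
lemma mul_log_add_le {x d t : ℝ} (hx : 0 < x) (hxt : 0 < x + t * d) :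
    (x + t * d) * Real.log (x + t * d) ≤
      x * Real.log x + t * (d * (Real.log x + 1)) + t ^ 2 * (d ^ 2 / x) := by
  have h1 := Real.log_le_sub_one_of_pos (div_pos hxt hx)
  rw [Real.log_div hxt.ne' hx.ne'] at h1
  have h2 : (x + t * d) / x - 1 = t * d / x := by field_simp; ring
  rw [h2] at h1
  have h3 := mul_le_mul_of_nonneg_left h1 hxt.le
  have h4 : (x + t * d) * (t * d / x) = t * d + t ^ 2 * (d ^ 2 / x) := by field_simp
  nlinarith

/-- First order optimality: a minimizer over a convex set of positive probability vectors of a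
convex function plus `c` times the negative entropy satisfies the three-point inequality. -/
lemma three_point {X : Set (A → ℝ)} (hX : Convex ℝ X) (hpos : ∀ p ∈ X, ∀ a, 0 < p a)
    (hsimp : X ⊆ stdSimplex ℝ A) {ψ : (A → ℝ) → ℝ} (hψ : ConvexOn ℝ X ψ) {c : ℝ} (hc : 0 ≤ c)
    {p : A → ℝ} (hp : p ∈ X)
    (hmin : IsMinOn (fun p => ψ p + c * ∑ a, p a * Real.log (p a)) X p) {q : A → ℝ} (hq : q ∈ X) :
    ψ p + c * ∑ a, p a * Real.log (p a) + c * klDist q p ≤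
      ψ q + c * ∑ a, q a * Real.log (q a) := by
  -- `G` is the derivative of the negative entropy at `p` towards `q`, and `H` bounds its
  -- second-order remainder.
  set G := ∑ a, (q a - p a) * (Real.log (p a) + 1) with hG
  set H := ∑ a, (q a - p a) ^ 2 / p a with hH
  have hH0 : 0 ≤ H := Finset.sum_nonneg fun a _ => div_nonneg (sq_nonneg _) (hpos p hp a).le
  -- Minimality is tested at the point `p + t(q-p)` of the segment; dividing by `t` and letting `t →
  -- 0` leaves the variational inequality.
  have key : ∀ t : ℝ, 0 < t → t ≤ 1 → 0 ≤ (ψ q - ψ p + c * G) + t * (c * H) := by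
    intro t ht ht1
    have hmem : (1 - t) • p + t • q ∈ X := hX hp hq (by linarith) ht.le (by ring)
    have h1 := hmin hmem
    simp only [Set.mem_ofPred_eq] at h1
    have h2 := hψ.2 hp hq (by linarith : 0 ≤ 1 - t) ht.le (by ring)
    simp only [smul_eq_mul] at h2
    have h3 : ∑ a, ((1 - t) • p + t • q) a * Real.log (((1 - t) • p + t • q) a) ≤
        ∑ a, p a * Real.log (p a) + t * G + t ^ 2 * H := by
      rw [hG, hH, Finset.mul_sum, Finset.mul_sum, ← Finset.sum_add_distrib,
        ← Finset.sum_add_distrib]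
      refine Finset.sum_le_sum fun a _ => ?_
      have e : ((1 - t) • p + t • q) a = p a + t * (q a - p a) := by
        simp only [Pi.add_apply, Pi.smul_apply, smul_eq_mul]; ring
      have hp' := hpos _ hmem a
      rw [e] at hp' ⊢
      exact mul_log_add_le (hpos p hp a) hp'
    have h4 := mul_le_mul_of_nonneg_left h3 hc
    have h5 : 0 ≤ t * ((ψ q - ψ p + c * G) + t * (c * H)) := by nlinarith
    exact nonneg_of_mul_nonneg_right h5 ht
  have h6 : 0 ≤ ψ q - ψ p + c * G := by
    have hlim : Filter.Tendsto (fun t : ℝ => (ψ q - ψ p + c * G) + t * (c * H))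
        (nhdsWithin 0 (Set.Ioi 0)) (nhds ((ψ q - ψ p + c * G) + 0 * (c * H))) := by
      refine Filter.Tendsto.mono_left (Continuous.tendsto ?_ 0) nhdsWithin_le_nhds
      fun_prop
    rw [zero_mul, add_zero] at hlim
    refine ge_of_tendsto hlim ?_
    filter_upwards [Ioc_mem_nhdsGT (zero_lt_one' ℝ)] with t ht using key t ht.1 ht.2
  -- The contributions of the `+1` in the derivative cancel because `p` and `q` have the same total
  -- mass.
  have h7 : G = ∑ a, q a * Real.log (p a) - ∑ a, p a * Real.log (p a) := by
    have h8 : G = ∑ a, q a * Real.log (p a) - ∑ a, p a * Real.log (p a) +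
        (∑ a, q a - ∑ a, p a) := by
      rw [hG, ← Finset.sum_sub_distrib, ← Finset.sum_sub_distrib, ← Finset.sum_add_distrib]
      exact Finset.sum_congr rfl fun a _ => by ring
    rw [h8, (hsimp hq).2, (hsimp hp).2]
    ring
  rw [klDist_eq (hpos q hq) (hpos p hp)]
  rw [h7] at h6
  nlinarith

end Kullback

/-! ### The prox-mapping and one step of mirror descent -/

namespace RegMDP

variable {S A : Type*} [Fintype S] [Fintype A] [DecidableEq S] [DecidableEq A]
  (M : RegMDP S A) {π π' : S → A → ℝ} {τ η : ℝ}

/-- The objective of the prox-mapping. -/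
noncomputable def proxObj (η τ : ℝ) (s : S) (q p₀ p : A → ℝ) : ℝ :=
  η * (∑ a, q a * p a + M.h s p + τ * klDist p (uniformDist A)) + klDist p p₀

/-- The objective is lower semicontinuous on a compact set, so a minimizer exists and the choice
made by `Classical.epsilon` is genuine. -/
lemma prox_spec [Nonempty A] (hη : 0 ≤ η) {s : S} {q p₀ : A → ℝ} (hp₀ : p₀ ∈ M.X s)
    (hpos : ∀ a, 0 < p₀ a) :
    M.prox η τ s q p₀ ∈ M.X s ∧ IsMinOn (M.proxObj η τ s q p₀) (M.X s) (M.prox η τ s q p₀) := by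
  refine Classical.epsilon_spec (p := fun p => p ∈ M.X s ∧ IsMinOn (M.proxObj η τ s q p₀) (M.X s) p)
    ?_
  have hcomp : IsCompact (M.X s) :=
    (isCompact_stdSimplex ℝ A).of_isClosed_subset (M.X_closed s) (M.X_subset s)
  refine LowerSemicontinuousOn.exists_isMinOn ⟨p₀, hp₀⟩ hcomp ?_
  have h1 : Continuous fun p : A → ℝ => η * (∑ a, q a * p a + τ * klDist p (uniformDist A)) +
      klDist p p₀ := by
    have := continuous_klDist (uniformDist_pos (A := A))
    have := continuous_klDist hpos
    fun_prop
  have h2 : LowerSemicontinuousOn (fun p => η * M.h s p) (M.X s) :=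
    (continuous_const_mul η).comp_lowerSemicontinuousOn (M.h_lsc s)
      (fun _ _ h => mul_le_mul_of_nonneg_left h hη)
  have h3 := h1.lowerSemicontinuous.lowerSemicontinuousOn (M.X s) |>.add h2
  convert h3 using 2 with p
  simp only [proxObj]
  ring

lemma prox_mem [Nonempty A] (hη : 0 ≤ η) {s : S} {q p₀ : A → ℝ} (hp₀ : p₀ ∈ M.X s)
    (hpos : ∀ a, 0 < p₀ a) : M.prox η τ s q p₀ ∈ M.X s := (M.prox_spec hη hp₀ hpos).1

lemma convexOn_linear {X : Set (A → ℝ)} (hX : Convex ℝ X) (q : A → ℝ) :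
    ConvexOn ℝ X fun p => ∑ a, q a * p a :=
  ⟨hX, fun x _ y _ a b _ _ _ => by
    simp only [Pi.add_apply, Pi.smul_apply, smul_eq_mul, Finset.mul_sum, ← Finset.sum_add_distrib]
    exact (Finset.sum_congr rfl fun i _ => by ring).le⟩

lemma proxObj_prox_add_le [Nonempty A] (hη : 0 ≤ η) (hτ : 0 ≤ τ) {s : S} {q p₀ p : A → ℝ}
    (hX : ∀ p ∈ M.X s, ∀ a, 0 < p a) (hp₀ : p₀ ∈ M.X s) (hp : p ∈ M.X s) :
    M.proxObj η τ s q p₀ (M.prox η τ s q p₀) + (1 + η * τ) * klDist p (M.prox η τ s q p₀) ≤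
      M.proxObj η τ s q p₀ p := by
  obtain ⟨hmem, hmin⟩ := M.prox_spec (τ := τ) (q := q) hη hp₀ (hX p₀ hp₀)
  -- Both divergences are split into linear parts, absorbed in `ψ`, and negative entropies, whose
  -- total coefficient is `1 + η * τ`.
  set ψ : (A → ℝ) → ℝ := fun p => ∑ a, (η * q a - η * τ * Real.log (uniformDist A a) -
    Real.log (p₀ a)) * p a + η * M.h s p with hψ
  have hobj : ∀ p ∈ M.X s, M.proxObj η τ s q p₀ p =
      ψ p + (1 + η * τ) * ∑ a, p a * Real.log (p a) := by
    intro p hp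
    rw [proxObj, klDist_eq (hX p hp) uniformDist_pos, klDist_eq (hX p hp) (hX p₀ hp₀), hψ]
    simp only [sub_mul, Finset.sum_sub_distrib, mul_assoc, ← Finset.mul_sum, mul_comm (Real.log _)]
    ring
  have hconv : ConvexOn ℝ (M.X s) ψ :=
    (convexOn_linear (M.X_convex s) _).add ((M.h_convex s).smul hη)
  have hmin' : IsMinOn (fun p => ψ p + (1 + η * τ) * ∑ a, p a * Real.log (p a)) (M.X s)
      (M.prox η τ s q p₀) := by
    intro p hp
    have := hmin hp
    simp only [Set.mem_ofPred_eq] at this ⊢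
    rwa [← hobj p hp, ← hobj _ hmem]
  rw [hobj p hp, hobj _ hmem]
  exact three_point (M.X_convex s) hX (M.X_subset s) hconv (by positivity) hmem hmin' hp

end RegMDP

lemma sum_simplex_mul_sub_le {ι κ : Type*} [Fintype ι] [Fintype κ] {p q : ι → ℝ}
    (hp : p ∈ stdSimplex ℝ ι) (hq : q ∈ stdSimplex ℝ ι) (δ : κ → ℝ) (j : ι → κ) :
    ∑ i, δ (j i) * (p i - q i) ≤ 2 * l2norm δ := by
  have h1 := sum_simplex_mul_le hp (g := fun i => δ (j i)) fun i =>
    (le_abs_self _).trans (abs_le_l2norm δ (j i))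
  have h2 := le_sum_simplex_mul hq (g := fun i => δ (j i)) fun i =>
    (neg_le_neg (abs_le_l2norm δ (j i))).trans (neg_abs_le _)
  have h3 : ∑ i, δ (j i) * (p i - q i) = ∑ i, p i * δ (j i) - ∑ i, q i * δ (j i) := by
    rw [← Finset.sum_sub_distrib]
    exact Finset.sum_congr rfl fun i _ => by ring
  rw [h3]
  linarith

namespace RegMDP

variable {S A : Type*} [Fintype S] [Fintype A] [DecidableEq S] [DecidableEq A]
  (M : RegMDP S A) {π πs : S → A → ℝ} {τ η : ℝ}

lemma sum_sq_row_le (δ : S × A → ℝ) (s : S) : ∑ a, δ (s, a) ^ 2 ≤ l2norm δ ^ 2 := by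
  rw [l2norm_sq, Fintype.sum_prod_type]
  exact Finset.single_le_sum (f := fun s => ∑ a, δ (s, a) ^ 2)
    (fun _ _ => Finset.sum_nonneg fun _ _ => sq_nonneg _) (Finset.mem_univ s)

/-- The three-point inequality with `θ` replaced by `Q_τ^π` plus an error. At the new point `p'` the
error is split by Young's inequality; the part `‖p' - π s‖²/4` is absorbed by `klDist p' (π s)`,
which the prox objective supplies. Only the error paired with the comparator stays linear. -/
lemma gain_prox_le [Nonempty A] (hX : ∀ s, ∀ p ∈ M.X s, ∀ a, 0 < p a) (hπ : M.Feasible π)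
    (hη : 0 ≤ η) (hτ : 0 ≤ τ) (θ : S × A → ℝ) {s : S} {p : A → ℝ} (hp : p ∈ M.X s) :
    η * M.gain τ π s (M.prox η τ s (fun a => θ (s, a)) (π s)) +
        (1 + η * τ) * klDist p (M.prox η τ s (fun a => θ (s, a)) (π s)) ≤
      η * M.gain τ π s p + η * ∑ a, (θ - M.Q τ π) (s, a) * (p a - π s a) +
        η ^ 2 * l2norm (θ - M.Q τ π) ^ 2 + klDist p (π s) := by
  have h := M.proxObj_prox_add_le hη hτ (q := fun a => θ (s, a)) (hX s) (hπ s) hp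
  have hm := M.prox_mem (τ := τ) hη (q := fun a => θ (s, a)) (hπ s) (hX s _ (hπ s))
  set p' := M.prox η τ s (fun a => θ (s, a)) (π s) with hp'
  set δ := θ - M.Q τ π with hδ
  have hθ : ∀ r : A → ℝ, ∑ a, θ (s, a) * r a =
      ∑ a, M.Q τ π (s, a) * (r a - π s a) + ∑ a, δ (s, a) * (r a - π s a) +
        ∑ a, θ (s, a) * π s a := by
    intro r
    rw [← Finset.sum_add_distrib, ← Finset.sum_add_distrib]
    refine Finset.sum_congr rfl fun a _ => ?_
    simp only [hδ, Pi.sub_apply]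
    ring
  have hy : -(η * ∑ a, δ (s, a) * (p' a - π s a)) ≤
      η ^ 2 * l2norm δ ^ 2 + klDist p' (π s) := by
    have h1 := sum_sq_sub_le_klDist (M.X_subset s hm) (hπ.mem_stdSimplex s) (hX s _ (hπ s))
    have h2 := mul_le_mul_of_nonneg_left (sum_sq_row_le δ s) (sq_nonneg η)
    have h3 : -(η * ∑ a, δ (s, a) * (p' a - π s a)) ≤
        η ^ 2 * ∑ a, δ (s, a) ^ 2 + (∑ a, (p' a - π s a) ^ 2) / 4 := by
      rw [Finset.mul_sum, Finset.mul_sum, Finset.sum_div, ← Finset.sum_neg_distrib,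
        ← Finset.sum_add_distrib]
      refine Finset.sum_le_sum fun a _ => ?_
      nlinarith [sq_nonneg (η * δ (s, a) + (p' a - π s a) / 2)]
    linarith
  simp only [proxObj, hθ p, hθ p'] at h
  simp only [gain]
  nlinarith

/-- One step of approximate policy mirror descent with evaluation error `θ - Q_τ^π`. -/
lemma mirror_step [Nonempty A] (hX : ∀ s, ∀ p ∈ M.X s, ∀ a, 0 < p a) (hπ : M.Feasible π)
    (hτ : 0 < τ) (hη : η = (1 - M.γ) / (M.γ * τ)) (θ : S × A → ℝ) (hπs : M.Feasible πs)
    {ν : S → ℝ} (hν : M.IsStationary πs ν) {π' : S → A → ℝ}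
    (hπ' : π' = fun s => M.prox η τ s (fun a => θ (s, a)) (π s)) :
    ∑ s, ν s * (M.V τ π' s - M.V τ πs s) + τ / (1 - M.γ) * ∑ s, ν s * klDist (πs s) (π' s) ≤
      M.γ * (∑ s, ν s * (M.V τ π s - M.V τ πs s) +
        τ / (1 - M.γ) * ∑ s, ν s * klDist (πs s) (π s)) +
      (2 * l2norm (θ - M.Q τ π) + l2norm (θ - M.Q τ π) ^ 2 / (M.γ * τ)) := by
  have hγ := M.γ_pos
  have hγ1 := M.one_sub_γ_pos
  have hη0 : 0 < η := by rw [hη]; positivity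
  have := M.stationary_nonempty hν
  set δ := l2norm (θ - M.Q τ π) with hδ
  set e := η * δ ^ 2 with he
  have hfeas : M.Feasible π' := fun s => by
    rw [hπ']
    exact M.prox_mem hη0.le (hπ s) (hX s _ (hπ s))
  -- This identity dictates the stepsize: it is what makes the distance term contract by exactly
  -- `γ`.
  have hητ : 1 + η * τ = 1 / M.γ := by rw [hη]; field_simp; ring
  -- Taking the old policy itself as comparator shows approximate improvement at every state: the
  -- gain is at most `e`.
  have hg : ∀ s, M.gain τ π s (π' s) ≤ e := by
    intro s
    have h1 := M.gain_prox_le hX hπ hη0.le hτ.le θ (hπ s)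
    have h2 : 0 ≤ klDist (π s) (π' s) :=
      klDist_nonneg (hπ.mem_stdSimplex s) (hfeas.mem_stdSimplex s) (hX s _ (hfeas s))
    have h3 : M.gain τ π s (π s) = 0 := by simp [gain]
    rw [h3, klDist_self (hX s _ (hπ s)), hητ] at h1
    simp only [sub_self, mul_zero, Finset.sum_const_zero, zero_add, add_zero] at h1
    have h4 : 0 ≤ 1 / M.γ * klDist (π s) (π' s) := by positivity
    rw [hπ'] at h4 ⊢
    refine le_of_mul_le_mul_left ?_ hη0
    rw [he]
    nlinarith
  -- The gain of `π'` is now compared with that of `πs`; by `hg` the future contributes at most `γ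
  -- e/(1-γ)`.
  have hstep : ∀ s, M.V τ π' s - M.V τ π s ≤ M.gain τ π s (πs s) +
      (2 * δ + δ ^ 2 / (M.γ * τ)) + M.γ * (τ / (1 - M.γ)) * klDist (πs s) (π s) -
        τ / (1 - M.γ) * klDist (πs s) (π' s) := by
    intro s
    have h1 := M.le_gain_add hfeas (M.V_sub_V (τ := τ) hπ hfeas) hg s
    have h2 := M.gain_prox_le hX hπ hη0.le hτ.le θ (hπs s)
    have h3 := sum_simplex_mul_sub_le (hπs.mem_stdSimplex s) (hπ.mem_stdSimplex s)
      (θ - M.Q τ π) fun a => (s, a)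
    have h4 : π' s = M.prox η τ s (fun a => θ (s, a)) (π s) := by rw [hπ']
    rw [← h4, hητ] at h2
    have h5 : M.gain τ π s (π' s) ≤ M.gain τ π s (πs s) + 2 * δ + e +
        (klDist (πs s) (π s) - 1 / M.γ * klDist (πs s) (π' s)) / η := by
      have h6 : (klDist (πs s) (π s) - 1 / M.γ * klDist (πs s) (π' s)) =
        η * ((klDist (πs s) (π s) - 1 / M.γ * klDist (πs s) (π' s)) / η) := by field_simp
      refine le_of_mul_le_mul_left ?_ hη0
      have h7 := mul_le_mul_of_nonneg_left h3 hη0.le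
      rw [he]
      nlinarith
    have h8 : (klDist (πs s) (π s) - 1 / M.γ * klDist (πs s) (π' s)) / η =
        M.γ * (τ / (1 - M.γ)) * klDist (πs s) (π s) - τ / (1 - M.γ) * klDist (πs s) (π' s) := by
      rw [hη]; field_simp
    have h9 : e + M.γ * (e / (1 - M.γ)) = δ ^ 2 / (M.γ * τ) := by
      rw [he, hη]; field_simp; ring
    linarith
  have hsum := Finset.sum_le_sum fun s (_ : s ∈ Finset.univ) =>
    mul_le_mul_of_nonneg_left (hstep s) (hν.1.1 s)
  -- Stationarity of `ν` under `πs` makes the averaged gain of `πs` equal to `1-γ` times the value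
  -- gap, which yields the factor `γ` for the value part of the potential.
  have hst := M.sum_stationary_eq hν (M.V_sub_V (τ := τ) hπ hπs)
  have hone := hν.1.2
  simp only [mul_add, mul_sub, Finset.sum_add_distrib, Finset.sum_sub_distrib, ← Finset.sum_mul,
    hone, one_mul, mul_left_comm (ν _), ← Finset.mul_sum] at hsum hst ⊢
  linarith

end RegMDP

/-! ### Stationary distributions and Doeblin's convergence bound -/

namespace Matrix

variable {ι : Type*} [Fintype ι] [DecidableEq ι]

/-- A row stochastic matrix has a stationary probability vector. -/
lemma exists_stationary [Nonempty ι] {P : Matrix ι ι ℝ} (hP : P ∈ rowStochastic ℝ ι) :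
    ∃ ν ∈ stdSimplex ℝ ι, ∀ j, ∑ i, ν i * P i j = ν j := by
  have hP' := mem_rowStochastic_iff_sum.1 hP
  -- The all-ones vector lies in the right kernel of `P - 1`, so there is also a nonzero left null
  -- vector `v`.
  have hdet : (P - 1).det = 0 := by
    refine exists_mulVec_eq_zero_iff.1 ⟨1, one_ne_zero, ?_⟩
    rw [sub_mulVec, (mem_rowStochastic.1 hP).2, one_mulVec, sub_self]
  obtain ⟨v, hv0, hv⟩ := exists_vecMul_eq_zero_iff.2 hdet
  have hvP : ∀ j, ∑ i, v i * P i j = v j := by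
    intro j
    have := congrFun hv j
    rw [vecMul_sub, vecMul_one, Pi.sub_apply, Pi.zero_apply, sub_eq_zero] at this
    exact this
  have hle : ∀ j, |v j| ≤ ∑ i, |v i| * P i j := by
    intro j
    rw [← hvP j]
    refine (Finset.abs_sum_le_sum_abs _ _).trans (Finset.sum_le_sum fun i _ => ?_)
    rw [abs_mul, abs_of_nonneg (hP'.1 i j)]
  have hsum : ∑ j, ∑ i, |v i| * P i j = ∑ j, |v j| := by
    rw [Finset.sum_comm]
    simp only [← Finset.mul_sum, hP'.2, mul_one]
  -- `|v| ≤ |v| P` entrywise while both sides have the same total, so `|v|` is invariant too and can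
  -- be normalized.
  have heq : ∀ j, |v j| = ∑ i, |v i| * P i j := fun j =>
    (Finset.sum_eq_sum_iff_of_le fun j _ => hle j).1 hsum.symm j (Finset.mem_univ j)
  have hpos : 0 < ∑ i, |v i| := by
    obtain ⟨i, hi⟩ := Function.ne_iff.1 hv0
    exact Finset.sum_pos' (fun _ _ => abs_nonneg _) ⟨i, Finset.mem_univ i, abs_pos.2 hi⟩
  refine ⟨fun i => |v i| / ∑ i, |v i|, ⟨fun i => by positivity, ?_⟩, fun j => ?_⟩
  · rw [← Finset.sum_div, div_self hpos.ne']
  · simp only [div_mul_eq_mul_div]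
    rw [← Finset.sum_div, ← heq j]

lemma sum_stationary_pow {P : Matrix ι ι ℝ} {ν : ι → ℝ} (hν : ∀ j, ∑ i, ν i * P i j = ν j)
    (n : ℕ) (j : ι) : ∑ i, ν i * (P ^ n) i j = ν j := by
  induction n generalizing j with
  | zero => simp [Matrix.one_apply]
  | succ n ih =>
    simp only [pow_succ, Matrix.mul_apply, Finset.mul_sum, ← mul_assoc]
    rw [Finset.sum_comm]
    simp only [← Finset.sum_mul, ih, hν]

/-- Doeblin's convergence bound under a minorization of the `n`-th power. -/
lemma abs_pow_sub_stationary_le {P : Matrix ι ι ℝ} (hP : P ∈ rowStochastic ℝ ι) {μ : ι → ℝ}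
    (hμ : μ ∈ stdSimplex ℝ ι) (hμP : ∀ j, ∑ i, μ i * P i j = μ j) {n : ℕ} {ε : ℝ} (hε : 0 ≤ ε)
    (hmin : ∀ i j, ε ≤ (P ^ n) i j) (q r : ℕ) (i j : ι) :
    |(P ^ (q * n + r)) i j - μ j| ≤ (1 - ε) ^ q := by
  induction q generalizing i with
  | zero =>
    have h0 := mem_rowStochastic_iff_sum.1 (pow_mem hP r)
    have h1 : (P ^ r) i j ≤ 1 := mem_stdSimplex_le_one ⟨h0.1 i, h0.2 i⟩ j
    have h2 := mem_stdSimplex_le_one hμ j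
    rw [zero_mul, zero_add, pow_zero, abs_le]
    constructor <;> linarith [h0.1 i j, hμ.1 j]
  | succ q ih =>
    have hn := mem_rowStochastic_iff_sum.1 (pow_mem hP n)
    -- The rank-one part `ε μ` may be subtracted from `P ^ n` since it annihilates the centred
    -- columns; what remains is nonnegative with row sums `1 - ε`.
    have h1 : (P ^ ((q + 1) * n + r)) i j - μ j =
        ∑ k, ((P ^ n) i k - ε * μ k) * ((P ^ (q * n + r)) k j - μ j) := by
      have e : (q + 1) * n + r = n + (q * n + r) := by ring
      rw [e, pow_add P n, Matrix.mul_apply]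
      simp only [sub_mul, mul_sub, Finset.sum_sub_distrib, ← Finset.sum_mul, hn.2, mul_assoc,
        ← Finset.mul_sum, sum_stationary_pow hμP, hμ.2]
      ring
    have hnn : ∀ k, 0 ≤ (P ^ n) i k - ε * μ k := fun k => by
      nlinarith [hmin i k, mem_stdSimplex_le_one hμ k]
    rw [h1]
    calc |∑ k, ((P ^ n) i k - ε * μ k) * ((P ^ (q * n + r)) k j - μ j)|
        ≤ ∑ k, ((P ^ n) i k - ε * μ k) * (1 - ε) ^ q := by
          refine (Finset.abs_sum_le_sum_abs _ _).trans (Finset.sum_le_sum fun k _ => ?_)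
          rw [abs_mul, abs_of_nonneg (hnn k)]
          exact mul_le_mul_of_nonneg_left (ih k) (hnn k)
      _ = (1 - ε) ^ (q + 1) := by
          rw [← Finset.sum_mul, Finset.sum_sub_distrib, ← Finset.mul_sum, hn.2, hμ.2, pow_succ]
          ring

lemma pow_mul_le_pow {P B : Matrix ι ι ℝ} {c : ℝ} (hc : 0 ≤ c) (hB : ∀ i j, 0 ≤ B i j)
    (h : ∀ i j, c * B i j ≤ P i j) (n : ℕ) (i j : ι) :
    0 ≤ (B ^ n) i j ∧ c ^ n * (B ^ n) i j ≤ (P ^ n) i j := by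
  induction n generalizing j with
  | zero => simp only [pow_zero, one_mul, le_refl, and_true, Matrix.one_apply]; positivity
  | succ n ih =>
    simp only [pow_succ, Matrix.mul_apply, Finset.mul_sum]
    refine ⟨Finset.sum_nonneg fun k _ => mul_nonneg (ih k).1 (hB k j),
      Finset.sum_le_sum fun k _ => ?_⟩
    have h1 : 0 ≤ c ^ n * (B ^ n) i k := mul_nonneg (pow_nonneg hc n) (ih k).1
    calc c ^ n * c * ((B ^ n) i k * B k j) = c ^ n * (B ^ n) i k * (c * B k j) := by ring
      _ ≤ (P ^ n) i k * P k j :=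
        mul_le_mul (ih k).2 (h k j) (mul_nonneg hc (hB k j)) (h1.trans (ih k).2)

end Matrix

/-! ### Uniform ergodicity, strong monotonicity and mixing constants -/

namespace RegMDP

variable {S A : Type*} [Fintype S] [Fintype A] [DecidableEq S] [DecidableEq A]
  (M : RegMDP S A) {π : S → A → ℝ} {ν : S → ℝ} {τ : ℝ}

lemma Regular.pos {M : RegMDP S A} (hM : M.Regular) : ∀ s, ∀ p ∈ M.X s, ∀ a, 0 < p a := by
  obtain ⟨⟨p₀, hp₀, h⟩, -⟩ := hM
  exact fun s p hp a => hp₀.trans_le (h s p hp a)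

lemma exists_isStationary [Nonempty S] (hπ : M.Feasible π) : ∃ ν, M.IsStationary π ν :=
  Matrix.exists_stationary (M.stateMatrix_mem hπ)

/-- A pair transition first moves the state and then draws an action, so powers factor through the
state chain; this transfers a minorization from states to pairs. -/
lemma pairMatrix_pow_succ_apply (n : ℕ) (z z' : S × A) :
    (M.pairMatrix π ^ (n + 1)) z z' =
      (∑ s, M.P z.1 z.2 s * (M.stateMatrix π ^ n) s z'.1) * π z'.1 z'.2 := by
  induction n generalizing z' with
  | zero => simp [Matrix.one_apply, pairMatrix]
  | succ n ih =>
    rw [pow_succ, Matrix.mul_apply]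
    simp only [ih]
    simp only [pow_succ (M.stateMatrix π), Matrix.mul_apply]
    simp only [Fintype.sum_prod_type, pairMatrix, Matrix.of_apply]
    simp only [stateMatrix, Matrix.of_apply, Finset.mul_sum, Finset.sum_mul]
    rw [Finset.sum_comm]
    conv_rhs => rw [Finset.sum_comm]; enter [2, x]; rw [Finset.sum_comm]
    rw [Finset.sum_comm]
    refine Finset.sum_congr rfl fun _ _ => Finset.sum_congr rfl fun _ _ =>
      Finset.sum_congr rfl fun _ _ => ?_
    ring

/-- Every feasible policy dominates `p₀` times the uniform one entrywise, hence so do the state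
matrices. A positive power for the uniform policy therefore serves all feasible policies with one
`n` and one `ε`. -/
lemma exists_minorization [Nonempty S] [Nonempty A] (hM : M.Regular)
    (hu : ∀ s, uniformDist A ∈ M.X s) :
    ∃ ε > 0, ∃ n, ∀ π, M.Feasible π → ∀ s s', ε ≤ (M.stateMatrix π ^ n) s s' := by
  obtain ⟨⟨p₀, hp₀, hX⟩, hprim⟩ := hM
  have hfu : M.Feasible fun _ => uniformDist A := hu
  obtain ⟨n, -, hn⟩ := (hprim _ hfu).exists_pos_pow
  obtain ⟨⟨i, j⟩, hij⟩ := Finite.exists_min fun z : S × S =>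
    (M.stateMatrix (fun _ => uniformDist A) ^ n) z.1 z.2
  refine ⟨p₀ ^ n * (M.stateMatrix (fun _ => uniformDist A) ^ n) i j,
    mul_pos (pow_pos hp₀ n) (hn i j), n, fun π hπ s s' => ?_⟩
  refine le_trans (mul_le_mul_of_nonneg_left (hij (s, s')) (pow_nonneg hp₀.le n)) ?_
  refine (Matrix.pow_mul_le_pow hp₀.le
    (Matrix.mem_rowStochastic_iff_sum.1 (M.stateMatrix_mem hfu)).1 (fun s s' => ?_) n s s').2
  simp only [stateMatrix, Matrix.of_apply, Finset.mul_sum]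
  refine Finset.sum_le_sum fun a _ => ?_
  rw [← mul_assoc]
  refine mul_le_mul_of_nonneg_right ?_ ((M.P_mem s a).1 s')
  have h1 := mem_stdSimplex_le_one (hfu.mem_stdSimplex s) a
  nlinarith [hX s _ (hπ s) a]

/-- A stationary `ν` is invariant under the `n`-th power, so each `ν s` is an average of entries
that are at least `ε`. This makes `Λ_min` positive. -/
lemma exists_weights_ge [Nonempty S] [Nonempty A] (hM : M.Regular)
    (hu : ∀ s, uniformDist A ∈ M.X s) : ∃ ε > 0, ∀ x ∈ M.weights, ε ≤ x := by
  obtain ⟨ε, hε, n, hn⟩ := M.exists_minorization hM hu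
  obtain ⟨⟨p₀, hp₀, hX⟩, -⟩ := hM
  refine ⟨ε * p₀, mul_pos hε hp₀, ?_⟩
  rintro x ⟨π, ν, s, a, hπ, hν, rfl⟩
  have h1 : ε ≤ ν s := by
    rw [← Matrix.sum_stationary_pow hν.2 n s]
    exact le_sum_simplex_mul hν.1 fun s' => hn π hπ s' s
  exact mul_le_mul h1 (hX s _ (hπ s) a) hp₀.le (hε.le.trans h1)

lemma weights_nonempty [Nonempty S] [Nonempty A] (hu : ∀ s, uniformDist A ∈ M.X s) :
    M.weights.Nonempty := by
  have hfu : M.Feasible fun _ => uniformDist A := hu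
  obtain ⟨ν, hν⟩ := M.exists_isStationary hfu
  exact ⟨_, _, ν, Classical.arbitrary S, Classical.arbitrary A, hfu, hν, rfl⟩

lemma weights_mem_Icc {x : ℝ} (hx : x ∈ M.weights) : 0 ≤ x ∧ x ≤ 1 := by
  obtain ⟨π, ν, s, a, hπ, hν, rfl⟩ := hx
  exact ⟨mul_nonneg (hν.1.1 s) (hπ.nonneg s a), mul_le_one₀ (mem_stdSimplex_le_one hν.1 s)
    (hπ.nonneg s a) (mem_stdSimplex_le_one (hπ.mem_stdSimplex s) a)⟩

lemma Lmin_pos [Nonempty S] [Nonempty A] (hM : M.Regular) (hu : ∀ s, uniformDist A ∈ M.X s) :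
    0 < M.Lmin := by
  obtain ⟨ε, hε, h⟩ := M.exists_weights_ge hM hu
  exact mul_pos M.one_sub_γ_pos (hε.trans_le (le_csInf (M.weights_nonempty hu) h))

lemma sInf_weights_le {x : ℝ} (hx : x ∈ M.weights) : sInf M.weights ≤ x :=
  csInf_le ⟨0, fun _ h => (M.weights_mem_Icc h).1⟩ hx

lemma Lmin_le_one [Nonempty S] [Nonempty A] (hu : ∀ s, uniformDist A ∈ M.X s) : M.Lmin ≤ 1 := by
  obtain ⟨x, hx⟩ := M.weights_nonempty hu
  have h1 := (M.sInf_weights_le hx).trans (M.weights_mem_Icc hx).2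
  have := M.γ_pos
  have := M.one_sub_γ_pos
  unfold Lmin
  nlinarith

lemma Lmax_mem [Nonempty S] [Nonempty A] (hu : ∀ s, uniformDist A ∈ M.X s) :
    0 ≤ M.Lmax ∧ M.Lmax ≤ 1 := by
  have h1 : sSup M.weights ≤ 1 :=
    csSup_le (M.weights_nonempty hu) fun x hx => (M.weights_mem_Icc hx).2
  have h2 : 0 ≤ sSup M.weights := Real.sSup_nonneg fun x hx => (M.weights_mem_Icc hx).1
  have := M.γ_pos
  have := M.one_sub_γ_pos
  unfold Lmax
  constructor <;> nlinarith

lemma pair_stationary (hν : M.IsStationary π ν) (hπ : M.Feasible π) :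
    (fun z : S × A => ν z.1 * π z.1 z.2) ∈ stdSimplex ℝ (S × A) ∧
      ∀ z', ∑ z : S × A, ν z.1 * π z.1 z.2 * M.pairMatrix π z z' = ν z'.1 * π z'.1 z'.2 := by
  refine ⟨⟨fun z => mul_nonneg (hν.1.1 _) (hπ.nonneg _ _), ?_⟩, fun z' => ?_⟩
  · simp only [Fintype.sum_prod_type, ← Finset.mul_sum, hπ.sum_eq_one, mul_one]
    exact hν.1.2
  · rw [← hν.2 z'.1]
    simp only [Fintype.sum_prod_type, pairMatrix, stateMatrix, Matrix.of_apply, Finset.mul_sum,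
      Finset.sum_mul, mul_assoc]

lemma sub_bellman_eq (hπ : M.Feasible π) (θ : S × A → ℝ) (z : S × A) :
    θ z - M.bellman τ π θ z = (θ - M.Q τ π) z -
      M.γ * ∑ z', M.pairMatrix π z z' * (θ - M.Q τ π) z' := by
  rw [bellman_eq, Pi.sub_apply, Q_eq_pair M hπ z]
  simp only [Pi.sub_apply, mul_sub, Finset.sum_sub_distrib]
  ring

/-- `Ftilde` is supported at its starting pair, so only paths whose last transition starts at `y`
contribute. The mean operator differs from `F` only through the law of that pair in place of the
stationary weight. -/
lemma meanFtilde_eq (hπ : M.Feasible π) (θ : S × A → ℝ) (α : ℕ) (z y : S × A) :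
    M.meanFtilde τ π θ α z y =
      (M.pairMatrix π ^ (α - 1)) z y * (θ y - M.bellman τ π θ y) := by
  have hrow := (Matrix.mem_rowStochastic_iff_sum.1 (M.pairMatrix_mem hπ)).2 y
  rw [meanFtilde, Finset.sum_eq_single y]
  · congr 1
    simp only [Ftilde, Pi.single_eq_same, mul_sub, Finset.sum_sub_distrib, ← Finset.sum_mul, hrow,
      bellman_eq, mul_left_comm _ M.γ, ← Finset.mul_sum]
    ring
  · intro z₁ _ hz
    simp [Ftilde, Pi.single_eq_of_ne hz.symm]
  · simp

/-- Strong monotonicity of the temporal difference operator. -/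
lemma Lmin_mul_sq_le (hπ : M.Feasible π) (hν : M.IsStationary π ν) (θ : S × A → ℝ) :
    M.Lmin * l2norm (θ - M.Q τ π) ^ 2 ≤ ∑ z, (θ - M.Q τ π) z * M.F τ π ν θ z := by
  set δ := θ - M.Q τ π with hδ
  obtain ⟨hμ, hμP⟩ := M.pair_stationary hν hπ
  set μ : S × A → ℝ := fun z => ν z.1 * π z.1 z.2 with hμdef
  have hP := Matrix.mem_rowStochastic_iff_sum.1 (M.pairMatrix_mem hπ)
  have h1 : ∑ z, δ z * M.F τ π ν θ z = ∑ z, μ z * δ z ^ 2 -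
      M.γ * ∑ z, μ z * ∑ z', M.pairMatrix π z z' * (δ z * δ z') := by
    rw [Finset.mul_sum, ← Finset.sum_sub_distrib]
    refine Finset.sum_congr rfl fun z _ => ?_
    simp only [F, sub_bellman_eq M hπ, mul_left_comm _ (δ z), ← Finset.mul_sum, ← hδ, hμdef]
    ring
  -- From `2ab ≤ a² + b²`; by stationarity the squares at `z` and at `z'` have the same `μ`-average.
  have h2 : ∑ z, μ z * ∑ z', M.pairMatrix π z z' * (δ z * δ z') ≤ ∑ z, μ z * δ z ^ 2 := by
    have h3 : ∑ z, μ z * ∑ z', M.pairMatrix π z z' * ((δ z ^ 2 + δ z' ^ 2) / 2) =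
        ∑ z, μ z * δ z ^ 2 := by
      simp only [add_div, mul_add, Finset.sum_add_distrib, ← Finset.sum_mul, hP.2, one_mul]
      have h4 : ∑ z, μ z * ∑ z', M.pairMatrix π z z' * (δ z' ^ 2 / 2) =
          ∑ z, μ z * (δ z ^ 2 / 2) := by
        simp only [Finset.mul_sum, ← mul_assoc]
        rw [Finset.sum_comm]
        simp only [← Finset.sum_mul]
        exact Finset.sum_congr rfl fun z _ => by rw [hμP z]
      rw [h4, ← Finset.sum_add_distrib]
      exact Finset.sum_congr rfl fun z _ => by ring
    rw [← h3]
    refine Finset.sum_le_sum fun z _ => mul_le_mul_of_nonneg_left ?_ (hμ.1 z)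
    refine Finset.sum_le_sum fun z' _ => mul_le_mul_of_nonneg_left ?_ (hP.1 z z')
    nlinarith [sq_nonneg (δ z - δ z')]
  have h5 : sInf M.weights * l2norm δ ^ 2 ≤ ∑ z, μ z * δ z ^ 2 := by
    rw [l2norm_sq, Finset.mul_sum]
    exact Finset.sum_le_sum fun z _ => mul_le_mul_of_nonneg_right
      (M.sInf_weights_le ⟨π, ν, z.1, z.2, hπ, hν, rfl⟩) (sq_nonneg _)
  rw [h1, Lmin]
  nlinarith [mul_le_mul_of_nonneg_left h2 M.γ_pos.le, mul_le_mul_of_nonneg_left h5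
    M.one_sub_γ_pos.le]

/-- Mixing constants exist. -/
lemma exists_mixingConst [Nonempty A] (hM : M.Regular) (hu : ∀ s, uniformDist A ∈ M.X s) :
    ∃ C ρ, M.MixingConst C ρ := by
  rcases isEmpty_or_nonempty S with hS | hS
  -- With no states there is no starting pair, so any constants work.
  · exact ⟨1, 1 / 2, by norm_num, by norm_num, by norm_num,
      fun _ _ _ _ _ _ _ _ z => isEmptyElim z.1⟩
  obtain ⟨ε', hε', n, hn⟩ := M.exists_minorization hM hu
  obtain ⟨⟨p₀, hp₀, hX⟩, -⟩ := hM
  -- The cap `1/2` keeps `1 - ε`, and hence `ρ`, positive.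
  obtain ⟨ε, hε, hε1, hεle⟩ : ∃ ε : ℝ, 0 < ε ∧ ε < 1 ∧ ε ≤ ε' * p₀ :=
    ⟨min (1 / 2) (ε' * p₀), by positivity, (min_le_left _ _).trans_lt (by norm_num),
      min_le_right _ _⟩
  have hmin : ∀ π, M.Feasible π → ∀ z z', ε ≤ (M.pairMatrix π ^ (n + 1)) z z' := by
    intro π hπ z z'
    rw [pairMatrix_pow_succ_apply]
    have h1 := le_sum_simplex_mul (M.P_mem z.1 z.2) fun s => hn π hπ s z'.1
    exact hεle.trans (mul_le_mul h1 (hX _ _ (hπ _) _) hp₀.le (hε'.le.trans h1))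
  set ρ : ℝ := (1 - ε) ^ (1 / ((n + 1 : ℕ) : ℝ)) with hρ
  have hρ0 : 0 < ρ := Real.rpow_pos_of_pos (by linarith) _
  have hρ1 : ρ < 1 := Real.rpow_lt_one (by linarith) (by linarith) (by positivity)
  have hρn : ρ ^ (n + 1) = 1 - ε := by
    rw [hρ, one_div, Real.rpow_inv_natCast_pow (by linarith) (by omega)]
  have hmix : ∀ π ν, M.Feasible π → M.IsStationary π ν → ∀ (t : ℕ) (z y : S × A),
      |(M.pairMatrix π ^ t) z y - ν y.1 * π y.1 y.2| ≤ ρ ^ t / ρ ^ (n + 1) := by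
    intro π ν hπ hν t z y
    obtain ⟨hμ, hμP⟩ := M.pair_stationary hν hπ
    have h1 := Matrix.abs_pow_sub_stationary_le (M.pairMatrix_mem hπ) hμ hμP hε.le (hmin π hπ)
      (t / (n + 1)) (t % (n + 1)) z y
    rw [Nat.div_add_mod'] at h1
    refine h1.trans ?_
    rw [← hρn, ← pow_mul, le_div_iff₀ (by positivity), ← pow_add]
    refine pow_le_pow_of_le_one hρ0.le hρ1.le ?_
    have := Nat.div_add_mod t (n + 1)
    have := Nat.mod_lt t (by omega : n + 1 > 0)
    omega
  -- The exponent `n + 2` is `n + 1`, lost by rounding `t` down to a multiple of `n + 1`, plus one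
  -- because the last transition starts after `α - 1` steps. The `2` bounds `1 + γ`, and the root of
  -- the cardinality passes from the maximum to the Euclidean norm.
  refine ⟨Real.sqrt (Fintype.card (S × A)) * (2 / ρ ^ (n + 2)), ρ, ?_, hρ0, hρ1, ?_⟩
  · have : 0 < Fintype.card (S × A) := Fintype.card_pos
    positivity
  intro π ν hπ hν τ _ α hα z θ
  have hδ0 := l2norm_nonneg (θ - M.Q τ π)
  refine (l2norm_le_of_abs_le (b := 2 / ρ ^ (n + 2) * ρ ^ α * l2norm (θ - M.Q τ π))
    (by positivity) fun y => ?_).trans (le_of_eq (by ring))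
  rw [Pi.sub_apply, meanFtilde_eq M hπ, F, ← sub_mul, abs_mul, abs_sub_comm]
  have h1 := hmix π ν hπ hν (α - 1) z y
  have h2 : |θ y - M.bellman τ π θ y| ≤ 2 * l2norm (θ - M.Q τ π) := by
    rw [sub_bellman_eq M hπ]
    have h3 := abs_le.1 (Matrix.abs_sum_row_mul_le (M.pairMatrix_mem hπ)
      (abs_le_l2norm (θ - M.Q τ π)) y)
    have h4 := abs_le.1 (abs_le_l2norm (θ - M.Q τ π) y)
    have := M.γ_pos
    have := M.γ_lt_one
    rw [abs_le]
    constructor <;> nlinarith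
  refine (mul_le_mul h1 h2 (abs_nonneg _) (by positivity)).trans (le_of_eq ?_)
  obtain ⟨m, rfl⟩ : ∃ m, α = m + 1 := ⟨α - 1, by omega⟩
  rw [Nat.add_sub_cancel]
  field_simp
  ring

end RegMDP

/-! ### Integration of functions of finitely many trajectory points -/

section FinitePaths

open MeasureTheory

variable {E Ω : Type*} [Fintype E] [DecidableEq E] [MeasurableSpace Ω] {μ : Measure Ω}
  [IsProbabilityMeasure μ] {Z : ℕ → Ω → E}

lemma integrable_sum_indicator {J : Type*} [Fintype J] {B : J → Set Ω}
    (hB : ∀ j, MeasurableSet (B j)) (c : J → ℝ) :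
    Integrable (fun x => ∑ j, (B j).indicator (fun _ => c j) x) μ :=
  integrable_finsetSum _ fun j _ => (integrable_const (c j)).indicator (hB j)

lemma integral_sum_indicator {J : Type*} [Fintype J] {B : J → Set Ω}
    (hB : ∀ j, MeasurableSet (B j)) (c : J → ℝ) :
    ∫ x, ∑ j, (B j).indicator (fun _ => c j) x ∂μ = ∑ j, μ.real (B j) * c j := by
  rw [integral_finsetSum _ fun j _ => (integrable_const (c j)).indicator (hB j)]
  refine Finset.sum_congr rfl fun j _ => ?_
  rw [integral_indicator_const _ (hB j), smul_eq_mul]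

/-- Extension of a finite path by its last value. -/
def extendPath {n : ℕ} (v : Fin (n + 1) → E) : ℕ → E := fun i => v ⟨min i n, by omega⟩

lemma eq_extendPath_iff {n : ℕ} (v : Fin (n + 1) → E) (w : ℕ → E) :
    (∀ i ≤ n, w i = extendPath v i) ↔ (fun i : Fin (n + 1) => w i) = v := by
  constructor
  · intro h
    funext i
    have hi : min i.1 n = i.1 := by omega
    rw [h i (by omega), extendPath]
    congr 1
    exact Fin.ext hi
  · rintro rfl i hi
    simp only [extendPath]
    congr 1
    omega

lemma measurableSet_path (hZ : ∀ n z, MeasurableSet {x | Z n x = z}) (n : ℕ) (w : ℕ → E) :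
    MeasurableSet {x | ∀ i ≤ n, Z i x = w i} := by
  have h : {x | ∀ i ≤ n, Z i x = w i} = ⋂ i, ⋂ (_ : i ≤ n), {x | Z i x = w i} := by
    ext x
    simp
  rw [h]
  exact MeasurableSet.iInter fun i => MeasurableSet.iInter fun _ => hZ i _

/-- A function of the first `n + 1` points takes finitely many values, one per prefix. Integrability
and conditioning thereby reduce to finite sums. -/
lemma eq_sum_indicator_path (Z : ℕ → Ω → E) {n : ℕ} {g : (ℕ → E) → ℝ}
    (hg : DependsOn g (Set.Iic n)) (x : Ω) :
    g (fun i => Z i x) = ∑ v : Fin (n + 1) → E,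
      {x | ∀ i ≤ n, Z i x = extendPath v i}.indicator (fun _ => g (extendPath v)) x := by
  rw [Finset.sum_eq_single fun i : Fin (n + 1) => Z i x]
  · have h := (eq_extendPath_iff (fun i : Fin (n + 1) => Z i x) fun i => Z i x).2 rfl
    rw [Set.indicator_of_mem (by exact h)]
    exact hg fun i hi => h i hi
  · intro v _ hv
    refine Set.indicator_of_notMem (fun h => hv ?_) _
    exact ((eq_extendPath_iff v fun i => Z i x).1 h).symm
  · simp

lemma integrable_path (hZ : ∀ n z, MeasurableSet {x | Z n x = z}) {n : ℕ} {g : (ℕ → E) → ℝ}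
    (hg : DependsOn g (Set.Iic n)) : Integrable (fun x => g fun i => Z i x) μ := by
  simp only [eq_sum_indicator_path Z hg]
  exact integrable_sum_indicator (fun v => measurableSet_path hZ n _) _

lemma integral_path (hZ : ∀ n z, MeasurableSet {x | Z n x = z}) {n : ℕ} {g : (ℕ → E) → ℝ}
    (hg : DependsOn g (Set.Iic n)) :
    ∫ x, g (fun i => Z i x) ∂μ = ∑ v : Fin (n + 1) → E,
      μ.real {x | ∀ i ≤ n, Z i x = extendPath v i} * g (extendPath v) := by
  simp only [eq_sum_indicator_path Z hg]
  exact integral_sum_indicator (fun v => measurableSet_path hZ n _) _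

/-- Conditioning on the path up to time `n`. -/
lemma integral_next (hZ : ∀ n z, MeasurableSet {x | Z n x = z}) {n : ℕ} {κ H : (ℕ → E) → E → ℝ}
    (hκ : DependsOn κ (Set.Iic n)) (hH : DependsOn H (Set.Iic n))
    (hcond : ∀ w : ℕ → E, μ.real {x | ∀ i ≤ n + 1, Z i x = w i} =
      μ.real {x | ∀ i ≤ n, Z i x = w i} * κ w (w (n + 1))) :
    ∫ x, H (fun i => Z i x) (Z (n + 1) x) ∂μ =
      ∫ x, ∑ z, κ (fun i => Z i x) z * H (fun i => Z i x) z ∂μ := by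
  have hL : ∀ x, H (fun i => Z i x) (Z (n + 1) x) = ∑ j : E × (Fin (n + 1) → E),
      ({x | ∀ i ≤ n, Z i x = extendPath j.2 i} ∩ {x | Z (n + 1) x = j.1}).indicator
        (fun _ => H (extendPath j.2) j.1) x := by
    intro x
    rw [Fintype.sum_prod_type, Finset.sum_eq_single (Z (n + 1) x)]
    · have hg : DependsOn (fun w => H w (Z (n + 1) x)) (Set.Iic n) :=
        fun w w' h => congrFun (hH h) _
      rw [eq_sum_indicator_path Z hg]
      refine Finset.sum_congr rfl fun v _ => ?_
      by_cases h : ∀ i ≤ n, Z i x = extendPath v i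
      · rw [Set.indicator_of_mem (by exact h), Set.indicator_of_mem (by exact ⟨h, rfl⟩)]
      · rw [Set.indicator_of_notMem (by exact h), Set.indicator_of_notMem fun h' => h h'.1]
    · intro z _ hz
      exact Finset.sum_eq_zero fun v _ => Set.indicator_of_notMem (fun h => hz h.2.symm) _
    · simp
  have hR : DependsOn (fun w => ∑ z, κ w z * H w z) (Set.Iic n) := fun w w' h => by
    simp only [hκ h, hH h]
  rw [integral_path hZ hR]
  simp only [hL]
  rw [integral_sum_indicator fun j => (measurableSet_path hZ n _).inter (hZ _ _),
    Fintype.sum_prod_type, Finset.sum_comm]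
  refine Finset.sum_congr rfl fun v _ => ?_
  rw [Finset.mul_sum]
  refine Finset.sum_congr rfl fun z _ => ?_
  -- Placing `z` at time `n + 1` does not disturb the prefix, so `hcond` at the updated path gives
  -- the probability of the prefix followed by `z`.
  have hupd : ∀ i ∈ Set.Iic n, Function.update (extendPath v) (n + 1) z i = extendPath v i :=
    fun i hi => Function.update_of_ne (by have := Set.mem_Iic.1 hi; omega) _ _
  have h1 := hcond (Function.update (extendPath v) (n + 1) z)
  rw [Function.update_self, hκ hupd] at h1
  have h2 : {x | ∀ i ≤ n, Z i x = Function.update (extendPath v) (n + 1) z i} =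
      {x | ∀ i ≤ n, Z i x = extendPath v i} :=
    Set.ext fun x => forall₂_congr fun i hi => by rw [hupd i hi]
  have h3 : {x | ∀ i ≤ n + 1, Z i x = Function.update (extendPath v) (n + 1) z i} =
      {x | ∀ i ≤ n, Z i x = extendPath v i} ∩ {x | Z (n + 1) x = z} := by
    rw [← h2]
    ext x
    constructor
    · intro h
      refine ⟨fun i hi => h i (by omega), ?_⟩
      have := h (n + 1) le_rfl
      rwa [Function.update_self] at this
    · rintro ⟨h, h'⟩ i hi
      rcases Nat.le_succ_iff.1 hi with hi | rfl
      · exact h i hi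
      · rw [Function.update_self]
        exact h'
  rw [h2, h3] at h1
  rw [h1]
  ring

end FinitePaths

/-! ### The law of the trajectory during one SAPMD iteration -/

lemma Schedule.samples_succ (σ : Schedule) (k : ℕ) :
    σ.samples (k + 1) = σ.samples k + σ.T k * σ.α k := Finset.sum_range_succ _ _

namespace RegMDP

open MeasureTheory

variable {S A : Type*} [Fintype S] [Fintype A] [DecidableEq S] [DecidableEq A]
  (M : RegMDP S A) {σ : Schedule}

lemma ctd_congr (k : ℕ) (π : S → A → ℝ) (t : ℕ) {w w' : ℕ → S × A}
    (h : ∀ i ≤ σ.samples k + t * σ.α k, w i = w' i) :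
    M.ctd σ w k π t = M.ctd σ w' k π t := by
  induction t with
  | zero => rfl
  | succ t ih =>
    have h1 : (t + 1) * σ.α k = t * σ.α k + σ.α k := by ring
    rw [ctd, ctd, ih fun i hi => h i (by omega), h _ le_rfl, h _ (by omega)]

/-- The policy `π_k` is a deterministic function of the points with index at most `samples k`,
inclusive: the endpoint of one iteration is the starting pair of the next. Given this past, the
policy of iteration `k` can be treated as fixed. -/
lemma iter_dependsOn (k : ℕ) :
    DependsOn (fun w => M.iter σ w k) (Set.Iic (σ.samples k)) := by
  induction k with
  | zero => exact fun _ _ _ => rfl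
  | succ k ih =>
    intro w w' h
    have hle : σ.samples k ≤ σ.samples (k + 1) := by rw [σ.samples_succ]; omega
    have h1 : M.iter σ w k = M.iter σ w' k := ih fun i hi => h i (le_trans hi hle)
    have h2 := M.ctd_congr k (M.iter σ w' k) (σ.T k) fun i hi => h i (by
      rw [σ.samples_succ]; exact hi)
    simp only [iter, h1, h2]

/-- CTD parameters of iteration `k` after `t` updates. -/
noncomputable def param (σ : Schedule) (k t : ℕ) (w : ℕ → S × A) : S × A → ℝ :=
  M.ctd σ w k (M.iter σ w k) t

lemma param_dependsOn (k t : ℕ) :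
    DependsOn (M.param σ k t) (Set.Iic (σ.samples k + t * σ.α k)) := by
  intro w w' h
  have h1 := M.iter_dependsOn k fun i hi => h i (le_trans hi (Nat.le_add_right _ _))
  simp only at h1
  rw [param, param, h1]
  exact M.ctd_congr k _ t h

variable {Ω : Type*} [MeasurableSpace Ω] {μ : Measure Ω} [IsProbabilityMeasure μ]
  {Z : ℕ → Ω → S × A}

lemma IsTrajectory.integral_succ {M : RegMDP S A} (hZ : M.IsTrajectory σ μ Z)
    {k n : ℕ} (hk : σ.samples k ≤ n) (hk' : n < σ.samples (k + 1))
    {H : (ℕ → S × A) → S × A → ℝ} (hH : DependsOn H (Set.Iic n)) :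
    ∫ x, H (fun i => Z i x) (Z (n + 1) x) ∂μ =
      ∫ x, ∑ z, M.pairMatrix (M.iter σ (fun i => Z i x) k) (Z n x) z * H (fun i => Z i x) z ∂μ :=
  integral_next (κ := fun w z => M.pairMatrix (M.iter σ w k) (w n) z) hZ.1 (fun w w' h => by
    have h1 := M.iter_dependsOn k fun i hi => h i (le_trans hi hk)
    simp only at h1
    simp only [h1, h n (Set.mem_Iic.2 le_rfl)]) hH (hZ.2 k n hk hk')

/-- Within one iteration the policy is frozen, so integrating out one point at a time composes
copies of a single transition matrix. -/
lemma IsTrajectory.integral_add {M : RegMDP S A} (hZ : M.IsTrajectory σ μ Z)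
    {k n : ℕ} (hk : σ.samples k ≤ n) (j : ℕ)
    (hk' : n + j ≤ σ.samples (k + 1)) {H : (ℕ → S × A) → S × A → ℝ}
    (hH : DependsOn H (Set.Iic n)) :
    ∫ x, H (fun i => Z i x) (Z (n + j) x) ∂μ =
      ∫ x, ∑ z, (M.pairMatrix (M.iter σ (fun i => Z i x) k) ^ j) (Z n x) z *
        H (fun i => Z i x) z ∂μ := by
  induction j generalizing H with
  | zero => simp [Matrix.one_apply]
  | succ j ih =>
    rw [← add_assoc, hZ.integral_succ (by omega : σ.samples k ≤ n + j) (by omega)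
      (hH.mono (Set.Iic_subset_Iic.2 (by omega)))]
    have hdep : DependsOn (fun (w : ℕ → S × A) (y : S × A) =>
        ∑ z, M.pairMatrix (M.iter σ w k) y z * H w z) (Set.Iic n) := by
      intro w w' h
      have h1 := M.iter_dependsOn k fun i hi => h i (le_trans hi hk)
      simp only at h1
      simp only [h1, hH h]
    rw [ih (by omega) hdep]
    refine integral_congr_ae (ae_of_all _ fun x => ?_)
    simp only [pow_succ, Matrix.mul_apply, Finset.mul_sum, Finset.sum_mul, mul_assoc]
    rw [Finset.sum_comm]

/-- Law of the last transition of a block. -/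
lemma IsTrajectory.integral_transition {M : RegMDP S A} (hZ : M.IsTrajectory σ μ Z)
    (hα : ∀ k, 1 ≤ σ.α k) {k n : ℕ} (hk : σ.samples k ≤ n)
    (hk' : n + σ.α k ≤ σ.samples (k + 1)) {H : (ℕ → S × A) → S × A → S × A → ℝ}
    (hH : DependsOn H (Set.Iic n)) :
    ∫ x, H (fun i => Z i x) (Z (n + σ.α k - 1) x) (Z (n + σ.α k) x) ∂μ =
      ∫ x, ∑ y, (M.pairMatrix (M.iter σ (fun i => Z i x) k) ^ (σ.α k - 1)) (Z n x) y *
        ∑ z, M.pairMatrix (M.iter σ (fun i => Z i x) k) y z * H (fun i => Z i x) y z ∂μ := by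
  obtain ⟨j, hj⟩ : ∃ j, σ.α k = j + 1 := ⟨σ.α k - 1, by have := hα k; omega⟩
  rw [hj] at hk' ⊢
  have h1 : DependsOn (fun (w : ℕ → S × A) z => H w (w (n + j)) z) (Set.Iic (n + j)) := by
    intro w w' h
    simp only [hH fun i hi => h i (le_trans hi (by omega : n ≤ n + j)),
      h (n + j) (Set.mem_Iic.2 le_rfl)]
  have h2 := hZ.integral_succ (by omega : σ.samples k ≤ n + j) (by omega) h1
  have h3 : DependsOn (fun (w : ℕ → S × A) (y : S × A) =>
      ∑ z, M.pairMatrix (M.iter σ w k) y z * H w y z) (Set.Iic n) := by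
    intro w w' h
    have h1 := M.iter_dependsOn k fun i hi => h i (le_trans hi hk)
    simp only at h1
    simp only [h1, hH h]
  rw [← add_assoc, Nat.add_sub_cancel, Nat.add_sub_cancel, h2]
  exact hZ.integral_add hk j (by omega) h3

end RegMDP

/-! ### Stochastic approximation, progress of one CTD update and constants of the schedule -/

/-- Convergence rate of stochastic approximation with stepsizes of order `1/t`. -/
lemma stochastic_approximation_rate {a : ℕ → ℝ} {t₀ D B : ℝ} (ht₀ : 3 ≤ t₀) (hD : 0 ≤ D)
    (hB : 0 ≤ B) {T : ℕ} (h0 : a 0 ≤ B)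
    (h : ∀ t < T, a (t + 1) ≤ (1 - 3 / (t + t₀)) * a t + 2 * D / (t + t₀) ^ 2) :
    ∀ t ≤ T, a t ≤ t₀ ^ 2 * B / (t + t₀) ^ 2 + D / (t + t₀) := by
  intro t ht
  induction t with
  | zero =>
    rw [Nat.cast_zero, zero_add, mul_div_cancel_left₀ _ (by positivity)]
    have : 0 ≤ D / t₀ := by positivity
    linarith
  | succ t ih =>
    have hn : 3 ≤ (t : ℝ) + t₀ := by linarith [Nat.cast_nonneg (α := ℝ) t]
    have h1 := h t (by omega)
    have h2 := ih (by omega)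
    rw [Nat.cast_succ, add_right_comm]
    set n : ℝ := t + t₀ with hndef
    have hE : 0 ≤ t₀ ^ 2 * B := by positivity
    set E := t₀ ^ 2 * B
    have h3 : 0 ≤ 1 - 3 / n := by
      rw [sub_nonneg, div_le_one (by linarith)]
      exact hn
    have h4 := mul_le_mul_of_nonneg_left h2 h3
    -- The initial error decays quadratically because `(n-3)(n+1)² ≤ n³`; the noise bound `D/n`
    -- propagates because `(n-1)(n+1) ≤ n²`.
    have h5 : (1 - 3 / n) * (E / n ^ 2) ≤ E / (n + 1) ^ 2 := by
      have e : (1 - 3 / n) * (E / n ^ 2) = E * (n - 3) / n ^ 3 := by field_simp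
      rw [e, div_le_div_iff₀ (by positivity) (by positivity), mul_assoc]
      exact mul_le_mul_of_nonneg_left (by nlinarith) hE
    have h6 : (1 - 3 / n) * (D / n) + 2 * D / n ^ 2 ≤ D / (n + 1) := by
      have e : (1 - 3 / n) * (D / n) + 2 * D / n ^ 2 = D * (n - 1) / n ^ 2 := by
        field_simp; ring
      rw [e, div_le_div_iff₀ (by positivity) (by positivity), mul_assoc]
      exact mul_le_mul_of_nonneg_left (by nlinarith) hD
    rw [mul_add] at h4
    linarith

namespace RegMDP

variable {S A : Type*} [Fintype S] [Fintype A] [DecidableEq S] [DecidableEq A]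
  (M : RegMDP S A) {π : S → A → ℝ} {ν : S → ℝ} {τ : ℝ}

lemma l2norm_sub_smul_Ftilde_sq (θ δ : S × A → ℝ) (β : ℝ) (y z : S × A) :
    l2norm (δ - β • M.Ftilde τ π θ y z) ^ 2 =
      l2norm δ ^ 2 - 2 * β * ∑ i, δ i * M.Ftilde τ π θ y z i +
        β ^ 2 * (θ y - M.stageCost τ π y - M.γ * θ z) ^ 2 := by
  have h1 : ∑ i, M.Ftilde τ π θ y z i ^ 2 = (θ y - M.stageCost τ π y - M.γ * θ z) ^ 2 := by
    rw [Finset.sum_eq_single y]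
    · rw [Ftilde, Pi.single_eq_same]
    · intro i _ hi
      rw [Ftilde, Pi.single_eq_of_ne hi, sq, zero_mul]
    · simp
  rw [← h1, l2norm_sq, l2norm_sq, Finset.mul_sum, Finset.mul_sum, ← Finset.sum_sub_distrib,
    ← Finset.sum_add_distrib]
  refine Finset.sum_congr rfl fun i _ => ?_
  simp only [Pi.sub_apply, Pi.smul_apply, smul_eq_mul]
  ring

lemma sum_mul_meanFtilde (θ δ : S × A → ℝ) (α : ℕ) (z₀ : S × A) :
    ∑ i, δ i * M.meanFtilde τ π θ α z₀ i =
      ∑ y, (M.pairMatrix π ^ (α - 1)) z₀ y * ∑ z, M.pairMatrix π y z *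
        ∑ i, δ i * M.Ftilde τ π θ y z i := by
  simp only [meanFtilde, Finset.mul_sum]
  rw [Finset.sum_comm]
  refine Finset.sum_congr rfl fun y _ => ?_
  rw [Finset.sum_comm]
  refine Finset.sum_congr rfl fun z _ => Finset.sum_congr rfl fun i _ => ?_
  ring

/-- Writing `θ = δ + Q_τ^π` separates a part proportional to `‖δ‖`, which enters the contraction
factor, from a constant noise level. -/
lemma td_error_sq_le {θ : S × A → ℝ} {b Θ : ℝ} (hb : ∀ z, |M.stageCost τ π z| ≤ b)
    (hΘ : l2norm (M.Q τ π) ≤ Θ) (y z : S × A) :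
    (θ y - M.stageCost τ π y - M.γ * θ z) ^ 2 ≤
      2 * (1 + M.γ) ^ 2 * l2norm (θ - M.Q τ π) ^ 2 + (4 * (1 + M.γ) ^ 2 * Θ ^ 2 + 4 * b ^ 2) := by
  have hγ := M.γ_pos
  have h1 := abs_le.1 (abs_le_l2norm (θ - M.Q τ π) y)
  have h2 := abs_le.1 (abs_le_l2norm (θ - M.Q τ π) z)
  have h3 := abs_le.1 ((abs_le_l2norm (M.Q τ π) y).trans hΘ)
  have h4 := abs_le.1 ((abs_le_l2norm (M.Q τ π) z).trans hΘ)
  have h5 := abs_le.1 (hb y)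
  simp only [Pi.sub_apply] at h1 h2
  set d := l2norm (θ - M.Q τ π)
  have h6 : |θ y - M.stageCost τ π y - M.γ * θ z| ≤ (1 + M.γ) * d + ((1 + M.γ) * Θ + b) := by
    rw [abs_le]
    constructor <;> nlinarith
  have h7 := sq_le_sq' (abs_le.1 h6).1 (abs_le.1 h6).2
  nlinarith [sq_nonneg ((1 + M.γ) * d - ((1 + M.γ) * Θ + b)), sq_nonneg ((1 + M.γ) * Θ - b)]

/-- Expected progress of one update of conditional temporal difference learning. -/
lemma expected_update_le (hπ : M.Feasible π) (hν : M.IsStationary π ν) (hτ : 0 ≤ τ) {C ρ : ℝ}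
    (hmix : M.MixingConst C ρ) {α : ℕ} (hα : 1 ≤ α) {b Θ β : ℝ}
    (hb : ∀ z, |M.stageCost τ π z| ≤ b) (hΘ : l2norm (M.Q τ π) ≤ Θ) (hβ : 0 ≤ β)
    (θ : S × A → ℝ) (z₀ : S × A) :
    ∑ y, (M.pairMatrix π ^ (α - 1)) z₀ y * ∑ z, M.pairMatrix π y z *
        l2norm (θ - β • M.Ftilde τ π θ y z - M.Q τ π) ^ 2 ≤
      (1 - 2 * β * (M.Lmin - C * ρ ^ α) + β ^ 2 * (2 * (1 + M.γ) ^ 2)) *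
          l2norm (θ - M.Q τ π) ^ 2 +
        β ^ 2 * (4 * (1 + M.γ) ^ 2 * Θ ^ 2 + 4 * b ^ 2) := by
  set δ := θ - M.Q τ π with hδ
  have hP := M.pairMatrix_mem hπ
  have hPα := Matrix.mem_rowStochastic_iff_sum.1 (pow_mem hP (α - 1))
  have hP' := Matrix.mem_rowStochastic_iff_sum.1 hP
  have h1 : ∀ y z, l2norm (θ - β • M.Ftilde τ π θ y z - M.Q τ π) ^ 2 ≤
      (l2norm δ ^ 2 + β ^ 2 * (2 * (1 + M.γ) ^ 2 * l2norm δ ^ 2 +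
        (4 * (1 + M.γ) ^ 2 * Θ ^ 2 + 4 * b ^ 2))) -
      2 * β * ∑ i, δ i * M.Ftilde τ π θ y z i := by
    intro y z
    rw [sub_right_comm, ← hδ, l2norm_sub_smul_Ftilde_sq]
    linarith [mul_le_mul_of_nonneg_left (M.td_error_sq_le hb hΘ (θ := θ) y z) (sq_nonneg β)]
  set c := l2norm δ ^ 2 + β ^ 2 * (2 * (1 + M.γ) ^ 2 * l2norm δ ^ 2 +
        (4 * (1 + M.γ) ^ 2 * Θ ^ 2 + 4 * b ^ 2)) with hc
  have h2 : ∑ y, (M.pairMatrix π ^ (α - 1)) z₀ y * ∑ z, M.pairMatrix π y z *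
        l2norm (θ - β • M.Ftilde τ π θ y z - M.Q τ π) ^ 2 ≤
      c - 2 * β * ∑ i, δ i * M.meanFtilde τ π θ α z₀ i := by
    calc _ ≤ ∑ y, (M.pairMatrix π ^ (α - 1)) z₀ y * ∑ z, M.pairMatrix π y z *
          (c - 2 * β * ∑ i, δ i * M.Ftilde τ π θ y z i) :=
          Finset.sum_le_sum fun y _ => mul_le_mul_of_nonneg_left (Finset.sum_le_sum fun z _ =>
            mul_le_mul_of_nonneg_left (h1 y z) (hP'.1 y z)) (hPα.1 z₀ y)
      _ = _ := by
          simp only [mul_sub, Finset.sum_sub_distrib, ← Finset.sum_mul, hP'.2, hPα.2, one_mul,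
            mul_left_comm _ (2 * β), ← Finset.mul_sum (a := 2 * β), sum_mul_meanFtilde]
  have h3 := M.Lmin_mul_sq_le (τ := τ) hπ hν θ
  have h4 := sum_mul_le_l2norm δ (M.F τ π ν θ - M.meanFtilde τ π θ α z₀)
  have h5 := mul_le_mul_of_nonneg_left (hmix.2.2.2 π ν hπ hν τ hτ α hα z₀ θ) (l2norm_nonneg δ)
  simp only [Pi.sub_apply, mul_sub, Finset.sum_sub_distrib] at h4
  rw [← hδ] at h3 h5
  -- Strong monotonicity of `F`, minus the bias bounded by Cauchy-Schwarz and the mixing inequality;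
  -- both are proportional to `‖δ‖²`.
  have h6 : (M.Lmin - C * ρ ^ α) * l2norm δ ^ 2 ≤ ∑ i, δ i * M.meanFtilde τ π θ α z₀ i := by
    nlinarith
  have h7 := mul_le_mul_of_nonneg_left h6 (mul_nonneg zero_le_two hβ)
  rw [hc] at h2
  nlinarith

/-- Standing assumptions: bounded costs and regularizers, feasible uniform policy, ergodicity. -/
structure Admissible (M : RegMDP S A) (cbar hbar : ℝ) : Prop where
  cost_le : ∀ s a, |M.c s a| ≤ cbar
  reg_le : ∀ s, ∀ p ∈ M.X s, |M.h s p| ≤ hbar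
  uniform_mem : ∀ s, uniformDist A ∈ M.X s
  regular : M.Regular
  nonempty : Nonempty S

variable [Nontrivial A]

lemma log_card_pos : 0 < Real.log (Fintype.card A) :=
  Real.log_pos (by exact_mod_cast Fintype.one_lt_card)

lemma tau_pos (k : ℕ) : 0 < M.tau k := by
  have := M.γ_pos
  have := log_card_pos (A := A)
  unfold tau
  positivity

lemma tau_eq (k : ℕ) : M.tau k = 2 * M.tau 0 * (1 / 2) ^ (k / M.epoch + 1) := by
  simp only [tau, Nat.zero_div, zero_add, pow_one]
  ring

lemma tau_le_tau_zero (k : ℕ) : M.tau k ≤ M.tau 0 := by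
  rw [tau_eq, pow_succ]
  have h1 : ((1 : ℝ) / 2) ^ (k / M.epoch) ≤ 1 := pow_le_one₀ (by norm_num) (by norm_num)
  nlinarith [M.tau_pos 0]

lemma tau_zero_mul_log : M.tau 0 * Real.log (Fintype.card A) =
    Real.sqrt (Real.log (Fintype.card A)) / Real.sqrt M.γ / 2 := by
  have h := log_card_pos (A := A)
  have hs := Real.mul_self_sqrt h.le
  have hs' := Real.sqrt_pos.2 h
  have hγ := Real.sqrt_pos.2 M.γ_pos
  simp only [tau, Nat.zero_div, zero_add, pow_one]
  rw [Real.sqrt_mul M.γ_pos.le]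
  set u := Real.sqrt (Real.log (Fintype.card A))
  rw [← hs]
  field_simp

variable {cbar hbar : ℝ} {M}

section

variable (h : M.Admissible cbar hbar)
include h

lemma Admissible.cbar_nonneg : 0 ≤ cbar := by
  obtain ⟨s⟩ := h.nonempty
  exact (abs_nonneg _).trans (h.cost_le s (Classical.arbitrary A))

lemma Admissible.hbar_nonneg : 0 ≤ hbar := by
  obtain ⟨s⟩ := h.nonempty
  exact (abs_nonneg _).trans (h.reg_le s _ (h.uniform_mem s))

lemma Admissible.klDist_uniform_mem (hπ : M.Feasible π) (s : S) :
    0 ≤ klDist (π s) (uniformDist A) ∧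
      klDist (π s) (uniformDist A) ≤ Real.log (Fintype.card A) :=
  ⟨klDist_nonneg (hπ.mem_stdSimplex s) (M.X_subset s (h.uniform_mem s)) uniformDist_pos,
    klDist_uniformDist_le (hπ.mem_stdSimplex s)⟩

lemma Admissible.abs_stageCost_le (hπ : M.Feasible π) (hτ : 0 ≤ τ) (z : S × A) :
    |M.stageCost τ π z| ≤ cbar + hbar + τ * Real.log (Fintype.card A) := by
  obtain ⟨h1, h2⟩ := h.klDist_uniform_mem hπ z.1
  have h3 := abs_le.1 (h.cost_le z.1 z.2)
  have h4 := abs_le.1 (h.reg_le z.1 _ (hπ z.1))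
  have h5 := mul_le_mul_of_nonneg_left h2 hτ
  have h6 := mul_nonneg hτ h1
  rw [stageCost, abs_le]
  constructor <;> linarith

lemma Admissible.abs_stageCost_le_costBound (hπ : M.Feasible π) (hτ : 0 ≤ τ) (hτ' : τ ≤ M.tau 0)
    (z : S × A) : |M.stageCost τ π z| ≤ M.costBound cbar hbar := by
  refine (h.abs_stageCost_le hπ hτ z).trans ?_
  have := mul_le_mul_of_nonneg_right hτ' (log_card_pos (A := A)).le
  unfold costBound
  linarith

lemma Admissible.l2norm_Q_le (hπ : M.Feasible π) (hτ : 0 ≤ τ) (hτ' : τ ≤ M.tau 0) :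
    l2norm (M.Q τ π) ≤ M.thetaStar := by
  refine le_csSup ⟨Real.sqrt (Fintype.card (S × A)) * (M.costBound cbar hbar / (1 - M.γ)), ?_⟩
    ⟨π, τ, hπ, hτ, hτ', rfl⟩
  rintro _ ⟨π, τ, hπ, hτ, hτ', rfl⟩
  have hb := h.abs_stageCost_le_costBound hπ hτ hτ'
  obtain ⟨s⟩ := h.nonempty
  exact l2norm_le_of_abs_le (div_nonneg ((abs_nonneg _).trans (hb (s, Classical.arbitrary A)))
    M.one_sub_γ_pos.le) (M.abs_Q_le hπ hb)

omit h in
lemma thetaStar_nonneg : 0 ≤ M.thetaStar := by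
  refine Real.sSup_nonneg ?_
  rintro _ ⟨π, τ, -, -, -, rfl⟩
  exact l2norm_nonneg _

/-- Already the entropy part `τ_0 log|A| ≥ √(log 2)/2` exceeds `2/5`. This numerical floor keeps the
schedule's constants away from zero even if costs and regularizers vanish. -/
lemma Admissible.costBound_ge : 2 / 5 ≤ M.costBound cbar hbar := by
  have h1 := h.cbar_nonneg
  have h2 := h.hbar_nonneg
  have h3 : Real.log 2 ≤ Real.log (Fintype.card A) :=
    Real.log_le_log (by norm_num) (by exact_mod_cast Fintype.one_lt_card)
  have h4 : 4 / 5 ≤ Real.sqrt (Real.log (Fintype.card A)) :=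
    Real.le_sqrt_of_sq_le (by linarith [Real.log_two_gt_d9])
  have h5 : Real.sqrt M.γ ≤ 1 := Real.sqrt_le_one.2 M.γ_lt_one.le
  have h6 : Real.sqrt (Real.log (Fintype.card A)) ≤
      Real.sqrt (Real.log (Fintype.card A)) / Real.sqrt M.γ := by
    rw [le_div_iff₀ (Real.sqrt_pos.2 M.γ_pos)]
    nlinarith
  rw [costBound, tau_zero_mul_log]
  linarith

lemma Admissible.Rsq_ge : 1 / 20 ≤ M.Rsq cbar hbar := by
  have h1 := h.costBound_ge
  have hγ := M.γ_pos
  have hγ1 := M.γ_lt_one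
  have h2 : 3 * (2 * (2 / 5) ^ 2) / (4 * (1 + 1) ^ 2) ≤
      3 * (M.thetaStar ^ 2 + 2 * M.costBound cbar hbar ^ 2) / (4 * (1 + M.γ) ^ 2) := by
    gcongr
    nlinarith [sq_nonneg M.thetaStar, sq_le_sq' (by linarith) h1]
  unfold Rsq
  nlinarith [sq_nonneg M.thetaStar]

lemma Admissible.Lmin_pos : 0 < M.Lmin :=
  have := h.nonempty
  M.Lmin_pos h.regular h.uniform_mem

/-- The maximum is attained by its second entry because `Λ_max ≤ 1`. -/
lemma Admissible.t0_eq : M.t0 = 64 * (1 + M.γ) ^ 2 / M.Lmin ^ 2 := by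
  have := h.nonempty
  obtain ⟨h1, h2⟩ := M.Lmax_mem h.uniform_mem
  have hγ := M.γ_pos
  rw [t0, max_eq_right (by nlinarith)]
  ring

lemma Admissible.t0_ge : 64 ≤ M.t0 := by
  have := h.nonempty
  have h1 := h.Lmin_pos
  have h2 := M.Lmin_le_one h.uniform_mem
  have hγ := M.γ_pos
  rw [h.t0_eq, le_div_iff₀ (by positivity)]
  nlinarith

lemma Admissible.thetaBar_pos : 0 < M.thetaBar cbar hbar :=
  div_pos (by linarith [h.costBound_ge]) M.one_sub_γ_pos

lemma Admissible.sigmaFsq_ge : 8 * (1 + M.γ) ^ 2 * M.thetaStar ^ 2 +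
      8 * M.costBound cbar hbar ^ 2 ≤ M.sigmaFsq cbar hbar ∧
    32 * (1 + M.γ) ^ 2 * M.thetaStar ^ 2 ≤ M.sigmaFsq cbar hbar := by
  have hγ := M.γ_pos
  have e : M.sigmaFsq cbar hbar = 32 * (1 + M.γ) ^ 2 * M.thetaStar ^ 2 +
      4 * M.thetaStar ^ 2 + 8 * M.costBound cbar hbar ^ 2 := by
    unfold sigmaFsq Rsq
    field_simp
    ring
  rw [e]
  constructor <;> nlinarith [sq_nonneg (M.costBound cbar hbar), sq_nonneg M.thetaStar,
    sq_nonneg ((1 + M.γ) * M.thetaStar)]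

/-- The first entry of the maximum defining `α_k` gives `ρ^α ≤ 4^{-(⌊k/l⌋+2)} Λ_min/(24CR²)`. With
`4^{-2}` this leaves `Λ_min/(384R²)`, and `R² ≥ 1/20` suffices. -/
lemma Admissible.mixing_bias_le {C ρ : ℝ} (hmix : M.MixingConst C ρ) (k : ℕ) :
    C * ρ ^ ((M.schedule cbar hbar C ρ).α k) ≤ M.Lmin / 16 := by
  obtain ⟨hC, hρ, hρ1, -⟩ := hmix
  have hΛ := h.Lmin_pos
  have hR := h.Rsq_ge
  have hx : 0 < M.Lmin / (24 * C * M.Rsq cbar hbar) := by positivity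
  have h1 : 2 * ((k / M.epoch : ℕ) + 2) * Real.logb ρ (1 / 2) +
      Real.logb ρ (M.Lmin / (24 * C * M.Rsq cbar hbar)) ≤
      ((M.schedule cbar hbar C ρ).α k : ℝ) := by
    refine (le_max_left _ _ : _ ≤ M.alphaReal cbar hbar C ρ k).trans ((Nat.le_ceil _).trans ?_)
    exact Nat.cast_le.2 (le_max_right 1 _)
  have h2 : ρ ^ ((M.schedule cbar hbar C ρ).α k) ≤
      (1 / 2) ^ (2 * (((k / M.epoch : ℕ) : ℝ) + 2)) * (M.Lmin / (24 * C * M.Rsq cbar hbar)) := by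
    rw [← Real.rpow_natCast]
    refine (Real.rpow_le_rpow_of_exponent_ge hρ hρ1.le h1).trans (le_of_eq ?_)
    rw [Real.rpow_add hρ, Real.rpow_logb hρ hρ1.ne hx, mul_comm, mul_comm (2 * _) (Real.logb _ _),
      Real.rpow_mul hρ.le, Real.rpow_logb hρ hρ1.ne (by norm_num), mul_comm]
  have h3 : ((1 : ℝ) / 2) ^ (2 * (((k / M.epoch : ℕ) : ℝ) + 2)) ≤ 1 / 16 := by
    have h4 : ((1 : ℝ) / 2) ^ (2 * (((k / M.epoch : ℕ) : ℝ) + 2)) ≤ (1 / 2) ^ (4 : ℝ) :=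
      Real.rpow_le_rpow_of_exponent_ge (by norm_num) (by norm_num)
        (by linarith [Nat.cast_nonneg (α := ℝ) (k / M.epoch)])
    refine h4.trans (le_of_eq ?_)
    norm_num
  have h5 := h2.trans (mul_le_mul_of_nonneg_right h3 hx.le)
  calc C * ρ ^ ((M.schedule cbar hbar C ρ).α k)
      ≤ C * (1 / 16 * (M.Lmin / (24 * C * M.Rsq cbar hbar))) :=
        mul_le_mul_of_nonneg_left h5 hC.le
    _ = M.Lmin / (384 * M.Rsq cbar hbar) := by field_simp; norm_num
    _ ≤ M.Lmin / 16 := by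
        apply div_le_div_of_nonneg_left hΛ.le (by norm_num)
        linarith

end

end RegMDP

/-! ### Epoch recursion, dependence on the perturbation and accuracy of evaluation -/

/-- Recursion of the error over epochs of length `l`. -/
lemma epoch_recursion {x : ℕ → ℝ} {γ W N L : ℝ} {l : ℕ} (hγ : 0 < γ) (hl : 0 < l)
    (hγl : γ ^ l ≤ 1 / 4) (hN : 0 ≤ N) (hL : 0 ≤ L) (hW : 2 * N + L ≤ W) (h0 : x 0 ≤ W + N)
    (h : ∀ k, x (k + 1) ≤ γ * x k + (1 / 2) ^ (k / l) * ((1 - γ) * N) +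
      L * ((1 / 2) ^ (k / l + 1) - (1 / 2) ^ ((k + 1) / l + 1))) (k : ℕ) :
    x k ≤ (1 / 2) ^ (k / l) * (γ ^ (k % l) * W + N) := by
  induction k with
  | zero => simpa using h0
  | succ k ih =>
    have h1 := h k
    have hm := Nat.mod_lt k hl
    have hdm := Nat.div_add_mod k l
    have hp : (0 : ℝ) < (1 / 2) ^ (k / l) := by positivity
    have h2 := mul_le_mul_of_nonneg_left ih hγ.le
    by_cases hlast : k % l + 1 = l
    · obtain ⟨e1, e2⟩ : (k + 1) / l = k / l + 1 ∧ (k + 1) % l = 0 :=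
        (Nat.div_mod_unique hl).2 ⟨by rw [mul_add, mul_one]; omega, hl⟩
      rw [e1] at h1
      rw [e1, e2, pow_zero, one_mul]
      -- At an epoch boundary, relative to the old prefactor, `W/4 + N + L/4` must be at most `(W +
      -- N)/2`; this is exactly `2N + L ≤ W`. Inside an epoch the jump vanishes and the fixed point
      -- `N` absorbs the noise.
      have h3 : γ * γ ^ (k % l) ≤ 1 / 4 := by rw [← pow_succ', hlast]; exact hγl
      have hW0 : 0 ≤ W := by linarith
      have h4 := mul_le_mul_of_nonneg_left (mul_le_mul_of_nonneg_right h3 hW0) hp.le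
      simp only [pow_succ] at h1 ⊢
      nlinarith
    · obtain ⟨e1, e2⟩ : (k + 1) / l = k / l ∧ (k + 1) % l = k % l + 1 :=
        (Nat.div_mod_unique hl).2 ⟨by omega, by omega⟩
      rw [e1] at h1
      rw [e1, e2, pow_succ]
      nlinarith

namespace RegMDP

open MeasureTheory

variable {S A : Type*} [Fintype S] [Fintype A] [DecidableEq S] [DecidableEq A]
  {M : RegMDP S A} {π : S → A → ℝ} {ν : S → ℝ} {τ τ' : ℝ} {cbar hbar C ρ : ℝ}

-- Changing `τ` changes only the stage cost, by a multiple of the divergence to uniform, so the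
-- difference solves an evaluation equation accessible to the maximum principle.
variable (M) in
lemma V_sub_V_tau (hπ : M.Feasible π) (s : S) :
    M.V τ π s - M.V τ' π s = (τ - τ') * klDist (π s) (uniformDist A) +
      M.γ * ∑ s', M.stateMatrix π s s' * (M.V τ π s' - M.V τ' π s') := by
  have h1 : ∀ a, M.Q τ π (s, a) - M.Q τ' π (s, a) = (τ - τ') * klDist (π s) (uniformDist A) +
      M.γ * ∑ s', M.P s a s' * (M.V τ π s' - M.V τ' π s') := by
    intro a
    simp only [Q_eq M hπ, stageCost, mul_sub, Finset.sum_sub_distrib]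
    ring
  have h2 : M.V τ π s - M.V τ' π s = ∑ a, π s a * (M.Q τ π (s, a) - M.Q τ' π (s, a)) := by
    simp only [V, mul_sub, Finset.sum_sub_distrib]
  rw [h2, sum_stateMatrix_mul]
  simp only [h1, mul_add, Finset.sum_add_distrib, ← Finset.sum_mul, hπ.sum_eq_one, one_mul,
    mul_left_comm _ M.γ, ← Finset.mul_sum]

lemma epoch_pos : 0 < M.epoch :=
  Nat.ceil_pos.2 (Real.logb_pos_of_base_lt_one M.γ_pos M.γ_lt_one (by norm_num) (by norm_num))

lemma γ_pow_epoch_le : M.γ ^ M.epoch ≤ 1 / 4 := by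
  rw [← Real.rpow_natCast]
  refine (Real.rpow_le_rpow_of_exponent_ge M.γ_pos M.γ_lt_one.le (Nat.le_ceil _)).trans_eq ?_
  exact Real.rpow_logb M.γ_pos M.γ_lt_one.ne (by norm_num)

variable [Nontrivial A]

lemma schedule_one_le_alpha (k : ℕ) : 1 ≤ (M.schedule cbar hbar C ρ).α k := le_max_left _ _

lemma schedule_eta_pos (k : ℕ) : 0 < (M.schedule cbar hbar C ρ).η k :=
  div_pos M.one_sub_γ_pos (mul_pos M.γ_pos (M.tau_pos k))

lemma Admissible.iter_feasible (h : M.Admissible cbar hbar) (w : ℕ → S × A) (k : ℕ) :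
    M.Feasible (M.iter (M.schedule cbar hbar C ρ) w k) := by
  induction k with
  | zero => exact h.uniform_mem
  | succ k ih =>
    exact fun s => M.prox_mem (schedule_eta_pos k).le (ih s) (h.regular.pos s _ (ih s))

lemma Admissible.V_sub_V_tau_mem (h : M.Admissible cbar hbar) (hπ : M.Feasible π) (hτ : τ' ≤ τ)
    (s : S) : 0 ≤ M.V τ π s - M.V τ' π s ∧
      M.V τ π s - M.V τ' π s ≤ (τ - τ') * Real.log (Fintype.card A) / (1 - M.γ) := by
  have := h.nonempty
  have hd : 0 ≤ τ - τ' := sub_nonneg.2 hτ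
  refine ⟨?_, M.le_of_eq_add_discounted hπ (M.V_sub_V_tau hπ)
    (fun s => mul_le_mul_of_nonneg_left (h.klDist_uniform_mem hπ s).2 hd) s⟩
  have h1 := M.le_of_eq_add_discounted hπ (v := fun s => -(M.V τ π s - M.V τ' π s))
    (g := fun s => -((τ - τ') * klDist (π s) (uniformDist A))) (e := 0) (fun s => by
      simp only [mul_neg, Finset.sum_neg_distrib]
      rw [M.V_sub_V_tau hπ s]
      ring)
    (fun s => neg_nonpos.2 (mul_nonneg hd (h.klDist_uniform_mem hπ s).1)) s
  rw [zero_div] at h1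
  exact neg_nonpos.1 h1

/-- Squared error of the estimate after `t` updates of iteration `k` along the path `w`. -/
noncomputable def sqError (M : RegMDP S A) (σ : Schedule) (k t : ℕ) (w : ℕ → S × A) : ℝ :=
  l2norm (M.param σ k t w - M.Q (σ.τ k) (M.iter σ w k)) ^ 2

lemma sqError_dependsOn (σ : Schedule) (k t : ℕ) :
    DependsOn (M.sqError σ k t) (Set.Iic (σ.samples k + t * σ.α k)) := by
  intro w w' h
  have h1 := M.iter_dependsOn k fun i hi => h i (le_trans hi (Nat.le_add_right _ _))
  simp only at h1
  rw [sqError, sqError, h1, M.param_dependsOn k t h]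

variable {Ω : Type*} [MeasurableSpace Ω] {μ : Measure Ω} [IsProbabilityMeasure μ]
  {Z : ℕ → Ω → S × A}

/-- After `t` updates the next rate is `β_{t+1} = 2/(Λ_min(t+t_0))`, so the conditional bound of
`expected_update_le` integrates to the recursion required by `stochastic_approximation_rate`. -/
lemma Admissible.sqError_succ_le (h : M.Admissible cbar hbar) (hmix : M.MixingConst C ρ)
    (hZ : M.IsTrajectory (M.schedule cbar hbar C ρ) μ Z) {k t : ℕ}
    (ht : t < (M.schedule cbar hbar C ρ).T k) :
    ∫ x, M.sqError (M.schedule cbar hbar C ρ) k (t + 1) (fun i => Z i x) ∂μ ≤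
      (1 - 3 / (t + M.t0)) *
          ∫ x, M.sqError (M.schedule cbar hbar C ρ) k t (fun i => Z i x) ∂μ +
        2 * (M.sigmaFsq cbar hbar / M.Lmin ^ 2) / (t + M.t0) ^ 2 := by
  set σ := M.schedule cbar hbar C ρ with hσ
  have hne := h.nonempty
  have hγ := M.γ_pos
  have hΛ := h.Lmin_pos
  have ht0 := h.t0_ge
  have hn : 0 < (t : ℝ) + M.t0 := by linarith [Nat.cast_nonneg (α := ℝ) t]
  have hβ : σ.β (t + 1) = 2 / (M.Lmin * (t + M.t0)) := by
    simp only [hσ, schedule]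
    push_cast
    congr 2
    ring
  have hβ0 : 0 ≤ σ.β (t + 1) := by rw [hβ]; positivity
  set n := σ.samples k + t * σ.α k with hndef
  have hsucc : σ.samples k + (t + 1) * σ.α k = n + σ.α k := by rw [hndef]; ring
  set H : (ℕ → S × A) → S × A → S × A → ℝ := fun w y z =>
    l2norm (M.param σ k t w - σ.β (t + 1) • M.Ftilde (σ.τ k) (M.iter σ w k) (M.param σ k t w) y z -
      M.Q (σ.τ k) (M.iter σ w k)) ^ 2 with hH
  have hHdep : DependsOn H (Set.Iic n) := by
    intro w w' hw
    have h1 := M.iter_dependsOn k fun i hi => hw i (le_trans hi (Nat.le_add_right _ _))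
    simp only at h1
    simp only [hH, h1, M.param_dependsOn k t hw]
  have hlhs : ∀ x, M.sqError σ k (t + 1) (fun i => Z i x) =
      H (fun i => Z i x) (Z (n + σ.α k - 1) x) (Z (n + σ.α k) x) := by
    intro x
    rw [sqError, param, ctd, hsucc]
    rfl
  simp only [hlhs]
  have hT : n + σ.α k ≤ σ.samples (k + 1) := by
    rw [σ.samples_succ, ← hsucc]
    exact Nat.add_le_add_left (Nat.mul_le_mul_right _ ht) _
  rw [hZ.integral_transition schedule_one_le_alpha (Nat.le_add_right _ _) hT hHdep]
  have hE := M.sqError_dependsOn σ k t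
  have hEint : Integrable (fun x => M.sqError σ k t fun i => Z i x) μ := integrable_path hZ.1 hE
  set D := 2 * (M.sigmaFsq cbar hbar / M.Lmin ^ 2) / ((t : ℝ) + M.t0) ^ 2 with hD
  have hbound : ∀ w : ℕ → S × A,
      ∑ y, (M.pairMatrix (M.iter σ w k) ^ (σ.α k - 1)) (w n) y *
        ∑ z, M.pairMatrix (M.iter σ w k) y z * H w y z ≤
      (1 - 3 / (t + M.t0)) * M.sqError σ k t w + D := by
    intro w
    have hf : M.Feasible (M.iter σ w k) := h.iter_feasible w k
    obtain ⟨ν, hν⟩ := M.exists_isStationary hf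
    have hτ0 : 0 ≤ σ.τ k := (M.tau_pos k).le
    have hτ1 : σ.τ k ≤ M.tau 0 := M.tau_le_tau_zero k
    refine (M.expected_update_le hf hν hτ0 hmix (schedule_one_le_alpha k)
      (h.abs_stageCost_le_costBound hf hτ0 hτ1) (h.l2norm_Q_le hf hτ0 hτ1) hβ0
      (M.param σ k t w) (w n)).trans ?_
    refine add_le_add (mul_le_mul_of_nonneg_right ?_ (sq_nonneg _)) ?_
    -- With `n = t + t_0`, drift minus bias gives at least `15/(4n)` and the variance costs at most
    -- `1/(8n)`, since `t_0 = 64(1+γ)²/Λ_min²`; the remainder exceeds `3/n`.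
    · have h1 := h.mixing_bias_le hmix k
      have h2 : 2 * σ.β (t + 1) * (M.Lmin - M.Lmin / 16) = 15 / 4 / (t + M.t0) := by
        rw [hβ]; field_simp; norm_num
      have h3 : σ.β (t + 1) ^ 2 * (2 * (1 + M.γ) ^ 2) ≤ 1 / 8 / (t + M.t0) := by
        have h4 : σ.β (t + 1) ^ 2 * (2 * (1 + M.γ) ^ 2) =
            1 / 8 * (M.t0 / ((t : ℝ) + M.t0)) / (t + M.t0) := by
          rw [hβ, h.t0_eq]; field_simp; norm_num
        have h5 : M.t0 / ((t : ℝ) + M.t0) ≤ 1 := by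
          rw [div_le_one hn]
          linarith [Nat.cast_nonneg (α := ℝ) t]
        rw [h4]
        gcongr
        linarith
      have h6 : 2 * σ.β (t + 1) * (M.Lmin - M.Lmin / 16) ≤
          2 * σ.β (t + 1) * (M.Lmin - C * ρ ^ σ.α k) :=
        mul_le_mul_of_nonneg_left (by linarith) (by positivity)
      have h7 : 15 / 4 / (t + M.t0) - 1 / 8 / (t + M.t0) - 3 / ((t : ℝ) + M.t0) =
        5 / 8 / (t + M.t0) := by ring
      have h8 : 0 < 5 / 8 / ((t : ℝ) + M.t0) := by positivity
      linarith
    · have h1 := h.sigmaFsq_ge.1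
      have h2 : σ.β (t + 1) ^ 2 * (4 * (1 + M.γ) ^ 2 * M.thetaStar ^ 2 +
          4 * M.costBound cbar hbar ^ 2) = 2 * ((8 * (1 + M.γ) ^ 2 * M.thetaStar ^ 2 +
          8 * M.costBound cbar hbar ^ 2) / M.Lmin ^ 2) / ((t : ℝ) + M.t0) ^ 2 := by
        rw [hβ]; field_simp; ring
      rw [h2, hD]
      gcongr
  have hint2 : Integrable (fun x => (1 - 3 / ((t : ℝ) + M.t0)) *
      M.sqError σ k t (fun i => Z i x) + D) μ :=
    (hEint.const_mul _).add (integrable_const _)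
  refine (integral_mono ?_ hint2 fun x => hbound fun i => Z i x).trans_eq ?_
  · have hdep : DependsOn (fun w : ℕ → S × A =>
        ∑ y, (M.pairMatrix (M.iter σ w k) ^ (σ.α k - 1)) (w n) y *
          ∑ z, M.pairMatrix (M.iter σ w k) y z * H w y z) (Set.Iic n) := by
      intro w w' hw
      have h1 := M.iter_dependsOn k fun i hi => hw i (le_trans hi (Nat.le_add_right _ _))
      simp only at h1
      simp only [h1, hHdep hw, hw n (Set.mem_Iic.2 le_rfl)]
    exact integrable_path hZ.1 hdep
  · rw [integral_add (hEint.const_mul _) (integrable_const _), integral_const_mul]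
    simp

/-- Accuracy of policy evaluation by conditional temporal difference learning. -/
lemma Admissible.integral_sqError_le (h : M.Admissible cbar hbar) (hmix : M.MixingConst C ρ)
    (hZ : M.IsTrajectory (M.schedule cbar hbar C ρ) μ Z) (k : ℕ) :
    ∫ x, M.sqError (M.schedule cbar hbar C ρ) k ((M.schedule cbar hbar C ρ).T k)
      (fun i => Z i x) ∂μ ≤ (1 / 4) ^ (k / M.epoch + 4) := by
  have hΛ := h.Lmin_pos
  have hγ := M.γ_pos
  have ht0 := h.t0_ge
  obtain ⟨hσ1, hσ2⟩ := h.sigmaFsq_ge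
  have hσpos : 0 < M.sigmaFsq cbar hbar := by
    have := h.costBound_ge
    have : 0 ≤ 8 * (1 + M.γ) ^ 2 * M.thetaStar ^ 2 := by positivity
    nlinarith
  have hΘ := thetaStar_nonneg (M := M)
  have h0 : ∫ x, M.sqError (M.schedule cbar hbar C ρ) k 0 (fun i => Z i x) ∂μ ≤
      M.thetaStar ^ 2 := by
    refine (integral_mono (integrable_path hZ.1 (M.sqError_dependsOn _ k 0))
      (integrable_const (M.thetaStar ^ 2)) fun x => ?_).trans_eq (by simp)
    have h1 := h.l2norm_Q_le (h.iter_feasible (C := C) (ρ := ρ) (fun i => Z i x) k)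
      (M.tau_pos k).le (M.tau_le_tau_zero k)
    simp only [sqError, param, ctd]
    have h2 : ∀ q : S × A → ℝ, l2norm (0 - q) = l2norm q := by simp [l2norm]
    rw [h2]
    exact pow_le_pow_left₀ (l2norm_nonneg _) h1 2
  have h1 := stochastic_approximation_rate
    (a := fun t => ∫ x, M.sqError (M.schedule cbar hbar C ρ) k t (fun i => Z i x) ∂μ)
    (by linarith : 3 ≤ M.t0)
    (by positivity : 0 ≤ M.sigmaFsq cbar hbar / M.Lmin ^ 2) (sq_nonneg _) h0
    (fun t ht => h.sqError_succ_le hmix hZ ht) _ le_rfl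
  refine h1.trans ?_
  set T : ℝ := ((M.schedule cbar hbar C ρ).T k : ℝ) with hT
  set q : ℝ := 4 ^ (k / M.epoch + 2) with hq
  have hq0 : 0 < q := by positivity
  have hTge : 24 * M.sigmaFsq cbar hbar / M.Lmin ^ 2 * q ≤ T := by
    refine le_trans ?_ (Nat.le_ceil (M.Treal cbar hbar k))
    have hb := h.thetaBar_pos
    have : 0 ≤ M.t0 * (3 * M.thetaBar cbar hbar * 2 ^ (k / M.epoch + 2)) ^ (2 / 3 : ℝ) +
      (4 * M.t0 ^ 2 * M.thetaBar cbar hbar ^ 2 * 4 ^ (k / M.epoch + 2)) ^ (1 / 2 : ℝ) := by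
      positivity
    rw [Treal]
    linarith
  have hTpos : 0 < T := lt_of_lt_of_le (by positivity) hTge
  -- By `(T + t_0)² ≥ 4 T t_0` it suffices that `T ≥ 12 t_0 Θ² q`, which the last summand of `T_k`
  -- provides because `σ_F² ≥ 32(1+γ)²Θ²`.
  have hfirst : M.t0 ^ 2 * M.thetaStar ^ 2 / (T + M.t0) ^ 2 ≤ 1 / (48 * q) := by
    rw [div_le_div_iff₀ (by positivity) (by positivity)]
    have h2 : 12 * M.t0 * M.thetaStar ^ 2 * q ≤ T := by
      refine le_trans ?_ hTge
      have e : 12 * M.t0 * M.thetaStar ^ 2 * q =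
          24 * (32 * (1 + M.γ) ^ 2 * M.thetaStar ^ 2) / M.Lmin ^ 2 * q := by
        rw [h.t0_eq]; ring
      rw [e]
      gcongr
    have h3 := mul_le_mul_of_nonneg_left h2 (by linarith : 0 ≤ 4 * M.t0)
    nlinarith [sq_nonneg (T - M.t0)]
  have hsecond : M.sigmaFsq cbar hbar / M.Lmin ^ 2 / (T + M.t0) ≤ 1 / (24 * q) := by
    rw [div_le_div_iff₀ (by positivity) (by positivity)]
    have e : 24 * M.sigmaFsq cbar hbar / M.Lmin ^ 2 * q =
      M.sigmaFsq cbar hbar / M.Lmin ^ 2 * (24 * q) := by ring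
    rw [e] at hTge
    linarith
  have hfin : ((1 : ℝ) / 4) ^ (k / M.epoch + 4) = 1 / (48 * q) + 1 / (24 * q) := by
    rw [hq, div_pow, one_pow]
    field_simp
    ring
  rw [hfin]
  exact add_le_add hfirst hsecond

end RegMDP

/-! ### Contraction of the potential and convergence of SAPMD -/

namespace RegMDP

open MeasureTheory

variable {S A : Type*} [Fintype S] [Fintype A] [DecidableEq S] [DecidableEq A] [Nontrivial A]
  {M : RegMDP S A} {π πs : S → A → ℝ} {ν : S → ℝ} {τ τ' : ℝ} {cbar hbar C ρ : ℝ}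

/-- Potential of mirror descent: perturbed optimality gap plus weighted distance to `πs`. -/
noncomputable def potential (M : RegMDP S A) (ν : S → ℝ) (πs : S → A → ℝ) (τ : ℝ)
    (π : S → A → ℝ) : ℝ :=
  ∑ s, ν s * (M.V τ π s - M.V τ πs s) + τ / (1 - M.γ) * ∑ s, ν s * klDist (πs s) (π s)

/-- Lowering `τ` lowers the value of `π` and the weight of the nonnegative divergence; the only loss
is that the comparator's value also falls, by at most the stated amount. -/
lemma Admissible.potential_le (h : M.Admissible cbar hbar) (hπ : M.Feasible π)
    (hπs : M.Feasible πs) (hν : ν ∈ stdSimplex ℝ S) (hτ : τ' ≤ τ) :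
    M.potential ν πs τ' π ≤
      M.potential ν πs τ π + (τ - τ') * Real.log (Fintype.card A) / (1 - M.γ) := by
  have h1 : ∑ s, ν s * (M.V τ' π s - M.V τ' πs s) ≤ ∑ s, ν s * (M.V τ π s - M.V τ πs s) +
      (τ - τ') * Real.log (Fintype.card A) / (1 - M.γ) := by
    have h2 := sum_simplex_mul_le hν (g := fun s => (M.V τ' π s - M.V τ' πs s) -
      (M.V τ π s - M.V τ πs s)) (b := (τ - τ') * Real.log (Fintype.card A) / (1 - M.γ)) fun s => by
        linarith [(h.V_sub_V_tau_mem hπ hτ s).1, (h.V_sub_V_tau_mem hπs hτ s).2]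
    simp only [mul_sub (ν _) (_ - _), Finset.sum_sub_distrib] at h2
    linarith
  have h3 : 0 ≤ ∑ s, ν s * klDist (πs s) (π s) := Finset.sum_nonneg fun s _ =>
    mul_nonneg (hν.1 s) (klDist_nonneg (hπs.mem_stdSimplex s) (hπ.mem_stdSimplex s)
      (h.regular.pos s _ (hπ s)))
  have h4 : τ' / (1 - M.γ) ≤ τ / (1 - M.γ) := div_le_div_of_nonneg_right hτ M.one_sub_γ_pos.le
  have h5 := mul_le_mul_of_nonneg_right h4 h3
  unfold potential
  linarith

lemma potential_zero : M.potential ν πs 0 π = M.f ν π - M.f ν πs := by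
  simp [potential, f, mul_sub]

lemma Admissible.potential_uniform_le (h : M.Admissible cbar hbar)
    (hπs : M.Feasible πs) (hν : ν ∈ stdSimplex ℝ S) (hτ : 0 ≤ τ) :
    M.potential ν πs τ (fun _ => uniformDist A) ≤
      M.f ν (fun _ => uniformDist A) - M.f ν πs +
        2 * (τ * Real.log (Fintype.card A) / (1 - M.γ)) := by
  have hu : M.Feasible fun _ => uniformDist A := h.uniform_mem
  have h2 := sum_simplex_mul_le hν (g := fun s =>
    (M.V τ (fun _ => uniformDist A) s - M.V τ πs s) -
      (M.V 0 (fun _ => uniformDist A) s - M.V 0 πs s))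
      (b := τ * Real.log (Fintype.card A) / (1 - M.γ)) fun s => by
        have h3 := (h.V_sub_V_tau_mem hu hτ s).2
        rw [sub_zero] at h3
        linarith [(h.V_sub_V_tau_mem hπs hτ s).1]
  have h4 := sum_simplex_mul_le hν fun s => (h.klDist_uniform_mem hπs s).2
  have h5 := mul_le_mul_of_nonneg_left h4 (div_nonneg hτ M.one_sub_γ_pos.le)
  have h6 : τ / (1 - M.γ) * Real.log (Fintype.card A) =
    τ * Real.log (Fintype.card A) / (1 - M.γ) := by ring
  rw [← potential_zero]
  simp only [mul_sub (ν _) (_ - _), Finset.sum_sub_distrib] at h2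
  unfold potential
  rw [zero_div, zero_mul, add_zero]
  linarith

/-- Bound on the noise caused by an evaluation error `d`. -/
lemma noise_le {d c : ℝ} (hc : 0 < c) : 2 * d ≤ d ^ 2 / c + c := by
  rw [div_add' _ _ _ hc.ne', le_div_iff₀ hc]
  nlinarith [sq_nonneg (d - c)]

variable {Ω : Type*} [MeasurableSpace Ω] {μ : Measure Ω} [IsProbabilityMeasure μ]
  {Z : ℕ → Ω → S × A}

/-- No measurability of `g` is needed: `π_k` takes finitely many values, one for each trajectory
prefix. -/
lemma integrable_of_iter {σ : Schedule} (hZ : M.IsTrajectory σ μ Z) (g : (S → A → ℝ) → ℝ) (k : ℕ) :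
    Integrable (fun x => g (M.iter σ (fun n => Z n x) k)) μ :=
  integrable_path (g := fun w => g (M.iter σ w k)) hZ.1 (n := σ.samples k) fun _ _ hw =>
    congrArg g (M.iter_dependsOn k hw)

lemma Admissible.integral_potential_succ_le (h : M.Admissible cbar hbar)
    (hmix : M.MixingConst C ρ) (hZ : M.IsTrajectory (M.schedule cbar hbar C ρ) μ Z)
    (hπs : M.Feasible πs) (hν : M.IsStationary πs ν) (k : ℕ) :
    ∫ x, M.potential ν πs (M.tau (k + 1))
        (M.iter (M.schedule cbar hbar C ρ) (fun n => Z n x) (k + 1)) ∂μ ≤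
      M.γ * ∫ x, M.potential ν πs (M.tau k)
        (M.iter (M.schedule cbar hbar C ρ) (fun n => Z n x) k) ∂μ +
      ((1 / 4) ^ (k / M.epoch + 4) * (2 ^ (k / M.epoch + 4) + 1 / (M.γ * M.tau k)) +
        (1 / 2) ^ (k / M.epoch + 4)) +
      (M.tau k - M.tau (k + 1)) * Real.log (Fintype.card A) / (1 - M.γ) := by
  set σ := M.schedule cbar hbar C ρ with hσ
  have hγ := M.γ_pos
  have hτ := M.tau_pos k
  have hE : Integrable (fun x => M.sqError σ k (σ.T k) fun i => Z i x) μ :=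
    integrable_path hZ.1 (M.sqError_dependsOn σ k _)
  have hmono : M.tau (k + 1) ≤ M.tau k := by
    rw [tau_eq, tau_eq M k]
    have := M.tau_pos 0
    gcongr ?_ * ?_
    exact pow_le_pow_of_le_one (by norm_num) (by norm_num)
      (Nat.succ_le_succ (Nat.div_le_div_right (Nat.le_succ k)))
  set c : ℝ := 2 ^ (k / M.epoch + 4) + 1 / (M.γ * M.tau k) with hc
  set e : ℝ := (1 / 2) ^ (k / M.epoch + 4) + (M.tau k - M.tau (k + 1)) *
    Real.log (Fintype.card A) / (1 - M.γ) with he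
  have hstep : ∀ w : ℕ → S × A, M.potential ν πs (M.tau (k + 1)) (M.iter σ w (k + 1)) ≤
      M.γ * M.potential ν πs (M.tau k) (M.iter σ w k) + M.sqError σ k (σ.T k) w * c + e := by
    intro w
    have hf : M.Feasible (M.iter σ w k) := h.iter_feasible w k
    have h1 := M.mirror_step h.regular.pos hf hτ rfl (M.param σ k (σ.T k) w) hπs hν
      (π' := M.iter σ w (k + 1)) rfl
    have h2 := h.potential_le (h.iter_feasible (C := C) (ρ := ρ) w (k + 1)) hπs hν.1 hmono
    have h3 : M.sqError σ k (σ.T k) w = l2norm (M.param σ k (σ.T k) w -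
      M.Q (M.tau k) (M.iter σ w k)) ^ 2 := rfl
    set d := l2norm (M.param σ k (σ.T k) w - M.Q (M.tau k) (M.iter σ w k))
    -- The linear error `2d` is traded for `d²` with weight `2^{⌊k/l⌋+4}`, the inverse root of the
    -- bound on `E d²`, so both resulting terms have order `2^{-⌊k/l⌋}`.
    have h4 := noise_le (d := d) (c := (1 / 2) ^ (k / M.epoch + 4)) (by positivity)
    have h5 : d ^ 2 / (1 / 2) ^ (k / M.epoch + 4) = d ^ 2 * 2 ^ (k / M.epoch + 4) := by
      rw [one_div, inv_pow, div_inv_eq_mul]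
    have h6 : d ^ 2 / (M.γ * M.tau k) = d ^ 2 * (1 / (M.γ * M.tau k)) := by ring
    rw [← hσ] at h2
    change M.potential ν πs (M.tau k) (M.iter σ w (k + 1)) ≤
      M.γ * M.potential ν πs (M.tau k) (M.iter σ w k) + _ at h1
    rw [h5] at h4
    rw [h6] at h1
    rw [h3, hc, he]
    linarith
  have hI : Integrable (fun x => M.potential ν πs (M.tau k) (M.iter σ (fun n => Z n x) k)) μ :=
    integrable_of_iter hZ (M.potential ν πs (M.tau k)) k
  have hsum : Integrable (fun x => M.γ * M.potential ν πs (M.tau k)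
      (M.iter σ (fun n => Z n x) k) + M.sqError σ k (σ.T k) (fun i => Z i x) * c) μ :=
    (hI.const_mul _).add (hE.mul_const _)
  have hint : Integrable (fun x => M.γ * M.potential ν πs (M.tau k)
      (M.iter σ (fun n => Z n x) k) + M.sqError σ k (σ.T k) (fun i => Z i x) * c + e) μ :=
    hsum.add (integrable_const _)
  have h1 := integral_mono (integrable_of_iter hZ (M.potential ν πs (M.tau (k + 1))) (k + 1)) hint
    fun x => hstep fun n => Z n x
  rw [integral_add hsum (integrable_const _),
    integral_add (hI.const_mul _) (hE.mul_const _), integral_const_mul, integral_mul_const] at h1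
  simp only [integral_const, probReal_univ, one_smul] at h1
  have hc0 : 0 ≤ c := by rw [hc]; positivity
  have h2 := mul_le_mul_of_nonneg_right (h.integral_sqError_le hmix hZ k) hc0
  rw [he] at h1
  linarith

/-- The convergence relation. -/
lemma Admissible.convergence (h : M.Admissible cbar hbar) (hmix : M.MixingConst C ρ)
    (hZ : M.IsTrajectory (M.schedule cbar hbar C ρ) μ Z) (hπs : M.IsOptimal πs)
    (hν : M.IsStationary πs ν) (k : ℕ) :
    ∫ x, (M.f ν (M.iter (M.schedule cbar hbar C ρ) (fun n => Z n x) k) - M.f ν πs) ∂μ ≤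
      (1 / 2) ^ (k / M.epoch) *
        (M.f ν (fun _ => uniformDist A) - M.f ν πs +
          3 * Real.sqrt (Real.log (Fintype.card A)) / ((1 - M.γ) * Real.sqrt M.γ) +
          5 / (2 * (1 - M.γ))) := by
  have hγ := M.γ_pos
  have hγ1 := M.one_sub_γ_pos
  set σ := M.schedule cbar hbar C ρ with hσ
  set Δ := M.f ν (fun _ => uniformDist A) - M.f ν πs with hΔ
  set r := Real.sqrt (Real.log (Fintype.card A)) / Real.sqrt M.γ with hr
  have hr0 : 0 ≤ r := by positivity
  set L := r / (1 - M.γ) with hL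
  have hL0 : 0 ≤ L := by positivity
  -- `(1-γ)N = 1/8 + r/128` is the noise per iteration without the prefactor `2^{-⌊k/l⌋}`: `1/8`
  -- comes from the two halves of `2d`, and `r/128` from `d²/(γτ_k)` with `1/(γτ_k) = 2r 2^{⌊k/l⌋}`.
  set N := 1 / 8 / (1 - M.γ) + L / 128 with hN
  have hN0 : 0 ≤ N := by positivity
  have hΔ0 : 0 ≤ Δ := by
    rw [hΔ, f, f, ← Finset.sum_sub_distrib]
    refine Finset.sum_nonneg fun s _ => ?_
    rw [← mul_sub]
    exact mul_nonneg (hν.1.1 s) (sub_nonneg.2 (hπs.2 _ h.uniform_mem s))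
  have htau : ∀ j, M.tau j * Real.log (Fintype.card A) / (1 - M.γ) =
      L * (1 / 2) ^ (j / M.epoch + 1) := by
    intro j
    have h1 := M.tau_zero_mul_log
    have h2 : M.tau j * Real.log (Fintype.card A) =
        2 * (M.tau 0 * Real.log (Fintype.card A)) * (1 / 2) ^ (j / M.epoch + 1) := by
      rw [tau_eq M j]; ring
    rw [h2, h1, hL]
    ring
  have hinv : ∀ j, 1 / (M.γ * M.tau j) = 2 * r * 2 ^ (j / M.epoch) := by
    intro j
    have hl := log_card_pos (A := A)
    have hu := Real.sqrt_pos.2 hl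
    have hg := Real.sqrt_pos.2 M.γ_pos
    have e1 := Real.mul_self_sqrt M.γ_pos.le
    rw [tau, Real.sqrt_mul M.γ_pos.le, hr]
    have e2 : ((1 : ℝ) / 2) ^ (j / M.epoch + 1) = 1 / (2 * 2 ^ (j / M.epoch)) := by
      rw [div_pow, one_pow, pow_succ']
    rw [e2]
    set g := Real.sqrt M.γ
    rw [← e1]
    field_simp
  -- The choice `W = Δ + L + 2N` meets `2N + L ≤ W` because `Δ ≥ 0` by optimality, and covers the
  -- initial potential, which is at most `Δ + L`.
  have hrec := epoch_recursion (x := fun k => ∫ x, M.potential ν πs (M.tau k)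
      (M.iter σ (fun n => Z n x) k) ∂μ) (W := Δ + L + 2 * N) (N := N) (L := L) hγ
    (epoch_pos (M := M)) γ_pow_epoch_le hN0 hL0 (by linarith) (by
      simp only [iter, integral_const, probReal_univ, one_smul]
      have h1 := h.potential_uniform_le hπs.1 hν.1 (M.tau_pos 0).le
      rw [htau 0, Nat.zero_div, zero_add, pow_one] at h1
      linarith) (fun k => by
      have h1 := h.integral_potential_succ_le hmix hZ hπs.1 hν k
      have h2 : (M.tau k - M.tau (k + 1)) * Real.log (Fintype.card A) / (1 - M.γ) =
          L * ((1 / 2) ^ (k / M.epoch + 1) - (1 / 2) ^ ((k + 1) / M.epoch + 1)) := by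
        rw [mul_sub, ← htau, ← htau]; ring
      have h3 : (1 / 4) ^ (k / M.epoch + 4) * (2 ^ (k / M.epoch + 4) + 1 / (M.γ * M.tau k)) +
          (1 / 2) ^ (k / M.epoch + 4) = (1 / 2) ^ (k / M.epoch) * ((1 - M.γ) * N) := by
        have e1 : (1 - M.γ) * N = 1 / 8 + r / 128 := by rw [hN, hL]; field_simp
        have e2 : ((1 : ℝ) / 4) ^ (k / M.epoch + 4) =
            (1 / 2) ^ (k / M.epoch + 4) * (1 / 2) ^ (k / M.epoch + 4) := by
          rw [← mul_pow]; norm_num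
        have e3 : ((1 : ℝ) / 2) ^ (k / M.epoch) * 2 ^ (k / M.epoch) = 1 := by
          rw [← mul_pow]; norm_num
        rw [hinv, e1, e2]
        simp only [pow_add]
        linear_combination ((1 / 2) ^ (k / M.epoch) * (1 / 16 + r / 128)) * e3
      rw [h3, h2] at h1
      exact h1) k
  have hI : Integrable (fun x => M.potential ν πs (M.tau k) (M.iter σ (fun n => Z n x) k)) μ :=
    integrable_of_iter hZ (M.potential ν πs (M.tau k)) k
  -- The unperturbed gap is the potential at `τ = 0`, so one further lowering of `τ_k` to zero
  -- recovers `f`.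
  have hfin : ∫ x, (M.f ν (M.iter σ (fun n => Z n x) k) - M.f ν πs) ∂μ ≤
      ∫ x, M.potential ν πs (M.tau k) (M.iter σ (fun n => Z n x) k) ∂μ +
        L * (1 / 2) ^ (k / M.epoch + 1) := by
    refine (integral_mono (integrable_of_iter hZ (fun π => M.f ν π - M.f ν πs) k)
      (hI.add (integrable_const (L * (1 / 2) ^ (k / M.epoch + 1)))) fun x => ?_).trans_eq ?_
    · have h1 := h.potential_le (h.iter_feasible (C := C) (ρ := ρ) (fun n => Z n x) k) hπs.1 hν.1
        (M.tau_pos k).le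
      rw [potential_zero, sub_zero, htau] at h1
      exact h1
    · rw [integral_add' hI (integrable_const _)]
      simp
  refine (hfin.trans (add_le_add_left hrec _)).trans ?_
  have hpow : M.γ ^ (k % M.epoch) ≤ 1 := pow_le_one₀ hγ.le M.γ_lt_one.le
  have hW0 : 0 ≤ Δ + L + 2 * N := by positivity
  have h1 := mul_le_mul_of_nonneg_right hpow hW0
  have e1 : 3 * Real.sqrt (Real.log (Fintype.card A)) / ((1 - M.γ) * Real.sqrt M.γ) = 3 * L := by
    rw [hL, hr]; field_simp
  have e2 : 5 / (2 * (1 - M.γ)) = 20 * (1 / 8 / (1 - M.γ)) := by field_simp; norm_num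
  have h2 : 0 ≤ 1 / 8 / (1 - M.γ) := by positivity
  rw [e1, e2, pow_succ]
  have h3 : M.γ ^ (k % M.epoch) * (Δ + L + 2 * N) + N + L / 2 ≤
      Δ + 3 * L + 20 * (1 / 8 / (1 - M.γ)) := by
    rw [hN] at h1 ⊢
    linarith
  have h4 := mul_le_mul_of_nonneg_left h3 (by positivity : (0 : ℝ) ≤ (1 / 2) ^ (k / M.epoch))
  linarith

end RegMDP

/-! ### Iteration and sample complexity -/

lemma sum_pow_div_le {y : ℝ} (hy : 2 ≤ y) {l : ℕ} (hl : 0 < l) (m : ℕ) :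
    ∑ j ∈ Finset.range (m * l), y ^ (j / l) ≤ l * y ^ m := by
  induction m with
  | zero => simp
  | succ m ih =>
    rw [add_mul, one_mul, Finset.sum_range_add]
    have h1 : ∑ j ∈ Finset.range l, y ^ ((m * l + j) / l) = l * y ^ m := by
      rw [Finset.sum_congr rfl fun j hj => by
        rw [add_comm, Nat.add_mul_div_right _ _ hl, Nat.div_eq_of_lt (Finset.mem_range.1 hj),
          zero_add], Finset.sum_const, Finset.card_range, nsmul_eq_mul]
    have h2 : (0 : ℝ) ≤ l * y ^ m := by positivity
    rw [h1, pow_succ]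
    -- The new epoch adds `l y^m` to at most `l y^m`, and `2 ≤ y` absorbs the sum into `l y^{m+1}`.
    nlinarith

lemma logb_eq_neg_div_neg (b x : ℝ) : Real.logb b x = -Real.log x / -Real.log b := by
  rw [neg_div_neg_eq, Real.logb]

namespace RegMDP

open MeasureTheory

variable {S A : Type*} [Fintype S] [Fintype A] [DecidableEq S] [DecidableEq A] [Nontrivial A]
  {M : RegMDP S A} {π πs : S → A → ℝ} {ν : S → ℝ} {cbar hbar C ρ κ : ℝ}

lemma Admissible.abs_f_le (h : M.Admissible cbar hbar) (hπ : M.Feasible π)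
    (hν : ν ∈ stdSimplex ℝ S) : |M.f ν π| ≤ (cbar + hbar) / (1 - M.γ) := by
  have hQ := M.abs_Q_le hπ fun z => by
    have := h.abs_stageCost_le hπ le_rfl z
    rwa [zero_mul, add_zero] at this
  have hV : ∀ s, |M.V 0 π s| ≤ (cbar + hbar) / (1 - M.γ) := fun s => abs_le.2
    ⟨le_sum_simplex_mul (hπ.mem_stdSimplex s) fun a => (abs_le.1 (hQ (s, a))).1,
      sum_simplex_mul_le (hπ.mem_stdSimplex s) fun a => (abs_le.1 (hQ (s, a))).2⟩
  exact abs_le.2 ⟨le_sum_simplex_mul hν fun s => (abs_le.1 (hV s)).1,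
    sum_simplex_mul_le hν fun s => (abs_le.1 (hV s)).2⟩

/-- Extracts the factor `1/(1-γ)`, leaving a numerator that depends only on `κ`, the bounds and
`|A|`; that numerator becomes `B`. -/
lemma Admissible.bracket_le (h : M.Admissible cbar hbar) (hπs : M.Feasible πs)
    (hν : ν ∈ stdSimplex ℝ S) (hκ : 0 < κ) (hκγ : κ ≤ M.γ) :
    M.f ν (fun _ => uniformDist A) - M.f ν πs +
        3 * Real.sqrt (Real.log (Fintype.card A)) / ((1 - M.γ) * Real.sqrt M.γ) +
        5 / (2 * (1 - M.γ)) ≤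
      (2 * (|cbar| + |hbar|) + 3 * Real.sqrt (Real.log (Fintype.card A)) / Real.sqrt κ + 5 / 2) /
        (1 - M.γ) := by
  have h1 := (abs_le.1 (h.abs_f_le (π := fun _ => uniformDist A) h.uniform_mem hν)).2
  have h2 := (abs_le.1 (h.abs_f_le hπs hν)).1
  have hγ1 := M.one_sub_γ_pos
  have hκ' := Real.sqrt_pos.2 hκ
  have h3 : 3 * Real.sqrt (Real.log (Fintype.card A)) / Real.sqrt M.γ ≤
      3 * Real.sqrt (Real.log (Fintype.card A)) / Real.sqrt κ := by
    gcongr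
  have h4 : 3 * Real.sqrt (Real.log (Fintype.card A)) / ((1 - M.γ) * Real.sqrt M.γ) =
      3 * Real.sqrt (Real.log (Fintype.card A)) / Real.sqrt M.γ / (1 - M.γ) := by
    rw [mul_comm (1 - M.γ), div_div]
  have h5 := div_le_div_of_nonneg_right h3 hγ1.le
  have h6 : 5 / (2 * (1 - M.γ)) = 5 / 2 / (1 - M.γ) := by rw [div_div]
  have h7 : 2 * ((cbar + hbar) / (1 - M.γ)) ≤ 2 * (|cbar| + |hbar|) / (1 - M.γ) := by
    rw [mul_div_assoc]
    gcongr
    · exact le_abs_self _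
    · exact le_abs_self _
  rw [h4, h6, add_div, add_div]
  linarith

lemma Admissible.thetaBar_ge (h : M.Admissible cbar hbar) : 2 / 5 ≤ M.thetaBar cbar hbar := by
  have h1 := h.costBound_ge
  have hγ := M.γ_pos
  rw [thetaBar, le_div_iff₀ M.one_sub_γ_pos]
  nlinarith

/-- The base of the `2/3` power is at least one, so the power is at most its base. The two
lower-order summands give `12 + 8 = 20`, and `24` leaves room for rounding up. -/
lemma Admissible.T_le (h : M.Admissible cbar hbar) (k : ℕ) :
    ((M.schedule cbar hbar C ρ).T k : ℝ) ≤
      24 * (M.t0 * M.thetaBar cbar hbar) * 2 ^ (k / M.epoch) +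
        384 * (M.sigmaFsq cbar hbar / M.Lmin ^ 2) * 4 ^ (k / M.epoch) := by
  have hθ := h.thetaBar_ge
  have ht := h.t0_ge
  have hΛ := h.Lmin_pos
  have hσ : 0 ≤ M.sigmaFsq cbar hbar := le_trans (by positivity) h.sigmaFsq_ge.2
  set i := k / M.epoch with hi
  set θ := M.thetaBar cbar hbar
  have hp : (1 : ℝ) ≤ 2 ^ i := one_le_pow₀ (by norm_num)
  have h1 : (3 * θ * 2 ^ (i + 2)) ^ (2 / 3 : ℝ) ≤ 12 * θ * 2 ^ i := by
    have e : 3 * θ * 2 ^ (i + 2) = 12 * θ * 2 ^ i := by rw [pow_add]; ring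
    rw [e]
    have h2 : 1 ≤ 12 * θ * 2 ^ i := by nlinarith
    calc (12 * θ * 2 ^ i) ^ (2 / 3 : ℝ) ≤ (12 * θ * 2 ^ i) ^ (1 : ℝ) :=
          Real.rpow_le_rpow_of_exponent_le h2 (by norm_num)
      _ = _ := Real.rpow_one _
  have h3 : (4 * M.t0 ^ 2 * θ ^ 2 * 4 ^ (i + 2)) ^ (1 / 2 : ℝ) = 8 * (M.t0 * θ) * 2 ^ i := by
    have e : 4 * M.t0 ^ 2 * θ ^ 2 * 4 ^ (i + 2) = (8 * (M.t0 * θ) * 2 ^ i) ^ 2 := by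
      have : (4 : ℝ) ^ i = (2 ^ i) ^ 2 := by rw [← pow_mul, mul_comm, pow_mul]; norm_num
      rw [pow_add, this]
      ring
    rw [e, ← Real.sqrt_eq_rpow, Real.sqrt_sq]
    have : 0 ≤ M.t0 * θ := by positivity
    positivity
  have h4 : M.Treal cbar hbar k ≤ 20 * (M.t0 * θ) * 2 ^ i +
      384 * (M.sigmaFsq cbar hbar / M.Lmin ^ 2) * 4 ^ i := by
    rw [Treal, ← hi, h3, pow_add 4]
    have := mul_le_mul_of_nonneg_left h1 (by linarith : 0 ≤ M.t0)
    have e : 24 * M.sigmaFsq cbar hbar / M.Lmin ^ 2 * (4 ^ i * 4 ^ 2) =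
      384 * (M.sigmaFsq cbar hbar / M.Lmin ^ 2) * 4 ^ i := by ring
    rw [e]
    linarith
  have h5 : 0 ≤ M.Treal cbar hbar k := by
    rw [Treal]
    have : 0 < θ := by linarith
    positivity
  have h6 := (Nat.ceil_lt_add_one h5).le
  have h7 : 1 ≤ (M.t0 * θ) * 2 ^ i := by
    have : 1 ≤ M.t0 * θ := by nlinarith
    nlinarith
  have h8 : ((M.schedule cbar hbar C ρ).T k : ℝ) = (⌈M.Treal cbar hbar k⌉₊ : ℝ) := rfl
  rw [h8]
  linarith

/-- Logarithms to base `ρ` are put over the common denominator `-log ρ`; `4` dominates `log 24`, and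
`κ ≤ ρ` lets `-log κ` pay for the `1` lost in rounding up. -/
lemma Admissible.alpha_le (h : M.Admissible cbar hbar) (hmix : M.MixingConst C ρ) (hκ : 0 < κ)
    (hκρ : κ ≤ ρ) (hx : M.Lmin / (C * M.Rsq cbar hbar) ≤ 1) (k : ℕ) :
    ((M.schedule cbar hbar C ρ).α k : ℝ) ≤
      (2 * ((k / M.epoch : ℕ) + 2) + 4 + -Real.log (M.Lmin / (C * M.Rsq cbar hbar)) +
        -Real.log κ) / -Real.log ρ := by
  obtain ⟨hC, hρ, hρ1, -⟩ := hmix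
  have hΛ := h.Lmin_pos
  have hR : 0 < M.Rsq cbar hbar := by linarith [h.Rsq_ge]
  have hlρ : 0 < -Real.log ρ := neg_pos.2 (Real.log_neg hρ hρ1)
  set x := M.Lmin / (C * M.Rsq cbar hbar) with hxdef
  have hx0 : 0 < x := by positivity
  have hlx : 0 ≤ -Real.log x := neg_nonneg.2 (Real.log_nonpos hx0.le hx)
  have hlogκ : -Real.log ρ ≤ -Real.log κ := neg_le_neg (Real.log_le_log hκ hκρ)
  have hlog2 : Real.log 2 ≤ 1 := by linarith [Real.log_two_lt_d9]
  have hlog2' : 0 ≤ Real.log 2 := Real.log_nonneg (by norm_num)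
  have hlog24 : Real.log 24 ≤ 4 := by
    rw [Real.log_le_iff_le_exp (by norm_num)]
    have h1 := Real.exp_one_gt_d9
    have h2 : Real.exp 4 = Real.exp 1 ^ 4 := by rw [← Real.exp_nat_mul]; norm_num
    rw [h2]
    calc (24 : ℝ) ≤ 2.7 ^ 4 := by norm_num
      _ ≤ _ := pow_le_pow_left₀ (by norm_num) (by linarith) 4
  have hlog3 : Real.log 3 ≤ Real.log 24 := Real.log_le_log (by norm_num) (by norm_num)
  have hlog3' : 0 ≤ Real.log 3 := Real.log_nonneg (by norm_num)
  set i : ℝ := ((k / M.epoch : ℕ) : ℝ) with hi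
  have hi0 : 0 ≤ i := Nat.cast_nonneg _
  set X := (2 * (i + 2) + 4 + -Real.log x) / -Real.log ρ with hX
  have hX0 : 0 ≤ X := by positivity
  have hhalf : -Real.log (1 / 2) = Real.log 2 := by rw [one_div, Real.log_inv, neg_neg]
  have hdiv : ∀ c : ℝ, 0 < c → -Real.log (M.Lmin / (c * C * M.Rsq cbar hbar)) =
      Real.log c + -Real.log x := by
    intro c hc
    have e : M.Lmin / (c * C * M.Rsq cbar hbar) = x / c := by
      rw [hxdef, mul_assoc, div_div, mul_comm c]
    rw [e, Real.log_div hx0.ne' hc.ne']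
    ring
  have hle : M.alphaReal cbar hbar C ρ k ≤ X := by
    rw [alphaReal]
    refine max_le ?_ ?_
    · rw [logb_eq_neg_div_neg, logb_eq_neg_div_neg, hdiv 24 (by norm_num), hhalf, ← mul_div_assoc,
        ← add_div, hX]
      gcongr ?_ / _
      nlinarith
    · rw [logb_eq_neg_div_neg, logb_eq_neg_div_neg, hdiv 3 (by norm_num), hhalf, ← mul_div_assoc,
        ← add_div, hX]
      gcongr ?_ / _
      nlinarith
  have h1 : ((M.schedule cbar hbar C ρ).α k : ℝ) ≤ X + 1 := by
    have e : (M.schedule cbar hbar C ρ).α k = max 1 ⌈M.alphaReal cbar hbar C ρ k⌉₊ := rfl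
    rw [e, Nat.cast_max, Nat.cast_one]
    refine max_le (by linarith) ?_
    exact (Nat.cast_le.2 (Nat.ceil_le_ceil hle)).trans (Nat.ceil_lt_add_one hX0).le
  refine h1.trans ?_
  rw [add_div, ← hX]
  gcongr
  rwa [le_div_iff₀ hlρ, one_mul]

lemma Admissible.samples_le (h : M.Admissible cbar hbar) {m : ℕ} {a : ℝ} (ha0 : 0 ≤ a)
    (ha : ∀ k < m * M.epoch, ((M.schedule cbar hbar C ρ).α k : ℝ) ≤ a) :
    ((M.schedule cbar hbar C ρ).samples (m * M.epoch) : ℝ) ≤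
      a * (M.epoch * (24 * (M.t0 * M.thetaBar cbar hbar) * 2 ^ m +
        384 * (M.sigmaFsq cbar hbar / M.Lmin ^ 2) * 4 ^ m)) := by
  have hθ := h.thetaBar_ge
  have ht := h.t0_ge
  have hΛ := h.Lmin_pos
  have hσ : 0 ≤ M.sigmaFsq cbar hbar := le_trans (by positivity) h.sigmaFsq_ge.2
  rw [Schedule.samples]
  push_cast
  calc ∑ j ∈ Finset.range (m * M.epoch), ((M.schedule cbar hbar C ρ).T j : ℝ) *
        ((M.schedule cbar hbar C ρ).α j : ℝ)
      ≤ ∑ j ∈ Finset.range (m * M.epoch), (24 * (M.t0 * M.thetaBar cbar hbar) *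
          2 ^ (j / M.epoch) + 384 * (M.sigmaFsq cbar hbar / M.Lmin ^ 2) * 4 ^ (j / M.epoch)) * a :=
        Finset.sum_le_sum fun j hj => mul_le_mul (h.T_le j) (ha j (Finset.mem_range.1 hj))
          (Nat.cast_nonneg _) ((Nat.cast_nonneg _).trans (h.T_le (C := C) (ρ := ρ) j))
    _ = (24 * (M.t0 * M.thetaBar cbar hbar) *
          ∑ j ∈ Finset.range (m * M.epoch), 2 ^ (j / M.epoch) +
        384 * (M.sigmaFsq cbar hbar / M.Lmin ^ 2) *
          ∑ j ∈ Finset.range (m * M.epoch), 4 ^ (j / M.epoch)) * a := by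
        rw [← Finset.sum_mul, Finset.sum_add_distrib, ← Finset.mul_sum, ← Finset.mul_sum]
    _ ≤ (24 * (M.t0 * M.thetaBar cbar hbar) * (M.epoch * 2 ^ m) +
        384 * (M.sigmaFsq cbar hbar / M.Lmin ^ 2) * (M.epoch * 4 ^ m)) * a := by
        gcongr
        · exact sum_pow_div_le le_rfl epoch_pos m
        · exact sum_pow_div_le (by norm_num) epoch_pos m
    _ = _ := by ring

end RegMDP

/-- Number of epochs needed to reduce a constant `B` below `ε (1 - γ)`. -/
lemma exists_epochs {B g ε κ : ℝ} (hB : 1 ≤ B) (hg : 0 < g) (hg1 : g ≤ 1) (hκ : 0 < κ)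
    (hκ1 : κ < 1) (hε : 0 < ε) (hεκ : ε ≤ 1 - κ) (hεg : ε ≤ g ^ κ) :
    ∃ m : ℕ, B / (g * ε) ≤ 2 ^ m ∧ 2 ^ m ≤ 2 * (B / (g * ε)) ∧
      (m : ℝ) ≤ ((Real.log B / -Real.log (1 - κ) + 1 / κ + 1) / Real.log 2 +
        1 / -Real.log (1 - κ)) * -Real.log ε := by
  have hq0 : 0 < -Real.log (1 - κ) := neg_pos.2 (Real.log_neg (by linarith) (by linarith))
  have hq : -Real.log (1 - κ) ≤ -Real.log ε := neg_le_neg (Real.log_le_log hε hεκ)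
  have hlog2 : 0 < Real.log 2 := Real.log_pos (by norm_num)
  have hε1 : ε < 1 := by linarith
  set y := B / (g * ε) with hy
  have hy1 : 1 ≤ y := by
    rw [hy, one_le_div (by positivity)]
    nlinarith
  have hy0 : 0 < y := by linarith
  have hly : 0 ≤ Real.logb 2 y := Real.logb_nonneg (by norm_num) hy1
  -- The least power of two above `y` overshoots by at most a factor two. Its exponent is of order
  -- `-log ε`: `ε ≤ g^κ` controls `-log g`, and `ε ≤ 1 - κ` lets constants be absorbed.
  refine ⟨⌈Real.logb 2 y⌉₊, ?_, ?_, ?_⟩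
  · rw [← Real.rpow_natCast]
    calc y = 2 ^ Real.logb 2 y := (Real.rpow_logb (by norm_num) (by norm_num) hy0).symm
      _ ≤ _ := Real.rpow_le_rpow_of_exponent_le (by norm_num) (Nat.le_ceil _)
  · rw [← Real.rpow_natCast]
    calc (2 : ℝ) ^ (⌈Real.logb 2 y⌉₊ : ℝ) ≤ 2 ^ (Real.logb 2 y + 1) :=
          Real.rpow_le_rpow_of_exponent_le (by norm_num) (Nat.ceil_lt_add_one hly).le
      _ = 2 * y := by
          rw [Real.rpow_add (by norm_num), Real.rpow_logb (by norm_num) (by norm_num) hy0,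
            Real.rpow_one, mul_comm]
  · refine (Nat.ceil_lt_add_one hly).le.trans ?_
    have h1 : Real.log y = Real.log B + -Real.log g + -Real.log ε := by
      rw [hy, Real.log_div (by positivity) (by positivity), Real.log_mul hg.ne' hε.ne']
      ring
    have h2 : -Real.log g ≤ 1 / κ * -Real.log ε := by
      have h3 := Real.log_le_log hε hεg
      rw [Real.log_rpow hg] at h3
      rw [one_div_mul_eq_div, le_div_iff₀ hκ]
      linarith
    have h4 : Real.log B ≤ Real.log B / -Real.log (1 - κ) * -Real.log ε := by
      rw [div_mul_eq_mul_div, le_div_iff₀ hq0]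
      exact mul_le_mul_of_nonneg_left hq (Real.log_nonneg hB)
    have h5 : 1 ≤ 1 / -Real.log (1 - κ) * -Real.log ε := by
      rw [one_div_mul_eq_div, le_div_iff₀ hq0, one_mul]
      exact hq
    have h6 : Real.logb 2 y ≤ (Real.log B / -Real.log (1 - κ) + 1 / κ + 1) / Real.log 2 *
        -Real.log ε := by
      rw [Real.logb, div_mul_eq_mul_div]
      gcongr
      linarith
    linarith

namespace RegMDP

open MeasureTheory

variable {S A : Type*} [Fintype S] [Fintype A] [DecidableEq S] [DecidableEq A] [Nontrivial A]
  {M : RegMDP S A} {π πs : S → A → ℝ} {ν : S → ℝ} {cbar hbar C ρ κ : ℝ}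

lemma epoch_le (hκ : 0 < κ) (hκγ : κ ≤ M.γ) :
    (M.epoch : ℝ) ≤ (Real.log 4 + -Real.log κ) / -Real.log M.γ := by
  have hl : 0 < -Real.log M.γ := neg_pos.2 (Real.log_neg M.γ_pos M.γ_lt_one)
  have h1 : Real.logb M.γ (1 / 4) = Real.log 4 / -Real.log M.γ := by
    rw [logb_eq_neg_div_neg, one_div, Real.log_inv, neg_neg]
  have h2 : 0 ≤ Real.logb M.γ (1 / 4) := by
    rw [h1]
    have : 0 ≤ Real.log 4 := Real.log_nonneg (by norm_num)
    positivity
  refine (Nat.ceil_lt_add_one h2).le.trans ?_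
  rw [h1, add_div]
  gcongr
  rw [le_div_iff₀ hl, one_mul]
  exact neg_le_neg (Real.log_le_log hκ hκγ)

/-- The constant in the bound on the number of epochs. -/
noncomputable def epochConst (B κ : ℝ) : ℝ :=
  (Real.log B / -Real.log (1 - κ) + 1 / κ + 1) / Real.log 2 + 1 / -Real.log (1 - κ)

/-- The constant in the bound on the transitions per update. -/
noncomputable def blockConst (E κ : ℝ) : ℝ :=
  2 * E / -Real.log (1 - κ) + 8 / (-Real.log (1 - κ)) ^ 2 + 1 / -Real.log (1 - κ) +
    -Real.log κ / (-Real.log (1 - κ)) ^ 2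

/-- Since `q` and `x` are both at least `q₀`, each summand on the left is dominated by a multiple of
the product `q x`. This turns additive logarithmic terms into the multiplicative form of the
complexity bound. -/
lemma block_le {E q q₀ x r u m i : ℝ} (hq₀ : 0 < q₀) (hq : q₀ ≤ q) (hx : q₀ ≤ x) (hr : 0 < r)
    (hu : 0 ≤ u) (hm : m ≤ E * q) (hm0 : 0 ≤ m) (hi : i ≤ m) :
    (2 * (i + 2) + 4 + x + u) / r ≤
      (2 * E / q₀ + 8 / q₀ ^ 2 + 1 / q₀ + u / q₀ ^ 2) * q * (x / r) := by
  have hxq : 1 ≤ x / q₀ := (one_le_div hq₀).2 hx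
  have hqq : 1 ≤ q / q₀ := (one_le_div hq₀).2 hq
  have h0 : 0 ≤ q / q₀ * (x / q₀) - 1 := by nlinarith
  have e : (2 * E / q₀ + 8 / q₀ ^ 2 + 1 / q₀ + u / q₀ ^ 2) * q * (x / r) =
      (2 * (E * q) * (x / q₀) + 8 * (q / q₀ * (x / q₀)) + x * (q / q₀) +
        u * (q / q₀ * (x / q₀))) / r := by
    field_simp
  rw [e]
  refine div_le_div_of_nonneg_right ?_ hr.le
  have h1 : 2 * i ≤ 2 * (E * q) * (x / q₀) := by nlinarith
  have h2 : x ≤ x * (q / q₀) := le_mul_of_one_le_right (by linarith) hqq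
  nlinarith

variable {Ω : Type*} [MeasurableSpace Ω] {μ : Measure Ω} [IsProbabilityMeasure μ]
  {Z : ℕ → Ω → S × A}

/-- The constant in the iteration and sample complexity bounds. -/
noncomputable def complexityConst (B κ : ℝ) : ℝ :=
  epochConst B κ * (Real.log 4 + -Real.log κ) +
    blockConst (epochConst B κ) κ * (Real.log 4 + -Real.log κ) * (48 * B + 1536 * B ^ 2)

lemma epochConst_pos {B : ℝ} (hB : 1 ≤ B) (hκ : 0 < κ) (hκ1 : κ < 1) : 0 < epochConst B κ := by
  have hq0 : 0 < -Real.log (1 - κ) := neg_pos.2 (Real.log_neg (by linarith) (by linarith))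
  have hlog2 : 0 < Real.log 2 := Real.log_pos (by norm_num)
  have hlB := Real.log_nonneg hB
  unfold epochConst
  positivity

lemma blockConst_pos {E : ℝ} (hE : 0 < E) (hκ : 0 < κ) (hκ1 : κ < 1) : 0 < blockConst E κ := by
  have hq0 : 0 < -Real.log (1 - κ) := neg_pos.2 (Real.log_neg (by linarith) (by linarith))
  have hlκ : 0 < -Real.log κ := neg_pos.2 (Real.log_neg hκ hκ1)
  unfold blockConst
  positivity

lemma complexityConst_parts {B : ℝ} (hB : 1 ≤ B) (hκ : 0 < κ) (hκ1 : κ < 1) :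
    0 < epochConst B κ * (Real.log 4 + -Real.log κ) ∧
      0 < blockConst (epochConst B κ) κ * (Real.log 4 + -Real.log κ) *
        (48 * B + 1536 * B ^ 2) := by
  have hlκ : 0 < -Real.log κ := neg_pos.2 (Real.log_neg hκ hκ1)
  have hlog4 : 0 < Real.log 4 := Real.log_pos (by norm_num)
  have h1 := epochConst_pos hB hκ hκ1
  have h2 := blockConst_pos h1 hκ hκ1
  constructor <;> positivity

/-- Iteration and sample complexity. -/
lemma Admissible.complexity (h : M.Admissible cbar hbar) (hmix : M.MixingConst C ρ)
    (hZ : M.IsTrajectory (M.schedule cbar hbar C ρ) μ Z) (hπs : M.IsOptimal πs)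
    (hν : M.IsStationary πs ν) (hκ : 0 < κ) (hκ1 : κ < 1) (hκγ : κ ≤ M.γ) {B : ℝ}
    (hB : B = 2 * (|cbar| + |hbar|) + 3 * Real.sqrt (Real.log (Fintype.card A)) / Real.sqrt κ +
      5 / 2) {ε : ℝ} (hε : 0 < ε) (hεκ : ε ≤ 1 - κ) (hεγ : ε ≤ (1 - M.γ) ^ κ) :
    ∃ k : ℕ,
      (k : ℝ) ≤ complexityConst B κ * Real.logb M.γ ε ∧
      ∫ x, (M.f ν (M.iter (M.schedule cbar hbar C ρ) (fun n => Z n x) k) - M.f ν πs) ∂μ ≤ ε ∧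
      (κ ≤ ρ → M.Lmin / (C * M.Rsq cbar hbar) ≤ 1 - κ →
        ((M.schedule cbar hbar C ρ).samples k : ℝ) ≤
          complexityConst B κ * (Real.logb M.γ (1 / 2) * Real.logb 2 (1 / ε) *
            Real.logb ρ (M.Lmin / (C * M.Rsq cbar hbar)) *
            (M.t0 * M.thetaBar cbar hbar / ((1 - M.γ) * ε) +
              M.sigmaFsq cbar hbar / ((1 - M.γ) ^ 2 * M.Lmin ^ 2 * ε ^ 2)))) := by
  have hγ := M.γ_pos
  have hγ1 := M.one_sub_γ_pos
  have hB1 : 1 ≤ B := by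
    have : 0 ≤ 3 * Real.sqrt (Real.log (Fintype.card A)) / Real.sqrt κ := by positivity
    rw [hB]
    linarith [abs_nonneg cbar, abs_nonneg hbar]
  obtain ⟨hK1, hK2⟩ := complexityConst_parts hB1 hκ hκ1
  obtain ⟨m, hm1, hm2, hm3⟩ := exists_epochs hB1 hγ1 (by linarith) hκ hκ1 hε hεκ hεγ
  change (m : ℝ) ≤ epochConst B κ * -Real.log ε at hm3
  have hq0 : 0 < -Real.log (1 - κ) := neg_pos.2 (Real.log_neg (by linarith) (by linarith))
  have hq : -Real.log (1 - κ) ≤ -Real.log ε := neg_le_neg (Real.log_le_log hε hεκ)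
  have hlγ : 0 < -Real.log M.γ := neg_pos.2 (Real.log_neg M.γ_pos M.γ_lt_one)
  have hlκ : 0 < -Real.log κ := neg_pos.2 (Real.log_neg hκ hκ1)
  have hlog2 : 0 < Real.log 2 := Real.log_pos (by norm_num)
  have hlog4 : 0 < Real.log 4 := Real.log_pos (by norm_num)
  have hlB := Real.log_nonneg hB1
  have hEpos := epochConst_pos hB1 hκ hκ1
  have hl := epoch_le (M := M) hκ hκγ
  -- Stopping after exactly `m` epochs gives the prefactor `2^{-m}`, while all earlier iterations
  -- have epoch index below `m`.
  refine ⟨m * M.epoch, ?_, ?_, fun hκρ hx => ?_⟩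
  · have h1 : (m : ℝ) * M.epoch ≤ epochConst B κ * -Real.log ε *
        ((Real.log 4 + -Real.log κ) / -Real.log M.γ) :=
      mul_le_mul hm3 hl (Nat.cast_nonneg _) ((Nat.cast_nonneg _).trans hm3)
    have h2 : epochConst B κ * -Real.log ε * ((Real.log 4 + -Real.log κ) / -Real.log M.γ) =
        epochConst B κ * (Real.log 4 + -Real.log κ) * Real.logb M.γ ε := by
      rw [logb_eq_neg_div_neg]; ring
    have h3 : 0 ≤ Real.logb M.γ ε := by
      rw [logb_eq_neg_div_neg]
      exact div_nonneg (by linarith) hlγ.le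
    push_cast
    refine h1.trans ?_
    rw [h2, complexityConst]
    gcongr
    linarith
  · refine (h.convergence hmix hZ hπs hν _).trans ?_
    rw [Nat.mul_div_cancel _ epoch_pos]
    have h1 := h.bracket_le hπs.1 hν.1 hκ hκγ
    rw [← hB] at h1
    refine (mul_le_mul_of_nonneg_left h1 (by positivity)).trans ?_
    rw [div_pow, one_pow, one_div_mul_eq_div, div_le_iff₀ (by positivity), mul_comm ε]
    rw [div_le_iff₀ (by positivity)] at hm1 ⊢
    linarith
  · have hρ := hmix.2.1
    have hlρ : 0 < -Real.log ρ := neg_pos.2 (Real.log_neg hρ hmix.2.2.1)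
    have hΛ := h.Lmin_pos
    have hR : 0 < M.Rsq cbar hbar := by linarith [h.Rsq_ge]
    have hC := hmix.1
    set x := M.Lmin / (C * M.Rsq cbar hbar) with hxdef
    have hx0 : 0 < x := by positivity
    have hlx : -Real.log (1 - κ) ≤ -Real.log x := neg_le_neg (Real.log_le_log hx0 hx)
    have hθ := h.thetaBar_ge
    have ht := h.t0_ge
    have hσ : 0 ≤ M.sigmaFsq cbar hbar := le_trans (by positivity) h.sigmaFsq_ge.2
    set b := blockConst (epochConst B κ) κ with hb
    have hb0 : 0 < b := blockConst_pos hEpos hκ hκ1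
    have hlx0 : 0 < -Real.log x := by linarith
    have hq' : 0 < -Real.log ε := by linarith
    have hα : ∀ k < m * M.epoch, ((M.schedule cbar hbar C ρ).α k : ℝ) ≤
        b * -Real.log ε * (-Real.log x / -Real.log ρ) := by
      intro k hk
      refine (h.alpha_le hmix hκ hκρ (by linarith) k).trans ?_
      refine block_le hq0 hq hlx hlρ hlκ.le hm3 (Nat.cast_nonneg m) ?_
      exact Nat.cast_le.2 (Nat.div_le_of_le_mul (by rw [mul_comm]; exact hk.le))
    refine (h.samples_le (by positivity) hα).trans ?_
    set y := B / ((1 - M.γ) * ε) with hy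
    have hy0 : 0 < y := by positivity
    have h4 : (4 : ℝ) ^ m ≤ 4 * y ^ 2 := by
      have e : (4 : ℝ) ^ m = (2 ^ m) ^ 2 := by rw [← pow_mul, mul_comm, pow_mul]; norm_num
      rw [e]
      have := pow_le_pow_left₀ (by positivity) hm2 2
      linarith
    set U := M.t0 * M.thetaBar cbar hbar / ((1 - M.γ) * ε) with hU
    set W := M.sigmaFsq cbar hbar / ((1 - M.γ) ^ 2 * M.Lmin ^ 2 * ε ^ 2) with hW
    have hU0 : 0 ≤ U := by positivity
    have hW0 : 0 ≤ W := by positivity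
    have hsum : 24 * (M.t0 * M.thetaBar cbar hbar) * 2 ^ m +
        384 * (M.sigmaFsq cbar hbar / M.Lmin ^ 2) * 4 ^ m ≤
        (48 * B + 1536 * B ^ 2) * (U + W) := by
      have h5 : 24 * (M.t0 * M.thetaBar cbar hbar) * 2 ^ m ≤ 48 * B * U := by
        calc _ ≤ 24 * (M.t0 * M.thetaBar cbar hbar) * (2 * y) := by gcongr
          _ = _ := by rw [hy, hU]; field_simp; norm_num
      have h6 : 384 * (M.sigmaFsq cbar hbar / M.Lmin ^ 2) * 4 ^ m ≤ 1536 * B ^ 2 * W := by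
        calc _ ≤ 384 * (M.sigmaFsq cbar hbar / M.Lmin ^ 2) * (4 * y ^ 2) := by gcongr
          _ = _ := by rw [hy, hW]; field_simp; ring
      have h7 : 0 ≤ 48 * B * W := by positivity
      have h8 : 0 ≤ 1536 * B ^ 2 * U := by positivity
      linarith
    have e1 : Real.logb M.γ (1 / 2) = Real.log 2 / -Real.log M.γ := by
      rw [logb_eq_neg_div_neg, one_div, Real.log_inv, neg_neg]
    have e2 : Real.logb 2 (1 / ε) = -Real.log ε / Real.log 2 := by
      rw [Real.logb, one_div, Real.log_inv]
    rw [e1, e2, logb_eq_neg_div_neg ρ]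
    calc _ ≤ b * -Real.log ε * (-Real.log x / -Real.log ρ) *
          ((Real.log 4 + -Real.log κ) / -Real.log M.γ *
            ((48 * B + 1536 * B ^ 2) * (U + W))) := by
          gcongr
      _ = b * (Real.log 4 + -Real.log κ) * (48 * B + 1536 * B ^ 2) *
          (Real.log 2 / -Real.log M.γ * (-Real.log ε / Real.log 2) *
            (-Real.log x / -Real.log ρ) * (U + W)) := by
          field_simp
      _ ≤ _ := by
          rw [complexityConst]
          gcongr
          linarith

end RegMDP

theorem mainTheorem10 (A : Type*) [Fintype A] [DecidableEq A] [Nontrivial A]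
    (cbar hbar κ : ℝ) (hκ₀ : 0 < κ) (hκ₁ : κ < 1) :
    -- the constant hidden in the `O`-bounds
    ∃ K : ℝ, 0 < K ∧
      ∀ (S : Type*) [Fintype S] [DecidableEq S] (M : RegMDP S A),
        (∀ s a, |M.c s a| ≤ cbar) →
        (∀ s, ∀ p ∈ M.X s, |M.h s p| ≤ hbar) →
        (∀ s, uniformDist A ∈ M.X s) →
        M.Regular →
        (∃ C ρ, M.MixingConst C ρ) ∧
        ∀ C ρ, M.MixingConst C ρ →
        ∀ (Ω : Type*) [MeasurableSpace Ω] (ℙ : MeasureTheory.Measure Ω)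
          [MeasureTheory.IsProbabilityMeasure ℙ] (Z : ℕ → Ω → S × A),
          M.IsTrajectory (M.schedule cbar hbar C ρ) ℙ Z →
        ∀ πs νs, M.IsOptimal πs → M.IsStationary πs νs →
          -- the convergence relation, for every iteration `k`
          (∀ k : ℕ,
            MeasureTheory.Integrable
              (fun x => M.f νs (M.iter (M.schedule cbar hbar C ρ) (fun n => Z n x) k)) ℙ ∧
            ∫ x, (M.f νs (M.iter (M.schedule cbar hbar C ρ) (fun n => Z n x) k) - M.f νs πs) ∂ℙ ≤
              (1 / 2) ^ (k / M.epoch) *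
                (M.f νs (fun _ => uniformDist A) - M.f νs πs +
                  3 * Real.sqrt (Real.log (Fintype.card A)) / ((1 - M.γ) * Real.sqrt M.γ) +
                  5 / (2 * (1 - M.γ)))) ∧
          -- the iteration and sample complexities
          (κ ≤ M.γ → ∀ ε : ℝ, 0 < ε → ε ≤ 1 - κ → ε ≤ (1 - M.γ) ^ κ →
            ∃ k : ℕ,
              (k : ℝ) ≤ K * Real.logb M.γ ε ∧
              ∫ x, (M.f νs (M.iter (M.schedule cbar hbar C ρ) (fun n => Z n x) k) - M.f νs πs) ∂ℙ
                ≤ ε ∧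
              (κ ≤ ρ → M.Lmin / (C * M.Rsq cbar hbar) ≤ 1 - κ →
                ((M.schedule cbar hbar C ρ).samples k : ℝ) ≤
                  K * (Real.logb M.γ (1 / 2) * Real.logb 2 (1 / ε) *
                    Real.logb ρ (M.Lmin / (C * M.Rsq cbar hbar)) *
                    (M.t0 * M.thetaBar cbar hbar / ((1 - M.γ) * ε) +
                      M.sigmaFsq cbar hbar / ((1 - M.γ) ^ 2 * M.Lmin ^ 2 * ε ^ 2)))))

  := by
  set B : ℝ := 2 * (|cbar| + |hbar|) + 3 * Real.sqrt (Real.log (Fintype.card A)) / Real.sqrt κ +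
    5 / 2 with hB
  have hB1 : 1 ≤ B := by
    have : 0 ≤ 3 * Real.sqrt (Real.log (Fintype.card A)) / Real.sqrt κ := by positivity
    rw [hB]
    linarith [abs_nonneg cbar, abs_nonneg hbar]
  obtain ⟨hK1, hK2⟩ := RegMDP.complexityConst_parts hB1 hκ₀ hκ₁
  refine ⟨RegMDP.complexityConst B κ, add_pos hK1 hK2, fun S _ _ M hc hh hu hM =>
    ⟨M.exists_mixingConst hM hu, fun C ρ hmix Ω _ ℙ _ Z hZ πs νs hπs hνs => ?_⟩⟩
  -- The state space is nonempty because it carries the probability vector `νs`.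
  have h : M.Admissible cbar hbar := ⟨hc, hh, hu, hM, M.stationary_nonempty hνs⟩
  exact ⟨fun k => ⟨RegMDP.integrable_of_iter hZ (M.f νs) k, h.convergence hmix hZ hπs hνs k⟩,
    fun hκγ ε hε hεκ hεγ => h.complexity hmix hZ hπs hνs hκ₀ hκ₁ hκγ hB hε hεκ hεγ⟩
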